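/- Let $\mathbb T$ be the space of equivalence classes (root-preserving isometry classes) of rooted compact $\mathbb R$-trees, with the pointed Gromov–Hausdorff distance $d_{\rm GH}$ and its Borel $\sigma$-algebra, and let ${\rm ht}(T)=\sup_{x\in T}d(\rho,x)$ be the height of a tree with root $\rho$. A string is a triple $\xi=([0,\ell],(x_i)_{i\ge1},(p_i)_{i\ge1})$ with $\ell\ge 0$, $x_i\in[0,\ell]$ and $p_i\ge 0$. For $\beta>0$, a string $\xi$ and $\tau_1,\tau_2,\ldots\in\mathbb T$, let $\phi_\beta(\xi,(\tau_i)_{i\ge1})\in\mathbb T$ be the class of the tree with root $0$ that is obtained from $[0,\ell]$ by attaching to each $x_i$ the root of $\tau_i$ with its distances multiplied by $p_i^\beta$ (a single point if $p_i=0$), if this tree is compact, and the class of the one-point tree otherwise. Let $\beta>0$, $p\ge1$, and let $\nu$ be the law of a random string $\xi=([0,L],(X_i)_{i\ge1},(P_i)_{i\ge1})$ with $\mathbb E[L^p]<\infty$ and $\mathbb E\big[\sum_{j\ge1}P_j^{p\beta}\big]<1$. For a law $\eta$ on $\mathbb T$ let $\Phi_\beta(\eta)$ be the law of $\phi_\beta(\xi,(\tau_i)_{i\ge1})$,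 where $\tau_1,\tau_2,\ldots$ are i.i.d. with law $\eta$ and independent of $\xi$. Let $\mathcal P_p$ be the set of laws $\eta$ on $\mathbb T$ such that $\mathbb E[{\rm ht}(\tau)^p]<\infty$ for $\tau\sim\eta$, with the Wasserstein distance $W_p(\eta,\eta')=(\inf\mathbb E[d_{\rm GH}(\tau,\tau')^p])^{1/p}$, the infimum being over all couplings of $\tau\sim\eta$ and $\tau'\sim\eta'$. Let $\mathbb U=\bigcup_{n\ge0}\mathbb N^n$, and let $\xi_{\mathbf i}=([0,L_{\mathbf i}],(X_{\mathbf ij})_{j\ge1},(P_{\mathbf ij})_{j\ge1})$, $\mathbf i\in\mathbb U$, be i.i.d. strings with law $\nu$. For $n\ge0$ set $\tau^{(n)}_{\mathbf i}=[0,L_{\mathbf i}]$ (with root $0$) for $\mathbf i\in\mathbb N^n$ and, recursively, $\tau^{(n)}_{\mathbf i}=\phi_\beta\big(\xi_{\mathbf i},(\tau^{(n)}_{\mathbf ij})_{j\ge1}\big)$ for $\mathbf i\in\mathbb N^m$, $m=n-1,\ldots,0$. Put $\check{\mathcal T}_n=\tau^{(n)}_\varnothing$. **Theorem (recursive construction).**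 Each $\check{\mathcal T}_n$ is a random element of $\mathbb T$, and the sequence is increasing: almost surely, for every $n$, there is a root-preserving isometric embedding of $\check{\mathcal T}_n$ into $\check{\mathcal T}_{n+1}$. There is a random compact rooted $\mathbb R$-tree $\check{\mathcal T}$ (a random element of $\mathbb T$) such that $$\lim_{n\to\infty}d_{\rm GH}(\check{\mathcal T}_n,\check{\mathcal T})=0\quad\text{a.s.}$$ The law of $\check{\mathcal T}$ is the unique attractive fixpoint $\eta^*$ of $\Phi_\beta$ in $(\mathcal P_p,W_p)$: it belongs to $\mathcal P_p$, it satisfies $\Phi_\beta(\eta^*)=\eta^*$, it is the only fixpoint of $\Phi_\beta$ in $\mathcal P_p$, and $W_p(\Phi_\beta^n(\eta),\eta^*)\to0$ as $n\to\infty$ for every $\eta\in\mathcal P_p$. -/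

import Mathlib

open Set Filter Topology MeasureTheory ProbabilityTheory
open scoped ENNReal

noncomputable section

namespace StringTree

/-! ### Rooted compact real trees -/

/-- `h` restricted to `[0, d(x, y)]` is an isometric map from `x` to `y`. -/
structure IsGeodesic {M : Type*} [MetricSpace M] (x y : M) (h : ℝ → M) : Prop where
  dist_eq : ∀ s ∈ Icc 0 (dist x y), ∀ t ∈ Icc 0 (dist x y), dist (h s) (h t) = |s - t|
  left : h 0 = x
  right : h (dist x y) = y

/-- An `ℝ`-tree: any two points `x`, `y` are joined by a geodesic, and every injective path
`q : [0, 1] → T` from `x` to `y` has the same range as that geodesic. (Paths are encoded as functions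
on `ℝ` of which only the restriction to `[0, 1]` matters.) -/
def IsRTree (T : Type*) [MetricSpace T] : Prop :=
  ∀ x y : T, ∃ h : ℝ → T, IsGeodesic x y h ∧
    ∀ q : ℝ → T, ContinuousOn q (Icc 0 1) → InjOn q (Icc 0 1) → q 0 = x → q 1 = y →
      q '' Icc 0 1 = h '' Icc 0 (dist x y)

/-- A rooted compact `ℝ`-tree. -/
structure RootedRTree where
  carrier : Type
  [metric : MetricSpace carrier]
  [compact : CompactSpace carrier]
  root : carrier
  isRTree : IsRTree carrier

attribute [instance] RootedRTree.metric RootedRTree.compact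

/-- Two rooted compact `ℝ`-trees are equivalent if there is an isometry from the first onto the second
that maps root to root. -/
instance rootedRTreeSetoid : Setoid RootedRTree where
  r S T := ∃ e : S.carrier ≃ᵢ T.carrier, e S.root = T.root
  iseqv :=
    { refl := fun S => ⟨IsometryEquiv.refl _, rfl⟩
      symm := by
        rintro S T ⟨e, he⟩
        exact ⟨e.symm, by rw [← he, e.symm_apply_apply]⟩
      trans := by
        rintro S T U ⟨e, he⟩ ⟨f, hf⟩
        exact ⟨e.trans f, by rw [← hf, ← he]; rfl⟩ }

/-- The space `𝕋` of equivalence classes of rooted compact `ℝ`-trees. -/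
def TreeSpace : Type 1 := Quotient rootedRTreeSetoid

/-! ### The pointed Gromov–Hausdorff distance -/

/-- The pointed Gromov–Hausdorff distance of two rooted compact `ℝ`-trees: the infimum, over all
isometric embeddings `φ`, `φ'` into a common metric space `M`, of the maximum of the distance of the
images of the roots and the Hausdorff distance of the ranges. -/
def preGH (S T : RootedRTree) : ℝ :=
  sInf {r : ℝ | ∃ (M : Type) (_ : MetricSpace M) (φ : S.carrier → M) (φ' : T.carrier → M),
    Isometry φ ∧ Isometry φ' ∧
      r = max (dist (φ S.root) (φ' T.root)) (Metric.hausdorffDist (range φ) (range φ'))}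

lemma preGH_congr_aux {S S' T T' : RootedRTree} (hS : S ≈ S') (hT : T ≈ T') {r : ℝ}
    (h : ∃ (M : Type) (_ : MetricSpace M) (φ : S.carrier → M) (φ' : T.carrier → M),
      Isometry φ ∧ Isometry φ' ∧
        r = max (dist (φ S.root) (φ' T.root)) (Metric.hausdorffDist (range φ) (range φ'))) :
    ∃ (M : Type) (_ : MetricSpace M) (φ : S'.carrier → M) (φ' : T'.carrier → M),
      Isometry φ ∧ Isometry φ' ∧
        r = max (dist (φ S'.root) (φ' T'.root)) (Metric.hausdorffDist (range φ) (range φ')) := by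
  obtain ⟨e, he⟩ := Setoid.symm hS
  obtain ⟨f, hf⟩ := Setoid.symm hT
  obtain ⟨M, _, φ, φ', h1, h2, h3⟩ := h
  refine ⟨M, _, φ ∘ e, φ' ∘ f, h1.comp e.isometry, h2.comp f.isometry, ?_⟩
  rw [e.surjective.range_comp, f.surjective.range_comp, Function.comp, Function.comp, he, hf, h3]

/-- The pointed Gromov–Hausdorff distance on `𝕋`. -/
def dGH : TreeSpace → TreeSpace → ℝ :=
  Quotient.lift₂ preGH fun _ _ _ _ hS hT => congrArg sInf <| Set.ext fun _ =>
    ⟨preGH_congr_aux hS hT, preGH_congr_aux (Setoid.symm hS) (Setoid.symm hT)⟩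

/-- The topology of `(𝕋, dGH)`. -/
instance : TopologicalSpace TreeSpace where
  IsOpen U := ∀ x ∈ U, ∃ ε > 0, ∀ y, dGH x y < ε → y ∈ U
  isOpen_univ := fun _ _ => ⟨1, one_pos, fun _ _ => mem_univ _⟩
  isOpen_inter := fun U V hU hV x hx => by
    obtain ⟨ε, hε, h⟩ := hU x hx.1
    obtain ⟨δ, hδ, h'⟩ := hV x hx.2
    exact ⟨min ε δ, lt_min hε hδ, fun y hy =>
      ⟨h y (hy.trans_le (min_le_left _ _)), h' y (hy.trans_le (min_le_right _ _))⟩⟩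
  isOpen_sUnion := fun 𝒰 h x ⟨U, hU, hx⟩ => by
    obtain ⟨ε, hε, h'⟩ := h U hU x hx
    exact ⟨ε, hε, fun y hy => ⟨U, hU, h' y hy⟩⟩

/-- `𝕋` carries the Borel `σ`-algebra of `dGH`. -/
instance : MeasurableSpace TreeSpace := borel TreeSpace

instance : BorelSpace TreeSpace := ⟨rfl⟩

/-- The height of a rooted tree. -/
def preHeight (T : RootedRTree) : ℝ := ⨆ x : T.carrier, dist T.root x

/-- The height `ht` on `𝕋`. -/
def height : TreeSpace → ℝ :=
  Quotient.lift preHeight <| by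
    rintro S T ⟨e, he⟩
    refine e.surjective.iSup_congr _ fun x => ?_
    rw [← he, e.isometry.dist_eq]

/-- `S` embeds isometrically and root-preservingly into `T`. -/
def Embeds (S T : TreeSpace) : Prop :=
  ∃ f : (Quotient.out S).carrier → (Quotient.out T).carrier,
    Isometry f ∧ f (Quotient.out S).root = (Quotient.out T).root

/-! ### Arcs -/

/-- There is a geodesic from `x` to `y`, and it has the same range as every injective path from `x` to
`y`, whatever the parameter interval of the path is. -/
def ArcOK {M : Type*} [MetricSpace M] (x y : M) : Prop :=
  ∃ h : ℝ → M, IsGeodesic x y h ∧ ∀ a b : ℝ, a ≤ b → ∀ q : ℝ → M, ContinuousOn q (Icc a b) →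
    InjOn q (Icc a b) → q a = x → q b = y → q '' Icc a b = h '' Icc 0 (dist x y)

lemma IsRTree.arcOK {M : Type*} [MetricSpace M] (hM : IsRTree M) (x y : M) : ArcOK x y := by
  obtain ⟨h, hg, hq⟩ := hM x y
  refine ⟨h, hg, fun a b hab q qc qi qa qb => ?_⟩
  rcases hab.eq_or_lt with rfl | hab
  · have hxy : x = y := qa.symm.trans qb
    subst hxy
    simp [qa, hg.left]
  · have him : (fun t : ℝ => a + t * (b - a)) '' Icc 0 1 = Icc a b := by
      ext s
      constructor
      · rintro ⟨t, ⟨h0, h1⟩, rfl⟩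
        constructor <;> dsimp only <;> nlinarith
      · rintro ⟨h0, h1⟩
        have : 0 < b - a := by linarith
        refine ⟨(s - a) / (b - a), ⟨div_nonneg (by linarith) this.le, (div_le_one this).2 (by linarith)⟩, ?_⟩
        field_simp; ring
    have hmaps : MapsTo (fun t : ℝ => a + t * (b - a)) (Icc 0 1) (Icc a b) := by
      rw [← him]; exact mapsTo_image _ _
    have := hq (q ∘ fun t : ℝ => a + t * (b - a)) (qc.comp (by fun_prop) hmaps)
      (qi.comp (fun s _ t _ hst => by
        have : b - a ≠ 0 := by linarith
        simpa [this] using hst) hmaps) (by simpa using qa) (by simpa using qb)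
    rw [← this, image_comp, him]

lemma isRTree_of_arcOK {M : Type*} [MetricSpace M] (h : ∀ x y : M, ArcOK x y) : IsRTree M := by
  intro x y
  obtain ⟨g, hg, hq⟩ := h x y
  exact ⟨g, hg, fun q => hq 0 1 zero_le_one q⟩

/-- If `A` and `B` are closed, cover the space and meet in at most one point, then an injective path
with both ends in `A` stays in `A`. -/
lemma path_stays {M : Type*} [MetricSpace M] {A B : Set M} {c : M} (hA : IsClosed A)
    (hB : IsClosed B) (hAB : A ∪ B = univ) (hc : A ∩ B ⊆ {c}) {a b : ℝ} {q : ℝ → M}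
    (qc : ContinuousOn q (Icc a b)) (qi : InjOn q (Icc a b)) (ha : q a ∈ A) (hb : q b ∈ A)
    {t : ℝ} (ht : t ∈ Icc a b) : q t ∈ A := by
  by_contra hn
  have key : ∀ u v : ℝ, u ≤ v → Icc u v ⊆ Icc a b → (q u ∈ A ∧ q v ∈ B ∨ q u ∈ B ∧ q v ∈ A) →
      ∃ s ∈ Icc u v, q s = c := by
    intro u v huv hsub hor
    have hcov : Icc u v ⊆ (Icc u v ∩ q ⁻¹' A) ∪ (Icc u v ∩ q ⁻¹' B) := fun s hs => by
      have : q s ∈ A ∪ B := hAB ▸ mem_univ _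
      exact this.imp (fun h => ⟨hs, h⟩) (fun h => ⟨hs, h⟩)
    have h1 := (qc.mono hsub).preimage_isClosed_of_isClosed isClosed_Icc hA
    have h2 := (qc.mono hsub).preimage_isClosed_of_isClosed isClosed_Icc hB
    have hu : u ∈ Icc u v := left_mem_Icc.2 huv
    have hv : v ∈ Icc u v := right_mem_Icc.2 huv
    obtain ⟨s, hs, hs1, hs2⟩ := isPreconnected_closed_iff.1 (isPreconnected_Icc (a := u) (b := v))
      _ _ h1 h2 hcov
      (by rcases hor with h | h; exacts [⟨u, hu, hu, h.1⟩, ⟨v, hv, hv, h.2⟩])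
      (by rcases hor with h | h; exacts [⟨v, hv, hv, h.2⟩, ⟨u, hu, hu, h.1⟩])
    exact ⟨s, hs, hc ⟨hs1.2, hs2.2⟩⟩
  have htB : q t ∈ B := by
    have : q t ∈ A ∪ B := hAB ▸ mem_univ _
    exact this.resolve_left hn
  obtain ⟨s, hs, hsc⟩ := key a t ht.1 (Icc_subset_Icc_right ht.2) (Or.inl ⟨ha, htB⟩)
  obtain ⟨s', hs', hsc'⟩ := key t b ht.2 (Icc_subset_Icc_left ht.1) (Or.inr ⟨htB, hb⟩)
  have hss : s = s' := qi ⟨hs.1, hs.2.trans ht.2⟩ ⟨ht.1.trans hs'.1, hs'.2⟩ (hsc.trans hsc'.symm)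
  have hst : s = t := le_antisymm hs.2 (hss ▸ hs'.1)
  subst hst
  have hcA : ∀ w ∈ A, w ∈ B → w = c := fun w h1 h2 => hc ⟨h1, h2⟩
  -- the path is at `c` at time `s` only, and it is outside `A` on a neighbourhood of `s`
  have hne : s ≠ a := fun h => hn (h ▸ ha)
  have hlt : a < s := lt_of_le_of_ne ht.1 (Ne.symm hne)
  have hnhds : ∀ᶠ u in 𝓝[Icc a b] s, q u ∉ A :=
    (qc s ht).eventually (hA.isOpen_compl.mem_nhds hn)
  have hev : ∀ᶠ u in 𝓝[<] s, q u ∉ A := by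
    have : 𝓝[Ioo a s] s ≤ 𝓝[Icc a b] s :=
      nhdsWithin_mono _ fun u hu => ⟨hu.1.le, hu.2.le.trans ht.2⟩
    rw [← nhdsWithin_Ioo_eq_nhdsLT hlt]
    exact this hnhds
  obtain ⟨u, hu1, hu2⟩ := (hev.and (Ioo_mem_nhdsLT hlt)).exists
  have huB : q u ∈ B := by
    have : q u ∈ A ∪ B := hAB ▸ mem_univ _
    exact this.resolve_left hu1
  obtain ⟨w, hw, hwc⟩ := key a u hu2.1.le (Icc_subset_Icc_right (hu2.2.le.trans ht.2))
    (Or.inl ⟨ha, huB⟩)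
  have : w = s := qi ⟨hw.1, hw.2.trans (hu2.2.le.trans ht.2)⟩ ht (hwc.trans hsc.symm)
  linarith [hw.2, hu2.2]

/-- Concatenation of arcs at a point that separates the two ends. -/
lemma ArcOK.concat {M : Type*} [MetricSpace M] {A B : Set M} {x c y : M} (hA : IsClosed A)
    (hB : IsClosed B) (hAB : A ∪ B = univ) (hc : A ∩ B ⊆ {c}) (hx : x ∈ A) (hy : y ∈ B)
    (hd : dist x y = dist x c + dist c y) (h1 : ArcOK x c) (h2 : ArcOK c y) : ArcOK x y := by
  obtain ⟨g, hg, hgq⟩ := h1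
  obtain ⟨k, hk, hkq⟩ := h2
  set d := dist x c with hdd
  have hd0 : 0 ≤ d := dist_nonneg
  have hd1 : 0 ≤ dist c y := dist_nonneg
  let h : ℝ → M := fun s => if s ≤ d then g s else k (s - d)
  have hl : ∀ s, s ≤ d → h s = g s := fun s hs => if_pos hs
  have hr : ∀ s, d ≤ s → h s = k (s - d) := fun s hs => by
    rcases hs.eq_or_lt with rfl | hs
    · rw [hl _ le_rfl, hg.right, sub_self, hk.left]
    · exact if_neg (not_le.2 hs)
  have himg : h '' Icc 0 (dist x y) = g '' Icc 0 d ∪ k '' Icc 0 (dist c y) := by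
    ext w
    constructor
    · rintro ⟨s, ⟨hs0, hs1⟩, rfl⟩
      rcases le_total s d with hs | hs
      · exact Or.inl ⟨s, ⟨hs0, hs⟩, (hl s hs).symm⟩
      · exact Or.inr ⟨s - d, ⟨by linarith, by linarith⟩, (hr s hs).symm⟩
    · rintro (⟨s, ⟨hs0, hs1⟩, rfl⟩ | ⟨s, ⟨hs0, hs1⟩, rfl⟩)
      · exact ⟨s, ⟨hs0, by linarith⟩, hl s hs1⟩
      · exact ⟨s + d, ⟨by linarith, by linarith⟩, by rw [hr _ (by linarith), add_sub_cancel_right]⟩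
  have hmix : ∀ s ∈ Icc 0 (dist x y), ∀ t ∈ Icc 0 (dist x y), s ≤ d → d ≤ t →
      dist (h s) (h t) = t - s := by
    intro s hs t ht hsd hdt
    rw [hl s hsd, hr t hdt]
    have e1 : dist (g s) c = d - s := by
      have := hg.dist_eq s ⟨hs.1, hsd⟩ d ⟨hd0, le_rfl⟩
      rw [hg.right] at this
      rw [this, abs_sub_comm, abs_of_nonneg (by linarith)]
    have e2 : dist c (k (t - d)) = t - d := by
      have := hk.dist_eq 0 ⟨le_rfl, hd1⟩ (t - d) ⟨by linarith, by linarith [ht.2]⟩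
      rw [hk.left] at this
      rw [this, zero_sub, abs_neg, abs_of_nonneg (by linarith)]
    have e3 : dist x (g s) = s := by
      have := hg.dist_eq 0 ⟨le_rfl, hd0⟩ s ⟨hs.1, hsd⟩
      rw [hg.left] at this
      rw [this, zero_sub, abs_neg, abs_of_nonneg hs.1]
    have e4 : dist (k (t - d)) y = dist c y - (t - d) := by
      have := hk.dist_eq (t - d) ⟨by linarith, by linarith [ht.2]⟩ _ ⟨hd1, le_rfl⟩
      rw [hk.right] at this
      rw [this, abs_sub_comm, abs_of_nonneg (by linarith [ht.2])]
    have t1 := dist_triangle (g s) c (k (t - d))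
    have t2 := dist_triangle4 x (g s) (k (t - d)) y
    linarith
  refine ⟨h, ⟨?_, ?_, ?_⟩, ?_⟩
  · intro s hs t ht
    rcases le_total s d with hsd | hsd <;> rcases le_total t d with htd | htd
    · rw [hl s hsd, hl t htd]
      exact hg.dist_eq s ⟨hs.1, hsd⟩ t ⟨ht.1, htd⟩
    · rw [hmix s hs t ht hsd htd, abs_sub_comm, abs_of_nonneg (by linarith)]
    · rw [dist_comm, hmix t ht s hs htd hsd, abs_of_nonneg (by linarith)]
    · rw [hr s hsd, hr t htd, hk.dist_eq _ ⟨by linarith, by linarith [hs.2]⟩ _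
        ⟨by linarith, by linarith [ht.2]⟩]
      congr 1; ring
  · rw [hl 0 hd0, hg.left]
  · rw [hr _ (by linarith), hd, add_sub_cancel_left, hk.right]
  · intro a b hab q qc qi qa qb
    have hcov : Icc a b ⊆ (Icc a b ∩ q ⁻¹' A) ∪ (Icc a b ∩ q ⁻¹' B) := fun s hs => by
      have : q s ∈ A ∪ B := hAB ▸ mem_univ _
      exact this.imp (fun h => ⟨hs, h⟩) (fun h => ⟨hs, h⟩)
    obtain ⟨s, hs, hs1, hs2⟩ := isPreconnected_closed_iff.1 (isPreconnected_Icc (a := a) (b := b))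
      _ _ (qc.preimage_isClosed_of_isClosed isClosed_Icc hA)
      (qc.preimage_isClosed_of_isClosed isClosed_Icc hB) hcov
      ⟨a, left_mem_Icc.2 hab, left_mem_Icc.2 hab, by rw [mem_preimage, qa]; exact hx⟩
      ⟨b, right_mem_Icc.2 hab, right_mem_Icc.2 hab, by rw [mem_preimage, qb]; exact hy⟩
    have hsc : q s = c := hc ⟨hs1.2, hs2.2⟩
    have i1 : Icc a s ⊆ Icc a b := Icc_subset_Icc_right hs.2
    have i2 : Icc s b ⊆ Icc a b := Icc_subset_Icc_left hs.1
    rw [himg, ← hgq a s hs.1 q (qc.mono i1) (qi.mono i1) qa hsc,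
      ← hkq s b hs.2 q (qc.mono i2) (qi.mono i2) hsc qb, ← image_union, Icc_union_Icc_eq_Icc hs.1 hs.2]

/-- Transport of arcs along a similarity, if injective paths do not leave its range. -/
lemma ArcOK.transfer {N M : Type*} [MetricSpace N] [MetricSpace M] {f : N → M} {r : ℝ} (hr : 0 < r)
    (hf : ∀ u v, dist (f u) (f v) = r * dist u v) {u v : N} (h : ArcOK u v)
    (hstay : ∀ a b : ℝ, a ≤ b → ∀ q : ℝ → M, ContinuousOn q (Icc a b) → InjOn q (Icc a b) →
      q a = f u → q b = f v → ∀ t ∈ Icc a b, q t ∈ range f) : ArcOK (f u) (f v) := by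
  obtain ⟨g, hg, hq⟩ := h
  have hfi : Function.Injective f := fun u v huv => by
    have := hf u v
    rw [huv, dist_self] at this
    exact dist_eq_zero.1 ((mul_eq_zero.1 this.symm).resolve_left hr.ne')
  have hdiv : (fun s => s / r) '' Icc 0 (dist (f u) (f v)) = Icc 0 (dist u v) := by
    ext s
    rw [hf]
    constructor
    · rintro ⟨t, ⟨h0, h1⟩, rfl⟩
      exact ⟨div_nonneg h0 hr.le, (div_le_iff₀ hr).2 (by linarith)⟩
    · rintro ⟨h0, h1⟩
      exact ⟨r * s, ⟨by positivity, by gcongr⟩, by field_simp⟩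
  have hdm : ∀ s ∈ Icc 0 (dist (f u) (f v)), s / r ∈ Icc 0 (dist u v) := fun s hs =>
    hdiv ▸ mem_image_of_mem (fun s => s / r) hs
  refine ⟨fun s => f (g (s / r)), ⟨?_, ?_, ?_⟩, ?_⟩
  · intro s hs t ht
    rw [hf, hg.dist_eq _ (hdm s hs) _ (hdm t ht), ← sub_div, abs_div, abs_of_pos hr]
    field_simp
  · simp [hg.left]
  · rw [hf, mul_div_cancel_left₀ _ hr.ne', hg.right]
  · intro a b hab q qc qi qa qb
    have hst := hstay a b hab q qc qi qa qb
    have : Nonempty N := ⟨u⟩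
    choose! p hp using hst
    have hpd : ∀ s ∈ Icc a b, ∀ t ∈ Icc a b, dist (p s) (p t) = r⁻¹ * dist (q s) (q t) :=
      fun s hs t ht => by
        rw [← hp s hs, ← hp t ht, hf]; field_simp
    have hab1 := left_mem_Icc.2 hab
    have hab2 := right_mem_Icc.2 hab
    have himg : q '' Icc a b = f '' (p '' Icc a b) := by
      rw [image_image]
      exact image_congr fun s hs => (hp s hs).symm
    have hpc : ContinuousOn p (Icc a b) := by
      intro s hs
      rw [ContinuousWithinAt, tendsto_iff_dist_tendsto_zero]
      have := ((tendsto_iff_dist_tendsto_zero.1 (qc s hs)).const_mul r⁻¹)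
      rw [mul_zero] at this
      refine this.congr' ?_
      filter_upwards [self_mem_nhdsWithin] with t ht using (hpd t ht s hs).symm
    rw [himg, hq a b hab p hpc (fun s hs t ht hst => qi hs ht (by rw [← hp s hs, ← hp t ht, hst]))
      (hfi (by rw [hp a hab1, qa])) (hfi (by rw [hp b hab2, qb])), ← hdiv, image_image, image_image]

/-- A compact interval is an `ℝ`-tree. -/
lemma isRTree_Icc (ℓ : ℝ) (hℓ : 0 ≤ ℓ) : IsRTree (Icc (0 : ℝ) ℓ) := by
  intro x y
  have hx := x.2
  have hy := y.2
  have harc : ∀ q : ℝ → Icc (0 : ℝ) ℓ, ContinuousOn q (Icc 0 1) → InjOn q (Icc 0 1) →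
      q 0 = x → q 1 = y → q '' Icc 0 1 = Subtype.val ⁻¹' uIcc (x : ℝ) y := by
    intro q qc qi q0 q1
    let f : ℝ → ℝ := fun t => q t
    have fc : ContinuousOn f (Icc 0 1) := continuous_subtype_val.comp_continuousOn qc
    have fi : InjOn f (Icc 0 1) := Subtype.val_injective.comp_injOn qi
    have hsub : uIcc (f 0) (f 1) ⊆ f '' Icc 0 1 := by
      have := intermediate_value_uIcc (f := f) (a := 0) (b := 1) (by rwa [uIcc_of_le zero_le_one])
      rwa [uIcc_of_le (zero_le_one' ℝ)] at this
    have hsup : ∀ t ∈ Icc (0 : ℝ) 1, f t ∈ uIcc (f 0) (f 1) := by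
      intro t ht
      rcases fc.strictMonoOn_of_injOn_Icc' zero_le_one fi with hm | hm
      · exact mem_uIcc_of_le (hm.monotoneOn (by simp) ht ht.1) (hm.monotoneOn ht (by simp) ht.2)
      · exact mem_uIcc_of_ge (hm.antitoneOn ht (by simp) ht.2) (hm.antitoneOn (by simp) ht ht.1)
    have e0 : f 0 = x := congrArg Subtype.val q0
    have e1 : f 1 = y := congrArg Subtype.val q1
    rw [e0, e1] at hsub hsup
    ext w
    constructor
    · rintro ⟨t, ht, rfl⟩
      exact hsup t ht
    · intro hw
      obtain ⟨t, ht, htw⟩ := hsub hw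
      exact ⟨t, ht, Subtype.ext htw⟩
  rcases le_total (x : ℝ) y with hxy | hxy
  · have hd : dist x y = y - x := by
      rw [Subtype.dist_eq, Real.dist_eq, abs_sub_comm, abs_of_nonneg (by linarith)]
    have hv : ∀ s ∈ Icc 0 (dist x y), (projIcc 0 ℓ hℓ (x + s) : ℝ) = x + s := fun s hs => by
      rw [hd] at hs
      rw [projIcc_of_mem hℓ ⟨by linarith [hs.1, hx.1], by linarith [hs.2, hy.2]⟩]
    refine ⟨fun s => projIcc 0 ℓ hℓ (x + s), ⟨?_, ?_, ?_⟩, ?_⟩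
    · intro s hs t ht
      rw [Subtype.dist_eq, hv s hs, hv t ht, Real.dist_eq]
      congr 1; ring
    · simp
    · exact Subtype.ext (by rw [hv _ ⟨dist_nonneg, le_rfl⟩, hd]; ring)
    · intro q qc qi q0 q1
      rw [harc q qc qi q0 q1, uIcc_of_le hxy]
      ext w
      constructor
      · intro hw
        have hs : (w : ℝ) - x ∈ Icc 0 (dist x y) := by
          rw [hd]; exact ⟨by linarith [hw.1], by linarith [hw.2]⟩
        exact ⟨w - x, hs, Subtype.ext (by rw [hv _ hs]; ring)⟩
      · rintro ⟨s, hs, rfl⟩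
        rw [mem_preimage, hv s hs]
        rw [hd] at hs
        exact ⟨by linarith [hs.1], by linarith [hs.2]⟩
  · have hd : dist x y = x - y := by
      rw [Subtype.dist_eq, Real.dist_eq, abs_of_nonneg (by linarith)]
    have hv : ∀ s ∈ Icc 0 (dist x y), (projIcc 0 ℓ hℓ (x - s) : ℝ) = x - s := fun s hs => by
      rw [hd] at hs
      rw [projIcc_of_mem hℓ ⟨by linarith [hs.2, hy.1], by linarith [hs.1, hx.2]⟩]
    refine ⟨fun s => projIcc 0 ℓ hℓ (x - s), ⟨?_, ?_, ?_⟩, ?_⟩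
    · intro s hs t ht
      rw [Subtype.dist_eq, hv s hs, hv t ht, Real.dist_eq, abs_sub_comm]
      congr 1; ring
    · simp
    · exact Subtype.ext (by rw [hv _ ⟨dist_nonneg, le_rfl⟩, hd]; ring)
    · intro q qc qi q0 q1
      rw [harc q qc qi q0 q1, uIcc_of_ge hxy]
      ext w
      constructor
      · intro hw
        have hs : (x : ℝ) - w ∈ Icc 0 (dist x y) := by
          rw [hd]; exact ⟨by linarith [hw.2], by linarith [hw.1]⟩
        exact ⟨x - w, hs, Subtype.ext (by rw [hv _ hs]; ring)⟩
      · rintro ⟨s, hs, rfl⟩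
        rw [mem_preimage, hv s hs]
        rw [hd] at hs
        exact ⟨by linarith [hs.2], by linarith [hs.1]⟩

/-- The class of the one-point tree. -/
def onePoint : TreeSpace :=
  Quotient.mk _ ⟨Unit, (), fun x y => ⟨fun _ => x, ⟨fun _ _ _ _ => by simp_all, rfl, rfl⟩,
    fun _ _ _ _ _ => by
      ext; simpa using ⟨0, le_rfl, zero_le_one⟩⟩⟩

/-! ### Strings and grafting -/

/-- The space `Ξ` of strings `([0, ℓ], (x_i), (p_i))`: a length `ℓ ≥ 0`, locations `x_i ∈ [0, ℓ]`, not
necessarily distinct, and atom masses `p_i ≥ 0`, not necessarily summable. The atoms are indexed by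
`ℕ`, starting at `0`. It carries the product `σ`-algebra. -/
abbrev BeadString : Type :=
  {s : ℝ × (ℕ → ℝ) × (ℕ → ℝ) // 0 ≤ s.1 ∧ ∀ i, s.2.1 i ∈ Icc 0 s.1 ∧ 0 ≤ s.2.2 i}

namespace BeadString

/-- The length `ℓ`. -/
def len (s : BeadString) : ℝ := s.1.1

/-- The location `x_i`. -/
def loc (s : BeadString) (i : ℕ) : ℝ := s.1.2.1 i

/-- The mass `p_i`. -/
def mass (s : BeadString) (i : ℕ) : ℝ := s.1.2.2 i

lemma len_nonneg (s : BeadString) : 0 ≤ s.len := s.2.1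

lemma loc_mem (s : BeadString) (i : ℕ) : s.loc i ∈ Icc 0 s.len := (s.2.2 i).1

lemma mass_nonneg (s : BeadString) (i : ℕ) : 0 ≤ s.mass i := (s.2.2 i).2

/-- The class of the tree `[0, ℓ]` with root `0`. -/
def segment (s : BeadString) : TreeSpace :=
  Quotient.mk _ ⟨Icc (0 : ℝ) s.len, ⟨0, left_mem_Icc.2 s.len_nonneg⟩, isRTree_Icc _ s.len_nonneg⟩

end BeadString

/-- The disjoint union of `[0, ℓ]` and of the trees `τ_i`. -/
def PreGraft (_β : ℝ) (s : BeadString) (t : ℕ → RootedRTree) : Type :=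
  Icc (0 : ℝ) s.len ⊕ Σ i, (t i).carrier

open Classical in
/-- The distance of the grafted tree: each `τ_i` is scaled by `p_i ^ β` and its root is placed at
`x_i`. -/
def graftDist (β : ℝ) (s : BeadString) (t : ℕ → RootedRTree) :
    PreGraft β s t → PreGraft β s t → ℝ
  | .inl x, .inl y => |(x : ℝ) - y|
  | .inl x, .inr ⟨j, v⟩ => |(x : ℝ) - s.loc j| + s.mass j ^ β * dist (t j).root v
  | .inr ⟨i, u⟩, .inl y => s.mass i ^ β * dist u (t i).root + |s.loc i - (y : ℝ)|
  | .inr ⟨i, u⟩, .inr ⟨j, v⟩ =>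
      if h : i = j then s.mass j ^ β * dist (h ▸ u : (t j).carrier) v
      else s.mass i ^ β * dist u (t i).root + |s.loc i - s.loc j| + s.mass j ^ β * dist (t j).root v

section Graft

variable {β : ℝ} {s : BeadString} {t : ℕ → RootedRTree}

lemma scale_nonneg (β : ℝ) (s : BeadString) (i : ℕ) : 0 ≤ s.mass i ^ β :=
  Real.rpow_nonneg (s.mass_nonneg i) β

lemma graftDist_same (i : ℕ) (u v : (t i).carrier) :
    graftDist β s t (.inr ⟨i, u⟩) (.inr ⟨i, v⟩) = s.mass i ^ β * dist u v := by
  simp [graftDist]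

lemma graftDist_ne {i j : ℕ} (h : i ≠ j) (u : (t i).carrier) (v : (t j).carrier) :
    graftDist β s t (.inr ⟨i, u⟩) (.inr ⟨j, v⟩) =
      s.mass i ^ β * dist u (t i).root + |s.loc i - s.loc j| + s.mass j ^ β * dist (t j).root v := by
  simp [graftDist, h]

lemma scale_triangle (i : ℕ) (u v w : (t i).carrier) :
    s.mass i ^ β * dist u w ≤ s.mass i ^ β * dist u v + s.mass i ^ β * dist v w := by
  rw [← mul_add]
  exact mul_le_mul_of_nonneg_left (dist_triangle u v w) (scale_nonneg β s i)

lemma scale_dist_nonneg (i : ℕ) (u v : (t i).carrier) : 0 ≤ s.mass i ^ β * dist u v :=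
  mul_nonneg (scale_nonneg β s i) dist_nonneg

lemma graftDist_triangle (x y z : PreGraft β s t) :
    graftDist β s t x z ≤ graftDist β s t x y + graftDist β s t y z := by
  rcases x with x | ⟨i, u⟩ <;> rcases y with y | ⟨j, v⟩ <;> rcases z with z | ⟨k, w⟩
  · exact abs_sub_le _ _ _
  · simp only [graftDist]
    linarith [abs_sub_le (x : ℝ) y (s.loc k)]
  · simp only [graftDist]
    linarith [abs_sub_le (x : ℝ) (s.loc j) z, scale_dist_nonneg (β := β) (s := s) j v (t j).root,
      scale_dist_nonneg (β := β) (s := s) j (t j).root v]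
  · by_cases h : j = k
    · subst h
      rw [graftDist_same]
      simp only [graftDist]
      linarith [scale_triangle (β := β) (s := s) j (t j).root v w]
    · rw [graftDist_ne h]
      simp only [graftDist]
      linarith [abs_sub_le (x : ℝ) (s.loc j) (s.loc k),
        scale_dist_nonneg (β := β) (s := s) j v (t j).root,
        scale_dist_nonneg (β := β) (s := s) j (t j).root v]
  · simp only [graftDist]
    linarith [abs_sub_le (s.loc i) (y : ℝ) z]
  · by_cases h : i = k
    · subst h
      rw [graftDist_same]
      simp only [graftDist]
      linarith [scale_triangle (β := β) (s := s) i u (t i).root w, abs_nonneg (s.loc i - (y : ℝ)),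
        abs_nonneg ((y : ℝ) - s.loc i)]
    · rw [graftDist_ne h]
      simp only [graftDist]
      linarith [abs_sub_le (s.loc i) (y : ℝ) (s.loc k)]
  · by_cases h : i = j
    · subst h
      rw [graftDist_same]
      simp only [graftDist]
      linarith [scale_triangle (β := β) (s := s) i u v (t i).root]
    · rw [graftDist_ne h]
      simp only [graftDist]
      linarith [abs_sub_le (s.loc i) (s.loc j) (z : ℝ),
        scale_dist_nonneg (β := β) (s := s) j v (t j).root,
        scale_dist_nonneg (β := β) (s := s) j (t j).root v]
  · by_cases h : i = j <;> by_cases h' : j = k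
    · subst h; subst h'
      simp only [graftDist_same]
      exact scale_triangle i u v w
    · subst h
      rw [graftDist_same, graftDist_ne h', graftDist_ne h']
      linarith [scale_triangle (β := β) (s := s) i u v (t i).root]
    · subst h'
      rw [graftDist_same, graftDist_ne h, graftDist_ne h]
      linarith [scale_triangle (β := β) (s := s) j (t j).root v w]
    · have p1 := scale_dist_nonneg (β := β) (s := s) j v (t j).root
      have p2 := scale_dist_nonneg (β := β) (s := s) j (t j).root v
      rw [graftDist_ne h, graftDist_ne h']
      by_cases h'' : i = k
      · subst h''
        rw [graftDist_same]
        linarith [scale_triangle (β := β) (s := s) i u (t i).root w,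
          abs_nonneg (s.loc i - s.loc j), abs_nonneg (s.loc j - s.loc i)]
      · rw [graftDist_ne h'']
        linarith [abs_sub_le (s.loc i) (s.loc j) (s.loc k)]

instance : PseudoMetricSpace (PreGraft β s t) where
  dist := graftDist β s t
  dist_self := by
    rintro (x | ⟨i, u⟩)
    · simp [graftDist]
    · simp [graftDist]
  dist_comm := by
    rintro (x | ⟨i, u⟩) (y | ⟨j, v⟩)
    · exact abs_sub_comm _ _
    · simp only [graftDist]
      rw [abs_sub_comm, dist_comm, add_comm]
    · simp only [graftDist]
      rw [abs_sub_comm, dist_comm, add_comm]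
    · by_cases h : i = j
      · subst h
        rw [graftDist_same, graftDist_same, dist_comm]
      · rw [graftDist_ne h, graftDist_ne (Ne.symm h), abs_sub_comm, dist_comm u, dist_comm v]
        ring
  dist_triangle := graftDist_triangle

end Graft

/-- The grafted tree: points at distance `0` are identified, in particular the root of `τ_i` and `x_i`,
and the whole of `τ_i` and `x_i` if `p_i = 0`. -/
abbrev Graft (β : ℝ) (s : BeadString) (t : ℕ → RootedRTree) : Type :=
  SeparationQuotient (PreGraft β s t)

namespace Graft

variable {β : ℝ} {s : BeadString} {t : ℕ → RootedRTree}

/-- The inclusion of `[0, ℓ]`. -/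
def base (x : Icc (0 : ℝ) s.len) : Graft β s t :=
  SeparationQuotient.mk (X := PreGraft β s t) (Sum.inl x)

/-- The map from `τ_i` to the grafted tree. -/
def branch (i : ℕ) (u : (t i).carrier) : Graft β s t :=
  SeparationQuotient.mk (X := PreGraft β s t) (Sum.inr ⟨i, u⟩)

/-- The location `x_i`, as a point of the grafted tree. -/
def site (i : ℕ) : Graft β s t := base ⟨s.loc i, s.loc_mem i⟩

/-- The root is the point `0` of `[0, ℓ]`. -/
def root (β : ℝ) (s : BeadString) (t : ℕ → RootedRTree) : Graft β s t :=
  base ⟨0, left_mem_Icc.2 s.len_nonneg⟩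

lemma dist_base (x y : Icc (0 : ℝ) s.len) :
    dist (base x : Graft β s t) (base y) = dist x y := rfl

lemma dist_branch (i : ℕ) (u v : (t i).carrier) :
    dist (branch i u : Graft β s t) (branch i v) = s.mass i ^ β * dist u v :=
  graftDist_same i u v

lemma dist_base_branch (x : Icc (0 : ℝ) s.len) (i : ℕ) (u : (t i).carrier) :
    dist (base x : Graft β s t) (branch i u) =
      dist (base x : Graft β s t) (site i) + s.mass i ^ β * dist (t i).root u := rfl

lemma dist_branch_ne {i j : ℕ} (h : i ≠ j) (u : (t i).carrier) (v : (t j).carrier) :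
    dist (branch i u : Graft β s t) (branch j v) =
      s.mass i ^ β * dist u (t i).root + dist (site i : Graft β s t) (site j) +
        s.mass j ^ β * dist (t j).root v :=
  graftDist_ne h u v

lemma branch_root (i : ℕ) : (branch i (t i).root : Graft β s t) = site i := by
  refine dist_eq_zero.1 ?_
  rw [dist_comm, site, dist_base_branch, site, dist_self, dist_self]
  simp

lemma dist_site_branch (i : ℕ) (u : (t i).carrier) :
    dist (site i : Graft β s t) (branch i u) = s.mass i ^ β * dist (t i).root u := by
  rw [← branch_root, dist_branch]

lemma cases (z : Graft β s t) : (∃ x, z = base x) ∨ ∃ i u, z = branch i u := by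
  obtain ⟨z, rfl⟩ := SeparationQuotient.surjective_mk z
  rcases z with x | ⟨i, u⟩
  · exact Or.inl ⟨x, rfl⟩
  · exact Or.inr ⟨i, u, rfl⟩

/-- The part of the grafted tree that is separated from `τ_i` by `x_i`. -/
def away (i : ℕ) : Set (Graft β s t) :=
  {z | ∀ u : (t i).carrier, dist z (branch i u : Graft β s t) =
    dist z (site i : Graft β s t) + dist (site i : Graft β s t) (branch i u)}

lemma mem_away {i : ℕ} {z : Graft β s t} : z ∈ away i ↔ ∀ u : (t i).carrier,
    dist z (branch i u : Graft β s t) =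
      dist z (site i : Graft β s t) + dist (site i : Graft β s t) (branch i u) := Iff.rfl

lemma isClosed_away (i : ℕ) : IsClosed (away i : Set (Graft β s t)) := by
  simp only [away, ofPred_forall]
  exact isClosed_iInter fun u => isClosed_eq (by fun_prop) (by fun_prop)

lemma isClosed_range_branch (i : ℕ) : IsClosed (range (branch i : _ → Graft β s t)) := by
  have : LipschitzWith ⟨s.mass i ^ β, scale_nonneg β s i⟩ (branch i : _ → Graft β s t) :=
    LipschitzWith.of_dist_le_mul fun u v => (dist_branch i u v).le
  exact (isCompact_range this.continuous).isClosed

lemma base_mem_away (x : Icc (0 : ℝ) s.len) (i : ℕ) : (base x : Graft β s t) ∈ away i :=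
    mem_away.2 fun u => by
  rw [dist_base_branch, dist_site_branch]

lemma branch_mem_away {i j : ℕ} (h : j ≠ i) (v : (t j).carrier) :
    (branch j v : Graft β s t) ∈ away i :=
    mem_away.2 fun u => by
  have e : dist (site i : Graft β s t) (branch j v) =
      dist (site i : Graft β s t) (site j) + s.mass j ^ β * dist (t j).root v :=
    dist_base_branch _ j v
  rw [dist_branch_ne h, dist_site_branch, dist_comm (branch j v), e, dist_comm v,
    dist_comm (site i) (site j)]
  ring

lemma cover (i : ℕ) : away i ∪ range (branch i) = (univ : Set (Graft β s t)) := by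
  refine eq_univ_of_forall fun z => ?_
  rcases cases z with ⟨x, rfl⟩ | ⟨j, u, rfl⟩
  · exact Or.inl (base_mem_away x i)
  · by_cases h : j = i
    · subst h
      exact Or.inr ⟨u, rfl⟩
    · exact Or.inl (branch_mem_away h u)

lemma inter (i : ℕ) : away i ∩ range (branch i) ⊆ {(site i : Graft β s t)} := by
  rintro z ⟨hz, u, rfl⟩
  have := mem_away.1 hz u
  rw [dist_self, dist_comm (site i)] at this
  exact dist_eq_zero.1 (by linarith)

lemma arcOK_base (x y : Icc (0 : ℝ) s.len) : ArcOK (base x : Graft β s t) (base y) := by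
  refine ArcOK.transfer (r := 1) one_pos (fun u v => by rw [one_mul]; exact dist_base u v)
    ((isRTree_Icc _ s.len_nonneg).arcOK x y) ?_
  intro a b _ q qc qi qa qb r hr
  have hr' : ∀ i, q r ∈ away i := fun i =>
    path_stays (isClosed_away i) (isClosed_range_branch i) (cover i) (inter i) qc qi
      (qa ▸ base_mem_away x i) (qb ▸ base_mem_away y i) hr
  rcases cases (q r) with ⟨z, hz⟩ | ⟨i, u, hu⟩
  · exact ⟨z, hz.symm⟩
  · exact ⟨_, (inter i ⟨hr' i, u, hu.symm⟩).symm⟩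

lemma arcOK_branch (i : ℕ) (u v : (t i).carrier) :
    ArcOK (branch i u : Graft β s t) (branch i v) := by
  rcases (scale_nonneg β s i).eq_or_lt with h | h
  · have huv : (branch i u : Graft β s t) = branch i v :=
      dist_eq_zero.1 (by rw [dist_branch, ← h, zero_mul])
    rw [← huv]
    refine ⟨fun _ => branch i u, ⟨fun a ha b hb => ?_, rfl, rfl⟩, fun a b hab q _ qi qa qb => ?_⟩
    · rw [dist_self] at ha hb
      rw [Icc_self, mem_singleton_iff] at ha hb
      simp [ha, hb]
    · have : a = b := qi (left_mem_Icc.2 hab) (right_mem_Icc.2 hab) (qa.trans qb.symm)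
      subst this
      simp [qa]
  · refine ArcOK.transfer h (dist_branch i) ((t i).isRTree.arcOK u v) ?_
    intro a b _ q qc qi qa qb r hr
    exact path_stays (isClosed_range_branch i) (isClosed_away i) (by rw [union_comm, cover i])
      (by rw [inter_comm]; exact inter i) qc qi (qa ▸ mem_range_self u) (qb ▸ mem_range_self v) hr

lemma arcOK_away {i : ℕ} {z : Graft β s t} (hz : z ∈ away i) (h : ArcOK z (site i))
    (u : (t i).carrier) : ArcOK z (branch i u) := by
  refine ArcOK.concat (isClosed_away i) (isClosed_range_branch i) (cover i) (inter i) hz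
    (mem_range_self u) (mem_away.1 hz u) h ?_
  rw [← branch_root]
  exact arcOK_branch i _ u

lemma arcOK_branch_away {i : ℕ} {z : Graft β s t} (hz : z ∈ away i) (h : ArcOK (site i) z)
    (u : (t i).carrier) : ArcOK (branch i u) z := by
  refine ArcOK.concat (isClosed_range_branch i) (isClosed_away i) (by rw [union_comm, cover i])
    (by rw [inter_comm]; exact inter i) (mem_range_self u) hz ?_ ?_ h
  · rw [dist_comm, mem_away.1 hz u, dist_comm z, dist_comm (site i) (branch i u), add_comm]
  · rw [← branch_root]
    exact arcOK_branch i u _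

/-- The grafted tree is an `ℝ`-tree. -/
lemma isRTree (β : ℝ) (s : BeadString) (t : ℕ → RootedRTree) : IsRTree (Graft β s t) := by
  refine isRTree_of_arcOK fun z w => ?_
  rcases cases z with ⟨x, rfl⟩ | ⟨i, u, rfl⟩ <;> rcases cases w with ⟨y, rfl⟩ | ⟨j, v, rfl⟩
  · exact arcOK_base x y
  · exact arcOK_away (base_mem_away x j) (arcOK_base _ _) v
  · exact arcOK_branch_away (base_mem_away y i) (arcOK_base _ _) u
  · by_cases h : i = j
    · subst h
      exact arcOK_branch i u v
    · exact arcOK_away (branch_mem_away h u)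
        (arcOK_branch_away (base_mem_away _ i) (arcOK_base _ _) u) v

end Graft

open Classical in
/-- The grafting map `φ_β : Ξ × 𝕋^ℕ → 𝕋`: the class of the grafted tree if the latter is compact, and the
class of the one-point tree otherwise. -/
def phi (β : ℝ) (s : BeadString) (τ : ℕ → TreeSpace) : TreeSpace :=
  if _h : CompactSpace (Graft β s fun i => (τ i).out) then
    Quotient.mk _ ⟨Graft β s fun i => (τ i).out, Graft.root β s _, Graft.isRTree β s _⟩
  else onePoint

/-! ### The distributional equation and its fixpoint -/

/-- The map `Φ_β` on laws on `𝕋`: `Φ_β(η)` is the law of `φ_β(ξ, (τ_i))` where `ξ ∼ ν` and the i.i.d.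
sequence `(τ_i)` with law `η` are independent. -/
def Phi (β : ℝ) (ν : Measure BeadString) (η : Measure TreeSpace) : Measure TreeSpace :=
  (ν.prod (Measure.infinitePi fun _ : ℕ => η)).map fun z => phi β z.1 z.2

/-- The set `𝒫_p` of laws on `𝕋` with finite `p`-th moment of the height. -/
def finiteMomentLaws (p : ℝ) : Set (Measure TreeSpace) :=
  {η | IsProbabilityMeasure η ∧ ∫⁻ τ, ENNReal.ofReal (height τ ^ p) ∂η < ∞}

/-- The Wasserstein distance `W_p` of two laws on `𝕋`: the infimum is over all couplings. -/
def wasserstein (p : ℝ) (η η' : Measure TreeSpace) : ℝ≥0∞ :=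
  (⨅ (γ : Measure (TreeSpace × TreeSpace)) (_ : γ.map Prod.fst = η ∧ γ.map Prod.snd = η'),
    ∫⁻ z, ENNReal.ofReal (dGH z.1 z.2 ^ p) ∂γ) ^ (1 / p)

/-- `ηs` is the unique fixpoint of `Φ_β` in `𝒫_p`, and it attracts all of `(𝒫_p, W_p)`. -/
structure IsUniqueAttractiveFixpoint (β p : ℝ) (ν : Measure BeadString) (ηs : Measure TreeSpace) :
    Prop where
  mem : ηs ∈ finiteMomentLaws p
  fixed : Phi β ν ηs = ηs
  unique : ∀ η ∈ finiteMomentLaws p, Phi β ν η = η → η = ηs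
  attractive : ∀ η ∈ finiteMomentLaws p,
    Tendsto (fun n => wasserstein p ((Phi β ν)^[n] η) ηs) atTop (𝓝 0)

/-! ### The recursive construction -/

/-- `subtree β ξ k i` is the tree that is built from the strings at the individual `i` of the
Ulam–Harris tree and at its descendants of the next `k` generations. Individuals are finite
words over `ℕ`, and the `j`-th child of `i` is `i ++ [j]`. So the tree `τ_i^{(n)}` is
`subtree β ξ (n - i.length) i`. -/
def subtree (β : ℝ) (ξ : List ℕ → BeadString) : ℕ → List ℕ → TreeSpace
  | 0, i => (ξ i).segment
  | k + 1, i => phi β (ξ i) fun j => subtree β ξ k (i ++ [j])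

/-- The tree `Ť_n = τ_∅^{(n)}`. -/
def recTree (β : ℝ) (ξ : List ℕ → BeadString) (n : ℕ) : TreeSpace := subtree β ξ n []

end StringTree

end

/-! Grafting contracts in mean. In a grafted tree, a path between different branches runs through
their sites, so replacing each `τ i` by `τ' i` moves the grafted tree by at most the supremum of
`s.mass i ^ β * dist (τ i) (τ' i)` (`dist_phi_le`). The `p`-th power of a supremum is at most the
sum of the `p`-th powers (`ofReal_dist_phi_le`), and by independence the expectation of that sum is
`massMoment β p ν < 1` times the `p`-th moment of the distance in one pair (`lintegral_powerSum`).
Feeding coupled trees into the same string therefore multiplies the coupling cost by at most this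
factor (`couplingCost_couplingMap_le`). Iterating from a product coupling gives uniqueness and
attraction, because laws with couplings of arbitrarily small cost agree (`eq_of_couplingCost`).
Completeness of the Wasserstein space is not needed: the fixpoint comes from the recursive
construction.

That construction converges path by path. Generation `n + 1` almost surely only adds rescaled
segments to the previous tree, which embeds in the new one with a gap of at most the `p`-th root of
`generationSum` (`ae_embedsDense`). The expected gaps decay geometrically, so they are summable
almost surely (`ae_summable`). An increasing sequence with summable gaps converges to the completion
of its inductive limit (`exists_tendsto_of_embedsDense`). This completion is totally bounded, hence
compact. It is a real tree because the four-point condition is closed and because approximate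
geodesic points become exact in a compact space.

The branching property (`recTree_succ`, `map_branching`) shows that one step of the construction is
one application of `Phi`. The limit, and the graft of the limits attached to the first generation,
are both `L^p`-close to the same finite trees, so they are almost surely at distance zero and have
the same law (`Phi_map_limit`). Height moments are bounded uniformly by Minkowski's inequality
(`heightMoment_recTree_le`) and pass to the limit by Fatou's lemma.

Two preparations make this work. `dGH` is replaced by the comparable pseudo-distance `treeDist`, for
which the triangle inequality and stability under grafting follow directly from composing and gluing
relations. And `phi` is measurable because graftability is the measurable condition that the
rescaled heights tend to zero, and on it `phi` is a limit of continuous truncations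
(`measurable_phi`). -/

noncomputable section

namespace StringTree

/-! ### A distance by relations -/

/-- There is a relation between `S` and `T`, total on both sides, that changes distances to the root by
at most `r` and arbitrary distances by at most `2 * r`. -/
def RClose {S T : Type*} [MetricSpace S] [MetricSpace T] (ρ : S) (ρ' : T) (r : ℝ) : Prop :=
  ∃ R : S → T → Prop, (∀ x, ∃ y, R x y) ∧ (∀ y, ∃ x, R x y) ∧
    (∀ x y, R x y → |dist ρ x - dist ρ' y| ≤ r) ∧
    ∀ x y x' y', R x y → R x' y' → |dist x x' - dist y y'| ≤ 2 * r

section RClose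

variable {S T U : Type*} [MetricSpace S] [MetricSpace T] [MetricSpace U]
  {ρ : S} {ρ' : T} {ρ'' : U} {r r' : ℝ}

lemma RClose.nonneg (h : RClose ρ ρ' r) : 0 ≤ r := by
  obtain ⟨R, h1, -, h3, -⟩ := h
  obtain ⟨y, hy⟩ := h1 ρ
  exact (abs_nonneg _).trans (h3 _ _ hy)

lemma RClose.mono (h : RClose ρ ρ' r) (hr : r ≤ r') : RClose ρ ρ' r' := by
  obtain ⟨R, h1, h2, h3, h4⟩ := h
  exact ⟨R, h1, h2, fun x y h => (h3 x y h).trans hr,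
    fun x y x' y' h h' => (h4 x y x' y' h h').trans (by linarith)⟩

lemma RClose.symm (h : RClose ρ ρ' r) : RClose ρ' ρ r := by
  obtain ⟨R, h1, h2, h3, h4⟩ := h
  refine ⟨fun y x => R x y, h2, h1, fun y x h => ?_, fun y x y' x' h h' => ?_⟩
  · rw [abs_sub_comm]; exact h3 x y h
  · rw [abs_sub_comm]; exact h4 x y x' y' h h'

lemma RClose.trans (h : RClose ρ ρ' r) (h' : RClose ρ' ρ'' r') : RClose ρ ρ'' (r + r') := by
  obtain ⟨R, h1, h2, h3, h4⟩ := h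
  obtain ⟨R', h1', h2', h3', h4'⟩ := h'
  refine ⟨fun x z => ∃ y, R x y ∧ R' y z, fun x => ?_, fun z => ?_, ?_, ?_⟩
  · obtain ⟨y, hy⟩ := h1 x
    obtain ⟨z, hz⟩ := h1' y
    exact ⟨z, y, hy, hz⟩
  · obtain ⟨y, hy⟩ := h2' z
    obtain ⟨x, hx⟩ := h2 y
    exact ⟨x, y, hx, hy⟩
  · rintro x z ⟨y, hy, hz⟩
    have := abs_sub_le (dist ρ x) (dist ρ' y) (dist ρ'' z)
    linarith [h3 x y hy, h3' y z hz]
  · rintro x z x' z' ⟨y, hy, hz⟩ ⟨y', hy', hz'⟩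
    have := abs_sub_le (dist x x') (dist y y') (dist z z')
    linarith [h4 x y x' y' hy hy', h4' y z y' z' hz hz']

/-- The relation is proximity of `f x` and `y`. Since `f` fixes the root, a root distance moves at
one end only, by `r`, while a general distance moves at both ends, by `2 * r`. -/
lemma RClose.of_isometry_of_dense {f : S → T} (hf : Isometry f) (hρ : f ρ = ρ') (hr : 0 ≤ r)
    (hd : ∀ y, ∃ x, dist (f x) y ≤ r) : RClose ρ ρ' r := by
  refine ⟨fun x y => dist (f x) y ≤ r, fun x => ⟨f x, by simpa using hr⟩, hd, fun x y h => ?_,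
    fun x y x' y' h h' => ?_⟩
  · rw [← hf.dist_eq, hρ, dist_comm, dist_comm ρ' y]
    exact (abs_dist_sub_le _ _ _).trans h
  · rw [← hf.dist_eq]
    have h1 := abs_dist_sub_le (f x) y (f x')
    have h2 := abs_dist_sub_le (f x') y' y
    rw [dist_comm (f x') y, dist_comm y' y] at h2
    have := abs_sub_le (dist (f x) (f x')) (dist y (f x')) (dist y y')
    linarith

lemma RClose.of_isometryEquiv (e : S ≃ᵢ T) (he : e ρ = ρ') : RClose ρ ρ' 0 :=
  .of_isometry_of_dense e.isometry he le_rfl fun y => ⟨e.symm y, by simp⟩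

lemma RClose.of_bound (hS : ∀ x, dist ρ x ≤ r) (hT : ∀ y, dist ρ' y ≤ r) : RClose ρ ρ' r := by
  refine ⟨fun _ _ => True, fun _ => ⟨ρ', trivial⟩, fun _ => ⟨ρ, trivial⟩, fun x y _ => ?_,
    fun x y x' y' _ _ => ?_⟩
  · exact abs_sub_le_of_nonneg_of_le dist_nonneg (hS x) dist_nonneg (hT y)
  · have h1 := dist_triangle_left x x' ρ
    have h2 := dist_triangle_left y y' ρ'
    refine abs_sub_le_of_nonneg_of_le dist_nonneg ?_ dist_nonneg ?_
    · linarith [hS x, hS x']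
    · linarith [hT y, hT y']

lemma RClose.dist_le (h : RClose ρ ρ' r) {a : ℝ} (ha : ∀ x, dist ρ x ≤ a) (y : T) :
    dist ρ' y ≤ a + r := by
  obtain ⟨R, h1, h2, h3, h4⟩ := h
  obtain ⟨x, hx⟩ := h2 y
  linarith [(abs_le.1 (h3 x y hx)).1, ha x]

lemma RClose.of_common {M : Type*} [MetricSpace M] {φ : S → M} {φ' : T → M} (hφ : Isometry φ)
    (hφ' : Isometry φ') (hρ : dist (φ ρ) (φ' ρ') ≤ r) (h1 : ∀ x, ∃ y, dist (φ x) (φ' y) ≤ r)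
    (h2 : ∀ y, ∃ x, dist (φ x) (φ' y) ≤ r) : RClose ρ ρ' (2 * r) := by
  have key : ∀ x y x' y', dist (φ x) (φ' y) ≤ r → dist (φ x') (φ' y') ≤ r →
      |dist x x' - dist y y'| ≤ 2 * r := by
    intro x y x' y' h h'
    rw [← hφ.dist_eq, ← hφ'.dist_eq]
    have t1 := dist_triangle4 (φ x) (φ' y) (φ' y') (φ x')
    have t2 := dist_triangle4 (φ' y) (φ x) (φ x') (φ' y')
    rw [dist_comm (φ' y') (φ x')] at t1
    rw [dist_comm (φ' y) (φ x)] at t2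
    rw [abs_le]
    constructor <;> linarith
  refine ⟨fun x y => dist (φ x) (φ' y) ≤ r, h1, h2, fun x y h => key _ _ _ _ hρ h,
    fun x y x' y' h h' => (key _ _ _ _ h h').trans ?_⟩
  linarith [dist_nonneg.trans hρ]

end RClose

/-! ### Comparison of relations with the pointed Gromov–Hausdorff distance. -/

/-- Both trees sit in `ℓ^∞` by the Kuratowski embedding, so the infimum that defines `preGH` is a
genuine one and can be approximated. -/
lemma preGH_nonempty (S T : RootedRTree) : {r : ℝ | ∃ (M : Type) (_ : MetricSpace M)
    (φ : S.carrier → M) (φ' : T.carrier → M), Isometry φ ∧ Isometry φ' ∧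
      r = max (dist (φ S.root) (φ' T.root)) (Metric.hausdorffDist (range φ) (range φ'))}.Nonempty :=
  ⟨_, ↥(lp (fun _ : ℕ => ℝ) ∞), inferInstance, kuratowskiEmbedding S.carrier,
    kuratowskiEmbedding T.carrier, kuratowskiEmbedding.isometry _, kuratowskiEmbedding.isometry _,
    rfl⟩

/-- The two trees are glued into one metric space in which related points are at distance `r + ε`.
The extra `ε` makes the gap positive even when `r = 0`, as a metric on the disjoint union requires.
-/
lemma preGH_le_of_rclose {S T : RootedRTree} {r : ℝ} (h : RClose S.root T.root r) :
    preGH S T ≤ r := by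
  have hr := h.nonneg
  refine le_of_forall_pos_le_add fun ε hε => ?_
  obtain ⟨R, h1, h2, h3, h4⟩ := h
  -- The pair of roots is added to the relation so that the glued metric also controls the distance
  -- of the roots. The bound on root distances keeps the distortion of the enlarged relation below
  -- `2 * (r + ε)`.
  let Z := {z : S.carrier × T.carrier // z = (S.root, T.root) ∨ R z.1 z.2}
  let Φ : Z → S.carrier := fun z => z.1.1
  let Ψ : Z → T.carrier := fun z => z.1.2
  have : Nonempty Z := ⟨⟨(S.root, T.root), Or.inl rfl⟩⟩
  have hdist : ∀ p q : Z, |dist (Φ p) (Φ q) - dist (Ψ p) (Ψ q)| ≤ 2 * (r + ε) := by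
    rintro ⟨⟨x, y⟩, hxy⟩ ⟨⟨x', y'⟩, hxy'⟩
    rcases hxy with hxy | hxy <;> rcases hxy' with hxy' | hxy' <;>
      simp only [Prod.mk.injEq] at hxy hxy' <;> dsimp only [Φ, Ψ]
    · rw [hxy.1, hxy.2, hxy'.1, hxy'.2]
      simp; positivity
    · rw [hxy.1, hxy.2]
      linarith [h3 _ _ hxy']
    · rw [hxy'.1, hxy'.2, dist_comm, dist_comm y]
      linarith [h3 _ _ hxy]
    · linarith [h4 _ _ _ _ hxy hxy']
  let : MetricSpace (S.carrier ⊕ T.carrier) :=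
    Metric.glueMetricApprox Φ Ψ (r + ε) (by positivity) hdist
  have hg : ∀ z : Z, dist (Sum.inl (Φ z) : S.carrier ⊕ T.carrier) (Sum.inr (Ψ z)) = r + ε :=
    Metric.glueDist_glued_points Φ Ψ (r + ε)
  have hR : ∀ x y, R x y → dist (Sum.inl x : S.carrier ⊕ T.carrier) (Sum.inr y) = r + ε :=
    fun x y h => hg ⟨(x, y), Or.inr h⟩
  have hφ : Isometry (Sum.inl : S.carrier → S.carrier ⊕ T.carrier) :=
    Isometry.of_dist_eq fun _ _ => rfl
  have hφ' : Isometry (Sum.inr : T.carrier → S.carrier ⊕ T.carrier) :=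
    Isometry.of_dist_eq fun _ _ => rfl
  have hmem : ∃ (M : Type) (_ : MetricSpace M) (φ : S.carrier → M) (φ' : T.carrier → M),
      Isometry φ ∧ Isometry φ' ∧ max (dist (Sum.inl S.root : S.carrier ⊕ T.carrier)
        (Sum.inr T.root)) (Metric.hausdorffDist (range (Sum.inl : S.carrier → S.carrier ⊕ T.carrier))
          (range Sum.inr)) = max (dist (φ S.root) (φ' T.root))
            (Metric.hausdorffDist (range φ) (range φ')) :=
    ⟨_, this, Sum.inl, Sum.inr, hφ, hφ', rfl⟩
  refine le_trans (b := max (dist (Sum.inl S.root : S.carrier ⊕ T.carrier) (Sum.inr T.root))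
    (Metric.hausdorffDist (range (Sum.inl : S.carrier → S.carrier ⊕ T.carrier)) (range Sum.inr)))
    (csInf_le ⟨0, ?_⟩ hmem) (max_le ?_ ?_)
  · rintro _ ⟨M, _, φ, φ', -, -, rfl⟩
    exact le_max_of_le_left dist_nonneg
  · exact (hg ⟨(S.root, T.root), Or.inl rfl⟩).le
  · refine Metric.hausdorffDist_le_of_mem_dist (by positivity) ?_ ?_
    · rintro _ ⟨x, rfl⟩
      obtain ⟨y, hy⟩ := h1 x
      exact ⟨_, ⟨y, rfl⟩, (hR x y hy).le⟩
    · rintro _ ⟨y, rfl⟩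
      obtain ⟨x, hx⟩ := h2 y
      exact ⟨_, ⟨x, rfl⟩, by rw [dist_comm]; exact (hR x y hx).le⟩

lemma rclose_of_preGH_lt {S T : RootedRTree} {r : ℝ} (h : preGH S T < r) :
    RClose S.root T.root (2 * r) := by
  obtain ⟨_, ⟨M, _, φ, φ', hφ, hφ', rfl⟩, hr⟩ := exists_lt_of_csInf_lt (preGH_nonempty S T) h
  obtain ⟨h1, h2⟩ := max_lt_iff.1 hr
  have hfin : Metric.hausdorffEDist (range φ) (range φ') ≠ ⊤ :=
    Metric.hausdorffEDist_ne_top_of_nonempty_of_bounded ⟨_, mem_range_self S.root⟩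
      ⟨_, mem_range_self T.root⟩
      (isCompact_range hφ.continuous).isBounded (isCompact_range hφ'.continuous).isBounded
  refine RClose.of_common hφ hφ' h1.le (fun x => ?_) fun y => ?_
  · obtain ⟨_, ⟨y, rfl⟩, hy⟩ := Metric.exists_dist_lt_of_hausdorffDist_lt (mem_range_self x) h2 hfin
    exact ⟨y, hy.le⟩
  · obtain ⟨_, ⟨x, rfl⟩, hx⟩ := Metric.exists_dist_lt_of_hausdorffDist_lt' (mem_range_self y) h2 hfin
    exact ⟨x, hx.le⟩

/-- A pseudo-distance on `𝕋` that lies between `dGH` and `2 * dGH`. -/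
def treeDist (x y : TreeSpace) : ℝ := sInf {r : ℝ | RClose x.out.root y.out.root r}

lemma rclose_out_mk (S : RootedRTree) :
    RClose (Quotient.out (⟦S⟧ : TreeSpace)).root S.root 0 := by
  obtain ⟨e, he⟩ := Quotient.exact (Quotient.out_eq (⟦S⟧ : TreeSpace))
  exact .of_isometryEquiv e he

lemma dist_root_le_preHeight (T : RootedRTree) (x : T.carrier) : dist T.root x ≤ preHeight T :=
  le_ciSup (f := fun x => dist T.root x)
    (isCompact_range (continuous_const.dist continuous_id)).bddAbove x

lemma preHeight_nonneg (T : RootedRTree) : 0 ≤ preHeight T :=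
  dist_nonneg.trans (dist_root_le_preHeight T T.root)

lemma preHeight_le (T : RootedRTree) {a : ℝ} (h : ∀ x, dist T.root x ≤ a) : preHeight T ≤ a :=
  have : Nonempty T.carrier := ⟨T.root⟩
  ciSup_le h

lemma height_eq (x : TreeSpace) : height x = preHeight x.out := by
  conv_lhs => rw [← Quotient.out_eq x]
  rfl

lemma height_nonneg (x : TreeSpace) : 0 ≤ height x := by
  rw [height_eq]; exact preHeight_nonneg _

lemma dist_root_le_height (x : TreeSpace) (u : x.out.carrier) : dist x.out.root u ≤ height x := by
  rw [height_eq]; exact dist_root_le_preHeight _ u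

lemma rclose_height (x y : TreeSpace) :
    RClose x.out.root y.out.root (max (height x) (height y)) :=
  .of_bound (fun u => (dist_root_le_height x u).trans (le_max_left _ _))
    fun u => (dist_root_le_height y u).trans (le_max_right _ _)

lemma treeDist_le {x y : TreeSpace} {r : ℝ} (h : RClose x.out.root y.out.root r) :
    treeDist x y ≤ r :=
  csInf_le ⟨0, fun _ h => h.nonneg⟩ h

lemma treeDist_nonneg (x y : TreeSpace) : 0 ≤ treeDist x y :=
  Real.sInf_nonneg fun _ h => h.nonneg

lemma rclose_of_treeDist_lt {x y : TreeSpace} {r : ℝ} (h : treeDist x y < r) :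
    RClose x.out.root y.out.root r := by
  have hne : {r : ℝ | RClose x.out.root y.out.root r}.Nonempty := ⟨_, rclose_height x y⟩
  obtain ⟨r', hr', hlt⟩ := exists_lt_of_csInf_lt hne h
  exact RClose.mono hr' hlt.le

lemma treeDist_mk_le {S T : RootedRTree} {r : ℝ} (h : RClose S.root T.root r) :
    treeDist ⟦S⟧ ⟦T⟧ ≤ r :=
  treeDist_le <| by simpa using (rclose_out_mk S).trans (h.trans (rclose_out_mk T).symm)

lemma treeDist_self (x : TreeSpace) : treeDist x x = 0 :=
  (treeDist_le (.of_isometryEquiv (IsometryEquiv.refl _) rfl)).antisymm (treeDist_nonneg _ _)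

lemma treeDist_comm (x y : TreeSpace) : treeDist x y = treeDist y x := by
  unfold treeDist
  congr 1
  ext r
  exact ⟨RClose.symm, RClose.symm⟩

lemma treeDist_triangle (x y z : TreeSpace) : treeDist x z ≤ treeDist x y + treeDist y z := by
  refine le_of_forall_pos_le_add fun ε hε => ?_
  have h1 := rclose_of_treeDist_lt (show treeDist x y < treeDist x y + ε / 2 by linarith)
  have h2 := rclose_of_treeDist_lt (show treeDist y z < treeDist y z + ε / 2 by linarith)
  linarith [treeDist_le (h1.trans h2)]

lemma dGH_eq (x y : TreeSpace) : dGH x y = preGH x.out y.out := by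
  conv_lhs => rw [← Quotient.out_eq x, ← Quotient.out_eq y]
  rfl

lemma dGH_nonneg (x y : TreeSpace) : 0 ≤ dGH x y := by
  rw [dGH_eq]
  refine Real.sInf_nonneg ?_
  rintro _ ⟨M, _, φ, φ', -, -, rfl⟩
  exact le_max_of_le_left dist_nonneg

lemma dGH_le_treeDist (x y : TreeSpace) : dGH x y ≤ treeDist x y := by
  rw [dGH_eq]
  exact le_csInf ⟨_, rclose_height x y⟩ fun r hr => preGH_le_of_rclose hr

lemma treeDist_le_dGH (x y : TreeSpace) : treeDist x y ≤ 2 * dGH x y := by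
  refine le_of_forall_pos_le_add fun ε hε => ?_
  have := rclose_of_preGH_lt (show preGH x.out y.out < dGH x y + ε / 2 by rw [dGH_eq]; linarith)
  linarith [treeDist_le this]

instance : PseudoMetricSpace TreeSpace :=
  PseudoMetricSpace.replaceTopology
    { dist := treeDist
      dist_self := treeDist_self
      dist_comm := treeDist_comm
      dist_triangle := treeDist_triangle } <| by
    refine TopologicalSpace.ext <| funext fun U => propext ?_
    let m : PseudoMetricSpace TreeSpace :=
      { dist := treeDist
        dist_self := treeDist_self
        dist_comm := treeDist_comm
        dist_triangle := treeDist_triangle }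
    refine Iff.trans ?_ (@Metric.isOpen_iff TreeSpace m U).symm
    refine forall₂_congr fun x _ => ⟨?_, ?_⟩
    · rintro ⟨ε, hε, h⟩
      refine ⟨ε, hε, fun y hy => h y ((dGH_le_treeDist x y).trans_lt ?_)⟩
      rw [treeDist_comm]
      exact hy
    · rintro ⟨ε, hε, h⟩
      refine ⟨ε / 2, by positivity, fun y hy => h ?_⟩
      change treeDist y x < ε
      rw [treeDist_comm]
      linarith [treeDist_le_dGH x y]

lemma dist_eq_treeDist (x y : TreeSpace) : dist x y = treeDist x y := rfl

lemma dGH_le_dist (x y : TreeSpace) : dGH x y ≤ dist x y := dGH_le_treeDist x y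

lemma dist_mk_le {S T : RootedRTree} {r : ℝ} (h : RClose S.root T.root r) :
    dist (α := TreeSpace) ⟦S⟧ ⟦T⟧ ≤ r := treeDist_mk_le h

lemma height_mk (S : RootedRTree) : height ⟦S⟧ = preHeight S := rfl

lemma dist_le_max_height (x y : TreeSpace) : dist x y ≤ max (height x) (height y) :=
  treeDist_le (rclose_height x y)

lemma height_le_add_dist (x y : TreeSpace) : height y ≤ height x + dist x y := by
  refine le_of_forall_pos_le_add fun ε hε => ?_
  have h := rclose_of_treeDist_lt (show treeDist x y < dist x y + ε by
    rw [dist_eq_treeDist]; linarith)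
  rw [height_eq y, add_assoc]
  exact preHeight_le _ fun u => h.dist_le (dist_root_le_height x) u

lemma lipschitzWith_height : LipschitzWith 1 height :=
  LipschitzWith.of_le_add fun x y => by
    rw [dist_comm]; exact height_le_add_dist y x

lemma continuous_height : Continuous height := lipschitzWith_height.continuous

lemma measurable_height : Measurable height := continuous_height.measurable

lemma height_onePoint : height onePoint = 0 := by
  refine le_antisymm (preHeight_le _ fun x => ?_) (height_nonneg _)
  exact (dist_self _).le

lemma dist_onePoint_le (x : TreeSpace) : dist onePoint x ≤ height x := by
  refine (dist_le_max_height _ _).trans ?_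
  rw [height_onePoint, max_eq_right (height_nonneg x)]

/-- A tree is encoded, up to error `ε`, by a finite `ε / 5`-net together with the integer parts of
its root distances and mutual distances in units of `ε / 5`; there are countably many codes. Second
countability is what makes continuous maps on products, such as the distance, measurable for the
product `σ`-algebra. -/
instance : SecondCountableTopology TreeSpace := by
  refine Metric.secondCountable_of_countable_discretization fun ε hε => ?_
  have hnet : ∀ x : TreeSpace, ∃ (n : ℕ) (a : Fin n → x.out.carrier),
      ∀ u, ∃ i, dist u (a i) < ε / 5 := by
    intro x
    obtain ⟨t, -, ht, hc⟩ := finite_cover_balls_of_compact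
      (isCompact_univ (X := x.out.carrier)) (show 0 < ε / 5 by positivity)
    obtain ⟨n, a, -, rfl⟩ := ht.fin_param
    refine ⟨n, a, fun u => ?_⟩
    simpa using hc (mem_univ u)
  choose N a ha using hnet
  refine ⟨Σ n : ℕ, (Fin n → ℤ) × (Fin n → Fin n → ℤ), Encodable.ofCountable _, fun x =>
    ⟨N x, fun i => ⌊dist x.out.root (a x i) / (ε / 5)⌋,
      fun i j => ⌊dist (a x i) (a x j) / (ε / 5)⌋⟩, fun x y hxy => ?_⟩
  obtain ⟨hN, h2⟩ := Sigma.mk.inj_iff.1 hxy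
  have hfl : ∀ s t : ℝ, ⌊s / (ε / 5)⌋ = ⌊t / (ε / 5)⌋ → |s - t| ≤ ε / 5 := by
    intro s t hst
    have h := Int.abs_sub_lt_one_of_floor_eq_floor hst
    rw [← sub_div, abs_div, abs_of_pos (show 0 < ε / 5 by positivity),
      div_lt_one (by positivity)] at h
    exact h.le
  -- Equal codes give nets of equal size, but indexed by different types. The net of `y` is
  -- transported along `hN` before distances are compared.
  have hc : ∃ b : Fin (N x) → y.out.carrier, (∀ u, ∃ i, dist u (b i) < ε / 5) ∧
      (∀ i, |dist x.out.root (a x i) - dist y.out.root (b i)| ≤ ε / 5) ∧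
      ∀ i j, |dist (a x i) (a x j) - dist (b i) (b j)| ≤ ε / 5 := by
    have hay := ha y
    revert h2 hay
    generalize a y = b
    revert b
    rw [← hN]
    intro b h2 hay
    obtain ⟨h3, h4⟩ := Prod.mk.inj (eq_of_heq h2)
    exact ⟨b, hay, fun i => hfl _ _ (congrFun h3 i), fun i j => hfl _ _ (congrFun (congrFun h4 i) j)⟩
  obtain ⟨b, hb, hb1, hb2⟩ := hc
  refine treeDist_le ⟨fun u v => ∃ i, dist u (a x i) < ε / 5 ∧ dist v (b i) < ε / 5, fun u => ?_,
    fun v => ?_, ?_, ?_⟩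
  · obtain ⟨i, hi⟩ := ha x u
    exact ⟨b i, i, hi, by rw [dist_self]; positivity⟩
  · obtain ⟨i, hi⟩ := hb v
    exact ⟨a x i, i, by rw [dist_self]; positivity, hi⟩
  · rintro u v ⟨i, hu, hv⟩
    have t1 := abs_le.1 (dist_dist_dist_le x.out.root u x.out.root (a x i))
    have t2 := abs_le.1 (dist_dist_dist_le y.out.root v y.out.root (b i))
    have t3 := abs_le.1 (hb1 i)
    rw [dist_self] at t1 t2
    rw [abs_le]
    constructor <;> linarith [t1.1, t1.2, t2.1, t2.2, t3.1, t3.2]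
  · rintro u v u' v' ⟨i, hu, hv⟩ ⟨j, hu', hv'⟩
    have t1 := abs_le.1 (dist_dist_dist_le u u' (a x i) (a x j))
    have t2 := abs_le.1 (dist_dist_dist_le v v' (b i) (b j))
    have t3 := abs_le.1 (hb2 i j)
    rw [abs_le]
    constructor <;> linarith [t1.1, t1.2, t2.1, t2.2, t3.1, t3.2]

/-! ### Compactness of the grafted tree and estimates for the grafting map -/

namespace Graft

variable {β : ℝ} {s s' : BeadString} {t t' : ℕ → RootedRTree}

lemma dist_root_base (x : Icc (0 : ℝ) s.len) : dist (root β s t) (base x) = x := by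
  rw [root, dist_base, Subtype.dist_eq, Real.dist_eq, zero_sub, abs_neg, abs_of_nonneg x.2.1]

lemma dist_site (i j : ℕ) :
    dist (site i : Graft β s t) (site j) = |s.loc i - s.loc j| := rfl

lemma dist_base_site (x : Icc (0 : ℝ) s.len) (j : ℕ) :
    dist (base x : Graft β s t) (site j) = |(x : ℝ) - s.loc j| := rfl

lemma dist_root_branch (i : ℕ) (u : (t i).carrier) :
    dist (root β s t) (branch i u) = s.loc i + s.mass i ^ β * dist (t i).root u := by
  rw [root, dist_base_branch]
  congr 1
  exact dist_root_base (t := t) (β := β) ⟨s.loc i, s.loc_mem i⟩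

lemma dist_branch_ne' {i j : ℕ} (h : i ≠ j) (u : (t i).carrier) (v : (t j).carrier) :
    dist (branch i u : Graft β s t) (branch j v) = s.mass i ^ β * dist (t i).root u +
      |s.loc i - s.loc j| + s.mass j ^ β * dist (t j).root v := by
  rw [dist_branch_ne h, dist_comm u, dist_site]

/-- The relations in the branches are joined with the identity on `[0, ℓ]`. A distance across two
branches contains two rescaled root distances, each changed by at most `r`, which fits in the
allowed `2 * r`. This is why `RClose` bounds root distances by `r` separately, and why the errors of
the branches enter through their maximum and not through their sum. -/
lemma rclose {r : ℝ} (hr : 0 ≤ r)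
    (h : ∀ i, ∃ r', RClose (t i).root (t' i).root r' ∧ s.mass i ^ β * r' ≤ r) :
    RClose (root β s t) (root β s t') r := by
  choose r' h hr' using h
  choose R h1 h2 h3 h4 using h
  have k3 : ∀ i u v, R i u v →
      |s.mass i ^ β * dist (t i).root u - s.mass i ^ β * dist (t' i).root v| ≤ r := by
    intro i u v huv
    rw [← mul_sub, abs_mul, abs_of_nonneg (scale_nonneg β s i)]
    exact (mul_le_mul_of_nonneg_left (h3 i u v huv) (scale_nonneg β s i)).trans (hr' i)
  refine ⟨fun z w => (∃ x, z = base x ∧ w = base x) ∨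
    ∃ i u v, R i u v ∧ z = branch i u ∧ w = branch i v, fun z => ?_, fun w => ?_, ?_, ?_⟩
  · rcases Graft.cases z with ⟨x, rfl⟩ | ⟨i, u, rfl⟩
    · exact ⟨_, Or.inl ⟨x, rfl, rfl⟩⟩
    · obtain ⟨v, hv⟩ := h1 i u
      exact ⟨_, Or.inr ⟨i, u, v, hv, rfl, rfl⟩⟩
  · rcases Graft.cases w with ⟨x, rfl⟩ | ⟨i, v, rfl⟩
    · exact ⟨_, Or.inl ⟨x, rfl, rfl⟩⟩
    · obtain ⟨u, hu⟩ := h2 i v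
      exact ⟨_, Or.inr ⟨i, u, v, hu, rfl, rfl⟩⟩
  · rintro z w (⟨x, rfl, rfl⟩ | ⟨i, u, v, huv, rfl, rfl⟩)
    · simpa [dist_root_base] using hr
    · rw [dist_root_branch, dist_root_branch, add_sub_add_left_eq_sub]
      exact k3 i u v huv
  · rintro z w z' w' (⟨x, rfl, rfl⟩ | ⟨i, u, v, huv, rfl, rfl⟩)
      (⟨x', rfl, rfl⟩ | ⟨i', u', v', huv', rfl, rfl⟩)
    · rw [dist_base, dist_base, sub_self, abs_zero]; positivity
    · rw [dist_base_branch, dist_base_branch, dist_base_site, dist_base_site,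
        add_sub_add_left_eq_sub]
      linarith [k3 i' u' v' huv']
    · rw [dist_comm, dist_comm (branch i v), dist_base_branch, dist_base_branch, dist_base_site,
        dist_base_site, add_sub_add_left_eq_sub]
      linarith [k3 i u v huv]
    · by_cases hi : i = i'
      · subst hi
        rw [dist_branch, dist_branch, ← mul_sub, abs_mul, abs_of_nonneg (scale_nonneg β s i)]
        have := mul_le_mul_of_nonneg_left (h4 i _ _ _ _ huv huv') (scale_nonneg β s i)
        linarith [hr' i]
      · rw [dist_branch_ne' hi, dist_branch_ne' hi]
        have e1 := abs_le.1 (k3 i u v huv)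
        have e2 := abs_le.1 (k3 i' u' v' huv')
        rw [abs_le]
        constructor <;> linarith [e1.1, e1.2, e2.1, e2.2]

/-- Stability of the grafted tree in the string, if the trees from the index `N` on are trivial. -/
lemma rclose_string {N : ℕ} {ε : ℝ} (hε : 0 ≤ ε) (hlen : |s.len - s'.len| ≤ ε)
    (hloc : ∀ i < N, |s.loc i - s'.loc i| ≤ ε)
    (hmass : ∀ i < N, |s.mass i ^ β - s'.mass i ^ β| * preHeight (t i) ≤ ε)
    (ht : ∀ i, N ≤ i → ∀ u : (t i).carrier, u = (t i).root) :
    RClose (root β s t) (root β s' t) (2 * ε) := by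
  have k3 : ∀ i < N, ∀ u : (t i).carrier,
      |s.mass i ^ β * dist (t i).root u - s'.mass i ^ β * dist (t i).root u| ≤ ε := by
    intro i hi u
    rw [← sub_mul, abs_mul, abs_of_nonneg (dist_nonneg (x := (t i).root))]
    exact (mul_le_mul_of_nonneg_left (dist_root_le_preHeight _ u) (abs_nonneg _)).trans (hmass i hi)
  have hbase : ∀ (a b : ℝ), 0 ≤ b → |a - b| ≤ ε → ∀ x : Icc (0 : ℝ) a, ∃ y : Icc (0 : ℝ) b,
      |(x : ℝ) - y| ≤ ε := by
    intro a b hb hab x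
    have hx := x.2
    rcases le_total (x : ℝ) b with h | h
    · exact ⟨⟨x, hx.1, h⟩, by simpa using hε⟩
    · refine ⟨⟨b, hb, le_rfl⟩, ?_⟩
      rw [abs_of_nonneg (sub_nonneg.2 h)]
      linarith [hx.2, le_abs_self (a - b)]
  -- Branches from the index `N` on collapse to their sites and are treated as points of the base,
  -- so their locations and masses need not be compared.
  have htriv : ∀ (s : BeadString) (i : ℕ), N ≤ i → ∀ u : (t i).carrier,
      (branch i u : Graft β s t) = base ⟨s.loc i, s.loc_mem i⟩ := by
    intro s i hi u
    rw [ht i hi u, branch_root, site]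
  refine ⟨fun z w => (∃ (x : Icc (0 : ℝ) s.len) (y : Icc (0 : ℝ) s'.len),
      |(x : ℝ) - y| ≤ ε ∧ z = base x ∧ w = base y) ∨
    ∃ i < N, ∃ u, z = branch i u ∧ w = branch i u, fun z => ?_, fun w => ?_, ?_, ?_⟩
  · have hb : ∀ x : Icc (0 : ℝ) s.len, ∃ w : Graft β s' t,
        (∃ (x' : Icc (0 : ℝ) s.len) (y : Icc (0 : ℝ) s'.len), |(x' : ℝ) - y| ≤ ε ∧
          base x = (base x' : Graft β s t) ∧ w = base y) ∨
          ∃ i < N, ∃ u, (base x : Graft β s t) = branch i u ∧ w = branch i u := fun x => by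
      obtain ⟨y, hy⟩ := hbase s.len s'.len s'.len_nonneg hlen x
      exact ⟨base y, Or.inl ⟨x, y, hy, rfl, rfl⟩⟩
    rcases Graft.cases z with ⟨x, rfl⟩ | ⟨i, u, rfl⟩
    · exact hb x
    · rcases lt_or_ge i N with hi | hi
      · exact ⟨_, Or.inr ⟨i, hi, u, rfl, rfl⟩⟩
      · rw [htriv s i hi u]
        exact hb _
  · have hb : ∀ y : Icc (0 : ℝ) s'.len, ∃ z : Graft β s t,
        (∃ (x : Icc (0 : ℝ) s.len) (y' : Icc (0 : ℝ) s'.len), |(x : ℝ) - y'| ≤ ε ∧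
          z = base x ∧ base y = (base y' : Graft β s' t)) ∨
          ∃ i < N, ∃ u, z = branch i u ∧ (base y : Graft β s' t) = branch i u := fun y => by
      obtain ⟨x, hx⟩ := hbase s'.len s.len s.len_nonneg (by rwa [abs_sub_comm]) y
      exact ⟨base x, Or.inl ⟨x, y, by rwa [abs_sub_comm], rfl, rfl⟩⟩
    rcases Graft.cases w with ⟨y, rfl⟩ | ⟨i, u, rfl⟩
    · exact hb y
    · rcases lt_or_ge i N with hi | hi
      · exact ⟨_, Or.inr ⟨i, hi, u, rfl, rfl⟩⟩
      · rw [htriv s' i hi u]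
        exact hb _
  · rintro z w (⟨x, y, hxy, rfl, rfl⟩ | ⟨i, hi, u, rfl, rfl⟩)
    · rw [dist_root_base, dist_root_base]
      linarith
    · rw [dist_root_branch, dist_root_branch]
      have e1 := abs_le.1 (k3 i hi u)
      have e2 := abs_le.1 (hloc i hi)
      rw [abs_le]
      constructor <;> linarith [e1.1, e1.2, e2.1, e2.2]
  · have kabs : ∀ a b a' b' : ℝ, |a - a'| ≤ ε → |b - b'| ≤ ε →
        -(2 * ε) ≤ |a - b| - |a' - b'| ∧ |a - b| - |a' - b'| ≤ 2 * ε := by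
      intro a b a' b' h h'
      refine abs_le.1 ((abs_abs_sub_abs_le _ _).trans ?_)
      rw [show a - b - (a' - b') = (a - a') - (b - b') by ring]
      exact (abs_sub _ _).trans (by linarith)
    have kmix : ∀ (x : Icc (0 : ℝ) s.len) (y : Icc (0 : ℝ) s'.len), |(x : ℝ) - y| ≤ ε →
        ∀ i < N, ∀ u : (t i).carrier, |dist (base x : Graft β s t) (branch i u) -
          dist (base y : Graft β s' t) (branch i u)| ≤ 2 * (2 * ε) := by
      intro x y hxy i hi u
      rw [dist_base_branch, dist_base_branch, dist_base_site, dist_base_site]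
      have e1 := abs_le.1 (k3 i hi u)
      have e2 := kabs _ _ _ _ hxy (hloc i hi)
      rw [abs_le]
      constructor <;> linarith [e1.1, e1.2, e2.1, e2.2]
    rintro z w z' w' (⟨x, y, hxy, rfl, rfl⟩ | ⟨i, hi, u, rfl, rfl⟩)
      (⟨x', y', hxy', rfl, rfl⟩ | ⟨i', hi', u', rfl, rfl⟩)
    · rw [dist_base, dist_base, Subtype.dist_eq, Subtype.dist_eq, Real.dist_eq, Real.dist_eq]
      have e := kabs _ _ _ _ hxy hxy'
      rw [abs_le]
      constructor <;> linarith [e.1, e.2]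
    · exact kmix x y hxy i' hi' u'
    · rw [dist_comm, dist_comm (branch i u)]
      exact kmix x' y' hxy' i hi u
    · by_cases hne : i = i'
      · subst hne
        rw [dist_branch, dist_branch]
        have e1 := k3 i hi u
        have e2 := k3 i hi u'
        rw [← sub_mul, abs_mul, abs_of_nonneg dist_nonneg] at e1 e2 ⊢
        have e3 := mul_le_mul_of_nonneg_left (dist_triangle_left u u' (t i).root)
          (abs_nonneg (s.mass i ^ β - s'.mass i ^ β))
        linarith
      · rw [dist_branch_ne' hne, dist_branch_ne' hne]
        have e1 := abs_le.1 (k3 i hi u)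
        have e2 := abs_le.1 (k3 i' hi' u')
        have e3 := kabs _ _ _ _ (hloc i hi) (hloc i' hi')
        rw [abs_le]
        constructor <;> linarith [e1.1, e1.2, e2.1, e2.2, e3.1, e3.2]

lemma isCompact_range_branch (i : ℕ) : IsCompact (range (branch i : _ → Graft β s t)) := by
  have : LipschitzWith ⟨s.mass i ^ β, scale_nonneg β s i⟩ (branch i : _ → Graft β s t) :=
    LipschitzWith.of_dist_le_mul fun u v => (dist_branch i u v).le
  exact isCompact_range this.continuous

lemma isometry_base : Isometry (base : _ → Graft β s t) := Isometry.of_dist_eq dist_base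

/-- An ultrafilter that contains the base or a single branch converges by compactness of that piece.
Otherwise it leaves every finite set of branches; its projection to the base converges, and the
remaining branches are too short to matter. -/
lemma compactSpace_of_tendsto
    (h : Tendsto (fun i => s.mass i ^ β * preHeight (t i)) atTop (𝓝 0)) :
    CompactSpace (Graft β s t) := by
  refine ⟨isCompact_iff_ultrafilter_le_nhds.2 fun F _ => ?_⟩
  have hconv : ∀ K : Set (Graft β s t), IsCompact K → K ∈ F → ∃ z ∈ univ, (F : Filter (Graft β s t)) ≤ 𝓝 z := by
    intro K hK hF
    obtain ⟨z, -, hz⟩ := isCompact_iff_ultrafilter_le_nhds.1 hK F (le_principal_iff.2 hF)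
    exact ⟨z, mem_univ _, hz⟩
  by_cases hF0 : range (base : _ → Graft β s t) ∈ F
  · exact hconv _ (isCompact_range isometry_base.continuous) hF0
  by_cases hFi : ∃ i, range (branch i : _ → Graft β s t) ∈ F
  · obtain ⟨i, hi⟩ := hFi
    exact hconv _ (isCompact_range_branch i) hi
  push Not at hFi
  have hg : ∀ z : Graft β s t, ∃ x : Icc (0 : ℝ) s.len, z ∈ range (base : _ → Graft β s t) ∨
      ∃ i, z ∈ range (branch i : _ → Graft β s t) ∧
        dist z (base x) ≤ s.mass i ^ β * preHeight (t i) := by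
    intro z
    rcases Graft.cases z with ⟨x, rfl⟩ | ⟨i, u, rfl⟩
    · exact ⟨x, Or.inl ⟨x, rfl⟩⟩
    · refine ⟨⟨s.loc i, s.loc_mem i⟩, Or.inr ⟨i, ⟨u, rfl⟩, ?_⟩⟩
      rw [dist_comm]
      refine (dist_site_branch i u).le.trans ?_
      exact mul_le_mul_of_nonneg_left (dist_root_le_preHeight _ u) (scale_nonneg β s i)
  choose g hg using hg
  obtain ⟨x, -, hx⟩ := isCompact_iff_ultrafilter_le_nhds.1
    (isCompact_univ (X := Icc (0 : ℝ) s.len)) (F.map g) (by simp)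
  have hgx : Tendsto (fun z => (base (g z) : Graft β s t)) F (𝓝 (base x)) :=
    (isometry_base.continuous.tendsto x).comp hx
  refine ⟨base x, mem_univ _, ?_⟩
  change Tendsto (fun z : Graft β s t => z) F (𝓝 (base x))
  refine Metric.tendsto_nhds.2 fun ε hε => ?_
  obtain ⟨N, hN⟩ := eventually_atTop.1 (h.eventually (gt_mem_nhds (half_pos hε)))
  have hev : ∀ᶠ z in (F : Filter (Graft β s t)), ∀ i ∈ Finset.range N,
      z ∉ range (branch i : _ → Graft β s t) :=
    (Finset.eventually_all _).2 fun i _ => Ultrafilter.compl_mem_iff_notMem.2 (hFi i)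
  have hev0 : ∀ᶠ z in (F : Filter (Graft β s t)), z ∉ range (base : _ → Graft β s t) :=
    Ultrafilter.compl_mem_iff_notMem.2 hF0
  filter_upwards [Metric.tendsto_nhds.1 hgx (ε / 2) (half_pos hε), hev, hev0] with z h1 h2 h3
  obtain ⟨i, hi, hd⟩ := (hg z).resolve_left h3
  have hNi : N ≤ i := by
    by_contra hlt
    exact h2 i (Finset.mem_range.2 (not_le.1 hlt)) hi
  have := dist_triangle z (base (g z)) (base x)
  linarith [hN i hNi]

/-- If infinitely many rescaled heights were at least `ε`, the highest points of these branches
would be pairwise at distance at least `ε`, and two of them would share a ball of radius `ε / 2` of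
a finite cover. -/
lemma tendsto_of_compactSpace [CompactSpace (Graft β s t)] :
    Tendsto (fun i => s.mass i ^ β * preHeight (t i)) atTop (𝓝 0) := by
  rw [← Nat.cofinite_eq_atTop]
  refine Metric.tendsto_nhds.2 fun ε hε => ?_
  rw [eventually_cofinite]
  by_contra hinf
  have hu : ∀ i, ∃ u : (t i).carrier, preHeight (t i) = dist (t i).root u := by
    intro i
    obtain ⟨u, -, hu⟩ := isCompact_univ.exists_isMaxOn ⟨(t i).root, mem_univ _⟩
      (continuous_const.dist continuous_id (α := (t i).carrier) (f := fun _ => (t i).root)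
        (g := id)).continuousOn
    exact ⟨u, (preHeight_le _ fun v => hu (mem_univ v)).antisymm (dist_root_le_preHeight _ u)⟩
  choose u hu using hu
  obtain ⟨c, -, hc, hcov⟩ := finite_cover_balls_of_compact
    (isCompact_univ (X := Graft β s t)) (half_pos hε)
  have hcov' : ∀ i, ∃ z ∈ c, dist (branch i (u i) : Graft β s t) z < ε / 2 := fun i => by
    simpa using hcov (mem_univ (branch i (u i) : Graft β s t))
  choose z hz hd using hcov'
  obtain ⟨i, hi, j, hj, hne, hij⟩ := Set.Infinite.exists_ne_map_eq_of_mapsTo hinf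
    (fun i _ => hz i) hc
  have hε' : ε ≤ s.mass i ^ β * dist (t i).root (u i) := by
    rw [← hu]
    have := not_lt.1 hi
    rwa [Real.dist_eq, sub_zero,
      abs_of_nonneg (mul_nonneg (scale_nonneg β s i) (preHeight_nonneg _))] at this
  have h1 := dist_triangle_right (branch i (u i) : Graft β s t) (branch j (u j)) (z i)
  have h2 := hd i
  have h3 := hd j
  rw [← hij] at h3
  rw [dist_branch_ne' hne] at h1
  linarith [abs_nonneg (s.loc i - s.loc j), scale_dist_nonneg (β := β) (s := s) j (t j).root (u j)]

end Graft

/-- The condition under which the grafted tree is compact. -/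
def IsGraftable (β : ℝ) (s : BeadString) (τ : ℕ → TreeSpace) : Prop :=
  Tendsto (fun i => s.mass i ^ β * height (τ i)) atTop (𝓝 0)

section phi

variable {β : ℝ} {s : BeadString} {τ τ' : ℕ → TreeSpace}

lemma compactSpace_graft_iff :
    CompactSpace (Graft β s fun i => (τ i).out) ↔ IsGraftable β s τ := by
  simp only [IsGraftable, height_eq]
  exact ⟨fun _ => Graft.tendsto_of_compactSpace, Graft.compactSpace_of_tendsto⟩

/-- The grafted tree as a rooted compact tree. -/
def graftTree (β : ℝ) (s : BeadString) (τ : ℕ → TreeSpace) (h : IsGraftable β s τ) : RootedRTree :=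
  have := compactSpace_graft_iff.2 h
  ⟨Graft β s fun i => (τ i).out, Graft.root β s _, Graft.isRTree β s _⟩

lemma phi_eq_mk (h : IsGraftable β s τ) : phi β s τ = ⟦graftTree β s τ h⟧ :=
  dif_pos (compactSpace_graft_iff.2 h)

lemma phi_eq_onePoint (h : ¬ IsGraftable β s τ) : phi β s τ = onePoint :=
  dif_neg (mt compactSpace_graft_iff.1 h)

/-- The equivalence `hg` excludes the case in which only one side falls back to the one-point tree.
-/
lemma dist_phi_le {A : ℝ} (hg : IsGraftable β s τ ↔ IsGraftable β s τ')
    (h : ∀ i, s.mass i ^ β * dist (τ i) (τ' i) ≤ A) : dist (phi β s τ) (phi β s τ') ≤ A := by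
  have hA : 0 ≤ A := (mul_nonneg (scale_nonneg β s 0) dist_nonneg).trans (h 0)
  by_cases h' : IsGraftable β s τ
  · rw [phi_eq_mk h', phi_eq_mk (hg.1 h')]
    refine le_of_forall_pos_le_add fun ε hε => ?_
    refine dist_mk_le (Graft.rclose (by positivity) fun i => ?_)
    -- A relation is available only strictly above the infimum `treeDist`. The slack `ε / (1 +
    -- s.mass i ^ β)` stays below `ε` after rescaling, uniformly in `i`.
    have hpos : 0 < 1 + s.mass i ^ β := by linarith [scale_nonneg β s i]
    refine ⟨dist (τ i) (τ' i) + ε / (1 + s.mass i ^ β), rclose_of_treeDist_lt ?_, ?_⟩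
    · rw [← dist_eq_treeDist]
      linarith [div_pos hε hpos]
    · rw [mul_add]
      refine add_le_add (h i) ?_
      rw [mul_div_assoc', div_le_iff₀ hpos]
      nlinarith [scale_nonneg β s i]
  · rw [phi_eq_onePoint h', phi_eq_onePoint (mt hg.2 h'), dist_self]
    exact hA

lemma height_phi_le {A : ℝ} (h : ∀ i, s.mass i ^ β * height (τ i) ≤ A) :
    height (phi β s τ) ≤ s.len + A := by
  have hA : 0 ≤ A := (mul_nonneg (scale_nonneg β s 0) (height_nonneg _)).trans (h 0)
  by_cases h' : IsGraftable β s τ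
  · rw [phi_eq_mk h', height_mk]
    refine preHeight_le _ fun z => ?_
    change dist (Graft.root β s fun i => (τ i).out) z ≤ _
    rcases Graft.cases z with ⟨x, rfl⟩ | ⟨i, u, rfl⟩
    · rw [Graft.dist_root_base]
      linarith [x.2.2]
    · rw [Graft.dist_root_branch]
      have := mul_le_mul_of_nonneg_left (dist_root_le_height (τ i) u) (scale_nonneg β s i)
      linarith [(s.loc_mem i).2, h i]
  · rw [phi_eq_onePoint h', height_onePoint]
    linarith [s.len_nonneg]

lemma IsGraftable.of_dist (h : IsGraftable β s τ)
    (hd : Tendsto (fun i => s.mass i ^ β * dist (τ i) (τ' i)) atTop (𝓝 0)) :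
    IsGraftable β s τ' := by
  refine squeeze_zero (fun i => mul_nonneg (scale_nonneg β s i) (height_nonneg _)) (fun i => ?_)
    (by simpa using Tendsto.add h hd)
  rw [← mul_add]
  exact mul_le_mul_of_nonneg_left (height_le_add_dist _ _) (scale_nonneg β s i)

end phi

/-! ### `p`-th powers -/

lemma mass_rpow_mul (β p : ℝ) (s : BeadString) (i : ℕ) :
    s.mass i ^ (p * β) = (s.mass i ^ β) ^ p := by
  rw [mul_comm, Real.rpow_mul (s.mass_nonneg i)]

/-- The sum of the `p`-th powers of the rescaled values. -/
def powerSum (β p : ℝ) (s : BeadString) (f : ℕ → ℝ≥0∞) : ℝ≥0∞ :=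
  ∑' i, ENNReal.ofReal (s.mass i ^ (p * β)) * f i

lemma ofReal_scale_mul_rpow {β p : ℝ} (s : BeadString) (i : ℕ) {a : ℝ} (ha : 0 ≤ a) :
    ENNReal.ofReal (s.mass i ^ (p * β)) * ENNReal.ofReal (a ^ p) =
      ENNReal.ofReal ((s.mass i ^ β * a) ^ p) := by
  rw [mass_rpow_mul, ← ENNReal.ofReal_mul (Real.rpow_nonneg (scale_nonneg β s i) p),
    Real.mul_rpow (scale_nonneg β s i) ha]

lemma scale_mul_le_of_powerSum {β p : ℝ} (hp : 0 < p) {s : BeadString} {a : ℕ → ℝ}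
    (ha : ∀ i, 0 ≤ a i) (h : powerSum β p s (fun i => ENNReal.ofReal (a i ^ p)) ≠ ∞) (i : ℕ) :
    s.mass i ^ β * a i ≤
      (powerSum β p s fun i => ENNReal.ofReal (a i ^ p)).toReal ^ (1 / p) := by
  have h0 : 0 ≤ s.mass i ^ β * a i := mul_nonneg (scale_nonneg β s i) (ha i)
  have h1 : ENNReal.ofReal ((s.mass i ^ β * a i) ^ p) ≤
      powerSum β p s fun i => ENNReal.ofReal (a i ^ p) := by
    rw [← ofReal_scale_mul_rpow s i (ha i)]
    exact ENNReal.le_tsum (f := fun i => ENNReal.ofReal (s.mass i ^ (p * β)) *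
      ENNReal.ofReal (a i ^ p)) i
  have h2 := (ENNReal.ofReal_le_iff_le_toReal h).1 h1
  calc s.mass i ^ β * a i = ((s.mass i ^ β * a i) ^ p) ^ (1 / p) := by
        rw [← Real.rpow_mul h0, mul_one_div_cancel hp.ne', Real.rpow_one]
    _ ≤ _ := Real.rpow_le_rpow (Real.rpow_nonneg h0 p) h2 (by positivity)

lemma tendsto_scale_mul_of_powerSum {β p : ℝ} (hp : 0 < p) {s : BeadString} {a : ℕ → ℝ}
    (ha : ∀ i, 0 ≤ a i) (h : powerSum β p s (fun i => ENNReal.ofReal (a i ^ p)) ≠ ∞) :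
    Tendsto (fun i => s.mass i ^ β * a i) atTop (𝓝 0) := by
  have h1 := ENNReal.tendsto_atTop_zero_of_tsum_ne_top h
  have h2 := ((ENNReal.tendsto_toReal ENNReal.zero_ne_top).comp h1)
  have h3 := h2.rpow_const (p := 1 / p) (Or.inr (by positivity))
  rw [ENNReal.toReal_zero, Real.zero_rpow (by positivity)] at h3
  refine h3.congr fun i => ?_
  have h0 : 0 ≤ s.mass i ^ β * a i := mul_nonneg (scale_nonneg β s i) (ha i)
  rw [Function.comp_apply, ofReal_scale_mul_rpow s i (ha i),
    ENNReal.toReal_ofReal (Real.rpow_nonneg h0 p), ← Real.rpow_mul h0, mul_one_div_cancel hp.ne',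
    Real.rpow_one]

lemma isGraftable_of_powerSum {β p : ℝ} (hp : 0 < p) {s : BeadString} {τ : ℕ → TreeSpace}
    (h : powerSum β p s (fun i => ENNReal.ofReal (height (τ i) ^ p)) ≠ ∞) : IsGraftable β s τ :=
  tendsto_scale_mul_of_powerSum hp (fun i => height_nonneg (τ i)) h

lemma ofReal_rpow_le_of_le {p : ℝ} (hp : 0 < p) {a : ℝ} (ha : 0 ≤ a) {b : ℝ≥0∞} (hb : b ≠ ∞)
    (h : a ≤ b.toReal ^ (1 / p)) : ENNReal.ofReal (a ^ p) ≤ b := by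
  refine (ENNReal.ofReal_le_iff_le_toReal hb).2 ?_
  calc a ^ p ≤ (b.toReal ^ (1 / p)) ^ p := Real.rpow_le_rpow ha h hp.le
    _ = b.toReal := by
      rw [← Real.rpow_mul ENNReal.toReal_nonneg, one_div_mul_cancel hp.ne', Real.rpow_one]

/-- If the right side is finite, the rescaled distances tend to zero, so both families are graftable
or neither is. If it is infinite there is nothing to prove. Hence no graftability hypothesis is
needed. -/
lemma ofReal_dist_phi_le {β p : ℝ} (hp : 0 < p) (s : BeadString) (τ τ' : ℕ → TreeSpace) :
    ENNReal.ofReal (dist (phi β s τ) (phi β s τ') ^ p) ≤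
      powerSum β p s fun i => ENNReal.ofReal (dist (τ i) (τ' i) ^ p) := by
  by_cases h : powerSum β p s (fun i => ENNReal.ofReal (dist (τ i) (τ' i) ^ p)) = ∞
  · rw [h]; exact le_top
  · have ht := tendsto_scale_mul_of_powerSum hp (fun _ => dist_nonneg) h
    refine ofReal_rpow_le_of_le hp dist_nonneg h (dist_phi_le
      ⟨fun h' => h'.of_dist ht, fun h' => h'.of_dist ?_⟩
      (scale_mul_le_of_powerSum hp (fun _ => dist_nonneg) h))
    simpa only [dist_comm] using ht

lemma ofReal_height_phi_le {β p : ℝ} (hp : 0 < p) (s : BeadString) (τ : ℕ → TreeSpace) :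
    ENNReal.ofReal (height (phi β s τ)) ≤ ENNReal.ofReal s.len +
      powerSum β p s (fun i => ENNReal.ofReal (height (τ i) ^ p)) ^ (1 / p) := by
  by_cases h : powerSum β p s (fun i => ENNReal.ofReal (height (τ i) ^ p)) = ∞
  · rw [h, ENNReal.top_rpow_of_pos (by positivity), add_top]; exact le_top
  · have := height_phi_le (scale_mul_le_of_powerSum hp (fun i => height_nonneg (τ i)) h)
    refine (ENNReal.ofReal_le_ofReal this).trans (ENNReal.ofReal_add_le.trans ?_)
    gcongr
    rw [← ENNReal.ofReal_rpow_of_nonneg ENNReal.toReal_nonneg (by positivity),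
      ENNReal.ofReal_toReal h]

/-! ### Measurability of the grafting map -/

lemma height_segment (s : BeadString) : height s.segment = s.len := by
  refine le_antisymm (preHeight_le _ fun x => ?_) ?_
  · change dist (⟨0, _⟩ : Icc (0 : ℝ) s.len) x ≤ _
    have hx : x.1 ∈ Icc (0 : ℝ) s.len := x.2
    rw [Subtype.dist_eq, Real.dist_eq, zero_sub, abs_neg, abs_of_nonneg hx.1]
    exact hx.2
  · refine le_trans ?_ (dist_root_le_preHeight _ (⟨s.len, s.len_nonneg, le_rfl⟩ : Icc (0 : ℝ) s.len))
    change _ ≤ dist (⟨0, _⟩ : Icc (0 : ℝ) s.len) _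
    rw [Subtype.dist_eq, Real.dist_eq, zero_sub, abs_neg]
    exact le_abs_self _

lemma continuous_len : Continuous BeadString.len := continuous_fst.comp continuous_subtype_val

lemma continuous_loc (i : ℕ) : Continuous fun s : BeadString => s.loc i :=
  (continuous_apply i).comp (continuous_fst.comp (continuous_snd.comp continuous_subtype_val))

lemma continuous_mass (i : ℕ) : Continuous fun s : BeadString => s.mass i :=
  (continuous_apply i).comp (continuous_snd.comp (continuous_snd.comp continuous_subtype_val))

lemma measurable_len : Measurable BeadString.len := continuous_len.measurable

lemma measurable_mass (i : ℕ) : Measurable fun s : BeadString => s.mass i :=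
  (continuous_mass i).measurable

/-- The tree `τ_i` is replaced by the one-point tree for `i ≥ N`. -/
def truncate (N : ℕ) (τ : ℕ → TreeSpace) (i : ℕ) : TreeSpace := if i < N then τ i else onePoint

lemma truncate_of_lt {N i : ℕ} (h : i < N) (τ : ℕ → TreeSpace) : truncate N τ i = τ i := if_pos h

lemma truncate_of_le {N i : ℕ} (h : N ≤ i) (τ : ℕ → TreeSpace) : truncate N τ i = onePoint :=
  if_neg (not_lt.2 h)

lemma isGraftable_truncate (β : ℝ) (s : BeadString) (N : ℕ) (τ : ℕ → TreeSpace) :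
    IsGraftable β s (truncate N τ) := by
  refine tendsto_const_nhds.congr' ?_
  filter_upwards [eventually_ge_atTop N] with i hi
  rw [truncate_of_le hi, height_onePoint, mul_zero]

/-- Truncation only cuts branches from the index `N` on, whose rescaled heights are uniformly small
by graftability. -/
lemma tendsto_phi_truncate {β : ℝ} {s : BeadString} {τ : ℕ → TreeSpace} (h : IsGraftable β s τ) :
    Tendsto (fun N => phi β s (truncate N τ)) atTop (𝓝 (phi β s τ)) := by
  refine Metric.tendsto_atTop.2 fun ε hε => ?_
  obtain ⟨N, hN⟩ := eventually_atTop.1 (h.eventually (gt_mem_nhds (half_pos hε)))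
  refine ⟨N, fun n hn => (dist_phi_le (A := ε / 2)
    (iff_of_true (isGraftable_truncate _ _ _ _) h) fun i => ?_).trans_lt (half_lt_self hε)⟩
  rcases lt_or_ge i n with hi | hi
  · rw [truncate_of_lt hi, dist_self, mul_zero]
    positivity
  · rw [truncate_of_le hi]
    exact (mul_le_mul_of_nonneg_left (dist_onePoint_le _) (scale_nonneg β s i)).trans
      (hN i (hn.trans hi)).le

lemma height_eq_zero_unique (x : TreeSpace) (h : height x = 0) (u : x.out.carrier) :
    u = x.out.root :=
  (dist_le_zero.1 ((dist_root_le_height x u).trans h.le)).symm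

lemma dist_phi_string_le {β ε : ℝ} {s s' : BeadString} {N : ℕ} {τ : ℕ → TreeSpace} (hε : 0 ≤ ε)
    (hlen : |s.len - s'.len| ≤ ε) (hloc : ∀ i < N, |s.loc i - s'.loc i| ≤ ε)
    (hmass : ∀ i < N, |s.mass i ^ β - s'.mass i ^ β| * height (τ i) ≤ ε) :
    dist (phi β s (truncate N τ)) (phi β s' (truncate N τ)) ≤ 2 * ε := by
  rw [phi_eq_mk (isGraftable_truncate β s N τ), phi_eq_mk (isGraftable_truncate β s' N τ)]
  refine dist_mk_le (Graft.rclose_string hε hlen hloc (fun i hi => ?_) fun i hi u => ?_)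
  · rw [← height_eq, truncate_of_lt hi]
    exact hmass i hi
  · exact height_eq_zero_unique _ (by rw [truncate_of_le hi, height_onePoint]) u

/-- Only finitely many locations, masses and trees matter after truncation. The string is moved with
the trees fixed at `τ`, and then the trees with the string fixed. Positivity of `β` makes the scale
continuous at mass zero. -/
lemma continuous_phi_truncate {β : ℝ} (hβ : 0 < β) (N : ℕ) :
    Continuous fun z : BeadString × (ℕ → TreeSpace) => phi β z.1 (truncate N z.2) := by
  have hscale : ∀ i, Continuous fun s : BeadString => s.mass i ^ β := fun i =>
    (continuous_mass i).rpow_const fun _ => Or.inr hβ.le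
  refine continuous_iff_continuousAt.2 fun ⟨s, τ⟩ => Metric.tendsto_nhds.2 fun ε hε => ?_
  have hε4 : 0 < ε / 4 := by positivity
  have abs_ev : ∀ f : BeadString × (ℕ → TreeSpace) → ℝ, Continuous f → f (s, τ) = 0 →
      ∀ᶠ z in 𝓝 (s, τ), f z ≤ ε / 4 := fun f hf h0 =>
    (hf.continuousAt.eventually (gt_mem_nhds (h0.trans_lt hε4))).mono fun _ h => h.le
  have e1 := abs_ev (fun z => |s.len - z.1.len|)
    (continuous_const.sub (continuous_len.comp continuous_fst)).abs (by simp)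
  have e2 : ∀ᶠ z in 𝓝 (s, τ), ∀ i ∈ Finset.range N, |s.loc i - z.1.loc i| ≤ ε / 4 :=
    (Finset.eventually_all _).2 fun i _ => abs_ev (fun z => |s.loc i - z.1.loc i|)
      (continuous_const.sub ((continuous_loc i).comp continuous_fst)).abs (by simp)
  have e3 : ∀ᶠ z in 𝓝 (s, τ), ∀ i ∈ Finset.range N,
      |s.mass i ^ β - z.1.mass i ^ β| * height (τ i) ≤ ε / 4 :=
    (Finset.eventually_all _).2 fun i _ => abs_ev
      (fun z => |s.mass i ^ β - z.1.mass i ^ β| * height (τ i))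
      ((continuous_const.sub ((hscale i).comp continuous_fst)).abs.mul continuous_const) (by simp)
  have e4 : ∀ᶠ z in 𝓝 (s, τ), ∀ i ∈ Finset.range N,
      z.1.mass i ^ β * dist (z.2 i) (τ i) ≤ ε / 4 :=
    (Finset.eventually_all _).2 fun i _ => abs_ev (fun z => z.1.mass i ^ β * dist (z.2 i) (τ i))
      (((hscale i).comp continuous_fst).mul
        (((continuous_apply i).comp continuous_snd).dist continuous_const)) (by simp)
  filter_upwards [e1, e2, e3, e4] with z h1 h2 h3 h4
  have k1 := dist_phi_string_le hε4.le h1 (fun i hi => h2 i (Finset.mem_range.2 hi))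
    fun i hi => h3 i (Finset.mem_range.2 hi)
  have k2 : dist (phi β z.1 (truncate N z.2)) (phi β z.1 (truncate N τ)) ≤ ε / 4 := by
    refine dist_phi_le (iff_of_true (isGraftable_truncate _ _ _ _) (isGraftable_truncate _ _ _ _))
      fun i => ?_
    rcases lt_or_ge i N with hi | hi
    · rw [truncate_of_lt hi, truncate_of_lt hi]
      exact h4 i (Finset.mem_range.2 hi)
    · rw [truncate_of_le hi, truncate_of_le hi, dist_self, mul_zero]
      exact hε4.le
  have k3 := dist_triangle_right (phi β z.1 (truncate N z.2)) (phi β s (truncate N τ))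
    (phi β z.1 (truncate N τ))
  linarith

lemma measurableSet_isGraftable (β : ℝ) :
    MeasurableSet {z : BeadString × (ℕ → TreeSpace) | IsGraftable β z.1 z.2} :=
  measurableSet_tendsto (𝓝 0) fun i => (((measurable_mass i).comp measurable_fst).pow_const β).mul
    (measurable_height.comp ((measurable_pi_apply i).comp measurable_snd))

lemma measurable_phi {β : ℝ} (hβ : 0 < β) :
    Measurable fun z : BeadString × (ℕ → TreeSpace) => phi β z.1 z.2 := by
  classical
  refine measurable_of_tendsto_metrizable (f := fun N z => if IsGraftable β z.1 z.2 then
    phi β z.1 (truncate N z.2) else onePoint) (fun N => ?_) (tendsto_pi_nhds.2 fun z => ?_)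
  · exact Measurable.ite (measurableSet_isGraftable β) (continuous_phi_truncate hβ N).measurable
      measurable_const
  · by_cases h : IsGraftable β z.1 z.2
    · simpa only [if_pos h] using tendsto_phi_truncate h
    · simpa only [if_neg h, phi_eq_onePoint h] using tendsto_const_nhds

/-! ### Embeddings with dense range -/

/-- `S` embeds isometrically and root-preservingly into `T`, and every point of `T` is at distance
at most `r` from the range. -/
def EmbedsDense (S T : TreeSpace) (r : ℝ) : Prop :=
  ∃ f : S.out.carrier → T.out.carrier,
    Isometry f ∧ f S.out.root = T.out.root ∧ ∀ y, ∃ x, dist (f x) y ≤ r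

lemma EmbedsDense.embeds {S T : TreeSpace} {r : ℝ} (h : EmbedsDense S T r) : Embeds S T := by
  obtain ⟨f, hf, h, -⟩ := h
  exact ⟨f, hf, h⟩

lemma EmbedsDense.dist_le {S T : TreeSpace} {r : ℝ} (h : EmbedsDense S T r) : dist S T ≤ r := by
  obtain ⟨f, hf, h, hd⟩ := h
  obtain ⟨x, hx⟩ := hd T.out.root
  exact treeDist_le (.of_isometry_of_dense hf h (dist_nonneg.trans hx) hd)

lemma embedsDense_mk {S T : RootedRTree} {r : ℝ} (f : S.carrier → T.carrier) (hf : Isometry f)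
    (hρ : f S.root = T.root) (hd : ∀ y, ∃ x, dist (f x) y ≤ r) : EmbedsDense ⟦S⟧ ⟦T⟧ r := by
  obtain ⟨e, he⟩ := Quotient.exact (Quotient.out_eq (⟦S⟧ : TreeSpace))
  obtain ⟨e', he'⟩ := Setoid.symm (Quotient.exact (Quotient.out_eq (⟦T⟧ : TreeSpace)))
  refine ⟨e' ∘ f ∘ e, e'.isometry.comp (hf.comp e.isometry), ?_, fun y => ?_⟩
  · simp only [Function.comp_apply, he, hρ, he']
  · obtain ⟨x, hx⟩ := hd (e'.symm y)
    refine ⟨e.symm x, ?_⟩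
    rw [← e'.dist_eq] at hx
    simpa using hx

lemma embedsDense_segment {β A : ℝ} {s : BeadString} {τ : ℕ → TreeSpace} (hg : IsGraftable β s τ)
    (h : ∀ i, s.mass i ^ β * height (τ i) ≤ A) : EmbedsDense s.segment (phi β s τ) A := by
  have hA : 0 ≤ A := (mul_nonneg (scale_nonneg β s 0) (height_nonneg _)).trans (h 0)
  rw [phi_eq_mk hg]
  refine embedsDense_mk (T := graftTree β s τ hg)
    (Graft.base : Icc (0 : ℝ) s.len → Graft β s fun i => (τ i).out) Graft.isometry_base rfl
    fun z => ?_
  change ∃ x, dist (Graft.base x : Graft β s fun i => (τ i).out) z ≤ A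
  rcases Graft.cases z with ⟨x, rfl⟩ | ⟨i, u, rfl⟩
  · exact ⟨x, by rwa [dist_self]⟩
  · refine ⟨⟨s.loc i, s.loc_mem i⟩,
      (Graft.dist_site_branch (t := fun i => (τ i).out) i u).le.trans ?_⟩
    exact (mul_le_mul_of_nonneg_left (dist_root_le_height (τ i) u) (scale_nonneg β s i)).trans (h i)

/-- The embeddings of the branches fix roots, so together with the identity of `[0, ℓ]` they
preserve the graft distance and descend to the quotient. Each gap is rescaled with its branch. -/
lemma embedsDense_phi {β A : ℝ} {s : BeadString} {τ τ' : ℕ → TreeSpace} (hg : IsGraftable β s τ)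
    (hg' : IsGraftable β s τ') {r : ℕ → ℝ} (hr : ∀ i, EmbedsDense (τ i) (τ' i) (r i))
    (h : ∀ i, s.mass i ^ β * r i ≤ A) (hA : 0 ≤ A) :
    EmbedsDense (phi β s τ) (phi β s τ') A := by
  rw [phi_eq_mk hg, phi_eq_mk hg']
  choose f hf hρ hd using hr
  let F : PreGraft β s (fun i => (τ i).out) → PreGraft β s (fun i => (τ' i).out) :=
    Sum.map id fun z => ⟨z.1, f z.1 z.2⟩
  have hF : Isometry F := by
    refine Isometry.of_dist_eq ?_
    rintro (x | ⟨i, u⟩) (y | ⟨j, v⟩)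
    · rfl
    · change |_| + _ * dist (τ' j).out.root (f j v) = |_| + _ * dist (τ j).out.root v
      rw [← hρ, (hf j).dist_eq]
      rfl
    · change _ * dist (f i u) (τ' i).out.root + |_| = _ * dist u (τ i).out.root + |_|
      rw [← hρ, (hf i).dist_eq]
      rfl
    · by_cases hij : i = j
      · subst hij
        refine (graftDist_same i _ _).trans (Eq.trans ?_ (graftDist_same i _ _).symm)
        rw [(hf i).dist_eq]
      · refine (graftDist_ne hij _ _).trans (Eq.trans ?_ (graftDist_ne hij _ _).symm)
        rw [← hρ, ← hρ, (hf i).dist_eq, (hf j).dist_eq]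
  let G : (Graft β s fun i => (τ i).out) → Graft β s fun i => (τ' i).out :=
    SeparationQuotient.lift (SeparationQuotient.mk ∘ F) fun a b hab => by
      refine SeparationQuotient.mk_eq_mk.2 (Metric.inseparable_iff.2 ?_)
      rw [hF.dist_eq]
      exact Metric.inseparable_iff.1 hab
  have hG : Isometry G := by
    refine Isometry.of_dist_eq fun a b => ?_
    obtain ⟨a, rfl⟩ := SeparationQuotient.surjective_mk a
    obtain ⟨b, rfl⟩ := SeparationQuotient.surjective_mk b
    exact hF.dist_eq a b
  refine embedsDense_mk (S := graftTree β s τ hg) (T := graftTree β s τ' hg') G hG rfl fun z => ?_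
  change ∃ x, dist (G x) z ≤ A
  rcases Graft.cases z with ⟨x, rfl⟩ | ⟨i, v, rfl⟩
  · exact ⟨Graft.base x, (dist_self (Graft.base x : Graft β s fun i => (τ' i).out)).le.trans hA⟩
  · obtain ⟨u, hu⟩ := hd i v
    refine ⟨Graft.branch i u, (Graft.dist_branch (t := fun i => (τ' i).out) i (f i u) v).le.trans ?_⟩
    exact (mul_le_mul_of_nonneg_left hu (scale_nonneg β s i)).trans (h i)

/-- A segment is at distance zero from itself with one-point trees grafted on; the exponent `1` is
irrelevant. Distance zero is not used as equality, so the segment is instead presented as a limit of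
a constant sequence of measurable maps. -/
lemma measurable_segment : Measurable BeadString.segment := by
  refine measurable_of_tendsto_metrizable (f := fun _ s => phi 1 s fun _ => onePoint)
    (fun _ => (measurable_phi one_pos).comp (measurable_id.prodMk measurable_const))
    (tendsto_pi_nhds.2 fun s => tendsto_iff_dist_tendsto_zero.2 ?_)
  have hg : IsGraftable 1 s fun _ => onePoint := by simp [IsGraftable, height_onePoint]
  have := (embedsDense_segment (A := 0) hg (by simp [height_onePoint])).dist_le
  simp [dist_comm _ s.segment, this.antisymm dist_nonneg]

/-! ### Real trees and the four-point condition -/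

/-- The four-point condition. -/
def FourPoint (M : Type*) [PseudoMetricSpace M] : Prop :=
  ∀ x y z w : M, dist x y + dist z w ≤ max (dist x z + dist y w) (dist x w + dist y z)

/-- The four-point condition, stated by means of Gromov products at `ρ`. -/
def HypAt {M : Type*} [PseudoMetricSpace M] (ρ : M) : Prop :=
  ∀ x y z : M, min (dist ρ x + dist ρ z - dist x z) (dist ρ z + dist ρ y - dist z y) ≤
    dist ρ x + dist ρ y - dist x y

/-- Four instances of the Gromov product inequality at `ρ` suffice: each of the pairs `x, y` and `z,
w` is compared through both points of the other pair. -/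
lemma HypAt.fourPoint {M : Type*} [PseudoMetricSpace M] {ρ : M} (h : HypAt ρ) : FourPoint M := by
  intro x y z w
  have h1 := min_le_iff.1 (h x y z)
  have h2 := min_le_iff.1 (h x y w)
  have h3 := min_le_iff.1 (h z w x)
  have h4 := min_le_iff.1 (h z w y)
  rw [dist_comm z x] at h3
  rw [dist_comm z y] at h1 h4
  rw [dist_comm w y] at h2
  rw [le_max_iff]
  by_contra! hc
  obtain ⟨hc1, hc2⟩ := hc
  rcases h1 with h1 | h1 <;> rcases h2 with h2 | h2 <;> rcases h3 with h3 | h3 <;>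
    rcases h4 with h4 | h4 <;> linarith

lemma HypAt.of_isometry {S T : Type*} [PseudoMetricSpace S] [PseudoMetricSpace T] {ρ : S} {f : S → T}
    (hf : Isometry f) (h : HypAt (f ρ)) : HypAt ρ := by
  intro x y z
  simpa only [hf.dist_eq] using h (f x) (f y) (f z)

section FourPoint

variable {M : Type*} [MetricSpace M]

/-- A path contains all points between its ends. -/
lemma FourPoint.mem_image_of_between (h4 : FourPoint M) {q : ℝ → M} {a b : ℝ} (hab : a ≤ b)
    (qc : ContinuousOn q (Icc a b)) {m : M}
    (hm : dist (q a) m + dist m (q b) = dist (q a) (q b)) : m ∈ q '' Icc a b := by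
  by_contra hn
  have hqa : q a ∈ q '' Icc a b := mem_image_of_mem q (left_mem_Icc.2 hab)
  have hqb : q b ∈ q '' Icc a b := mem_image_of_mem q (right_mem_Icc.2 hab)
  -- Call `w` behind `m` if `m` lies between `q a` and `w`. The four-point condition keeps every
  -- point that is not behind `m` at distance at least `dist m w` from such a `w`. Balls around the
  -- points behind `m` thus give an open set disjoint from the points not behind, and a path that
  -- avoids `m` would be disconnected.
  have hsep : ∀ z w, dist (q a) z < dist (q a) m + dist m z →
      dist (q a) m + dist m w ≤ dist (q a) w → dist m w ≤ dist w z := by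
    intro z w hz hw
    have := h4 (q a) w m z
    rcases le_max_iff.1 this with h | h <;> rw [dist_comm w] at h <;>
      linarith [dist_nonneg (x := m) (y := z), dist_comm w m, dist_comm w z]
  obtain ⟨z, -, hzU, hzV⟩ := (isPreconnected_Icc.image q qc)
    {z | dist (q a) z < dist (q a) m + dist m z}
    (⋃ w ∈ {w | w ≠ m ∧ dist (q a) m + dist m w ≤ dist (q a) w}, Metric.ball w (dist m w))
    (isOpen_lt (by fun_prop) (by fun_prop)) (isOpen_biUnion fun _ _ => Metric.isOpen_ball)
    (fun z hz => by
      rcases lt_or_ge (dist (q a) z) (dist (q a) m + dist m z) with h | h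
      · exact Or.inl h
      · have hne : z ≠ m := fun hzm => hn (hzm ▸ hz)
        exact Or.inr (mem_biUnion (show _ ∈ {w | _} from ⟨hne, h⟩)
          (Metric.mem_ball_self (dist_pos.2 hne.symm))))
    ⟨q a, hqa, by
      have hne : q a ≠ m := fun h => hn (h ▸ hqa)
      have := dist_pos.2 hne
      change dist (q a) (q a) < dist (q a) m + dist m (q a)
      rw [dist_self, dist_comm m]
      linarith⟩
    ⟨q b, hqb, by
      have hne : q b ≠ m := fun h => hn (h ▸ hqb)
      exact mem_biUnion (show _ ∈ {w | _} from ⟨hne, hm.le⟩)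
        (Metric.mem_ball_self (dist_pos.2 hne.symm))⟩
  obtain ⟨w, ⟨-, hw⟩, hzw⟩ := mem_iUnion₂.1 hzV
  have := hsep z w hzU hw
  rw [Metric.mem_ball, dist_comm] at hzw
  linarith

/-- A space with the four-point condition in which distances can be subdivided is an `ℝ`-tree. -/
lemma FourPoint.isRTree (h4 : FourPoint M) (hm : ∀ x y : M, ∀ s ∈ Icc 0 (dist x y),
    ∃ m, dist x m = s ∧ dist m y = dist x y - s) : IsRTree M := by
  intro x y
  have : Nonempty M := ⟨x⟩
  choose! h hx hy using hm x y
  have hd : (0 : ℝ) ≤ dist x y := dist_nonneg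
  refine ⟨h, ⟨fun s hs t ht => le_antisymm ?_ ?_, ?_, ?_⟩, ?_⟩
  · have := h4 (h s) (h t) x y
    rw [dist_comm _ x, dist_comm _ x, hx s hs, hx t ht, hy s hs, hy t ht] at this
    rcases le_max_iff.1 this with h | h
    · linarith [le_abs_self (s - t)]
    · linarith [neg_le_abs (s - t)]
  · have := abs_dist_sub_le (h s) (h t) x
    rwa [dist_comm _ x, dist_comm _ x, hx s hs, hx t ht] at this
  · exact (dist_eq_zero.1 (hx 0 ⟨le_rfl, hd⟩)).symm
  · refine dist_eq_zero.1 ?_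
    rw [hy _ ⟨hd, le_rfl⟩, sub_self]
  · intro q qc qi q0 q1
    refine Subset.antisymm ?_ ?_
    · rintro _ ⟨t, ht, rfl⟩
      set z := q t with hz
      have tr1 := dist_triangle x z y
      have tr2 := dist_triangle_right x y z
      have tr3 := dist_triangle x y z
      have tr4 := dist_triangle_left z y x
      rw [dist_comm y z] at tr2 tr3
      -- This is the Gromov product of `z` and `y` at `x`, so `h s` is the branch point of the
      -- tripod spanned by `x`, `y` and `z`.
      set s := (dist x z + dist x y - dist z y) / 2 with hs
      have hsI : s ∈ Icc 0 (dist x y) := ⟨by linarith, by linarith [dist_comm z x]⟩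
      have key : dist (h s) z ≤ (dist x z + dist z y - dist x y) / 2 := by
        have := h4 (h s) z x y
        rw [dist_comm _ x, dist_comm z x, hx s hsI, hy s hsI] at this
        rcases le_max_iff.1 this with h | h <;> linarith
      have b1 : dist x (h s) + dist (h s) z = dist x z :=
        le_antisymm (by rw [hx s hsI]; linarith) (dist_triangle _ _ _)
      have b2 : dist z (h s) + dist (h s) y = dist z y :=
        le_antisymm (by rw [hy s hsI, dist_comm z]; linarith) (dist_triangle _ _ _)
      obtain ⟨t1, ht1, e1⟩ := h4.mem_image_of_between ht.1 (qc.mono (Icc_subset_Icc_right ht.2))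
        (m := h s) (by rw [q0]; exact b1)
      obtain ⟨t2, ht2, e2⟩ := h4.mem_image_of_between ht.2 (qc.mono (Icc_subset_Icc_left ht.1))
        (m := h s) (by rw [q1]; exact b2)
      -- The path meets the branch point both before and after time `t`; injectivity forces it to be
      -- there at time `t`, so `q t` lies on the geodesic.
      have : t1 = t2 := qi ⟨ht1.1, ht1.2.trans ht.2⟩ ⟨ht.1.trans ht2.1, ht2.2⟩ (e1.trans e2.symm)
      have ht1' : t1 = t := le_antisymm ht1.2 (this ▸ ht2.1)
      exact ⟨s, hsI, by rw [hz, ← ht1', e1]⟩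
    · rintro _ ⟨s, hs, rfl⟩
      refine h4.mem_image_of_between zero_le_one qc ?_
      rw [q0, q1, hx s hs, hy s hs]
      ring

end FourPoint

/-! ### The four-point condition for recursively constructed trees -/

lemma two_mul_min (a b : ℝ) : 2 * min a b = a + b - |a - b| := by
  rcases le_total a b with h | h
  · rw [min_eq_left h, abs_of_nonpos (sub_nonpos.2 h)]; ring
  · rw [min_eq_right h, abs_of_nonneg (sub_nonneg.2 h)]; ring

lemma hypAt_segment (s : BeadString) :
    HypAt (⟨0, left_mem_Icc.2 s.len_nonneg⟩ : Icc (0 : ℝ) s.len) := by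
  intro x y z
  have h0 : ∀ x : Icc (0 : ℝ) s.len, dist (⟨0, left_mem_Icc.2 s.len_nonneg⟩ : Icc (0 : ℝ) s.len) x =
      x := fun x => by
    rw [Subtype.dist_eq, Real.dist_eq, zero_sub, abs_neg, abs_of_nonneg x.2.1]
  have h1 : ∀ x y : Icc (0 : ℝ) s.len, (x : ℝ) + y - dist x y = 2 * min (x : ℝ) y := fun x y => by
    rw [Subtype.dist_eq, Real.dist_eq, two_mul_min]
  simp only [h0, h1]
  grind

/-- Doubled Gromov products at the root are `2 * min` of the positions on `[0, ℓ]`, unless both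
points lie in one branch, where the product is at least that value. The inequality then reduces to
the one for minima, or to the one inside the branch if all three points share it. -/
lemma hypAt_preGraft {β : ℝ} {s : BeadString} {t : ℕ → RootedRTree} (h : ∀ i, HypAt (t i).root) :
    HypAt (M := PreGraft β s t) (Sum.inl ⟨0, left_mem_Icc.2 s.len_nonneg⟩) := by
  set ρ : PreGraft β s t := Sum.inl ⟨0, left_mem_Icc.2 s.len_nonneg⟩
  let pos : PreGraft β s t → ℝ := Sum.elim (fun x => (x : ℝ)) fun z => s.loc z.1
  let Same : PreGraft β s t → PreGraft β s t → Prop := fun z w =>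
    ∃ i u v, z = Sum.inr ⟨i, u⟩ ∧ w = Sum.inr ⟨i, v⟩
  have hbase : ∀ x : Icc (0 : ℝ) s.len, dist ρ (Sum.inl x) = x :=
    Graft.dist_root_base (β := β) (t := t)
  have hbranch : ∀ i (u : (t i).carrier), dist ρ (Sum.inr ⟨i, u⟩) =
      s.loc i + s.mass i ^ β * dist (t i).root u :=
    Graft.dist_root_branch (β := β) (s := s) (t := t)
  have hsame : ∀ i (u v : (t i).carrier),
      dist (α := PreGraft β s t) (Sum.inr ⟨i, u⟩) (Sum.inr ⟨i, v⟩) = s.mass i ^ β * dist u v :=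
    graftDist_same
  have hmix : ∀ (x : Icc (0 : ℝ) s.len) i (u : (t i).carrier),
      dist (α := PreGraft β s t) (Sum.inl x) (Sum.inr ⟨i, u⟩) =
        |(x : ℝ) - s.loc i| + s.mass i ^ β * dist (t i).root u := fun _ _ _ => rfl
  have hmix' : ∀ (x : Icc (0 : ℝ) s.len) i (u : (t i).carrier),
      dist (α := PreGraft β s t) (Sum.inr ⟨i, u⟩) (Sum.inl x) =
        |(x : ℝ) - s.loc i| + s.mass i ^ β * dist (t i).root u := fun x i u =>
    (dist_comm (α := PreGraft β s t) _ _).trans (hmix x i u)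
  have hsep : ∀ z w, ¬ Same z w → dist ρ z + dist ρ w - dist z w = 2 * min (pos z) (pos w) := by
    rintro (x | ⟨i, u⟩) (y | ⟨j, v⟩) hs <;> rw [two_mul_min]
    · rw [hbase, hbase]
      rfl
    · rw [hbase, hbranch, hmix]
      simp only [pos, Sum.elim_inl, Sum.elim_inr]
      ring
    · rw [hbase, hbranch, hmix']
      simp only [pos, Sum.elim_inl, Sum.elim_inr]
      rw [abs_sub_comm (y : ℝ)]
      ring
    · have hij : i ≠ j := by
        rintro rfl
        exact hs ⟨i, u, v, rfl, rfl⟩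
      have : dist (α := PreGraft β s t) (Sum.inr ⟨i, u⟩) (Sum.inr ⟨j, v⟩) = _ := graftDist_ne hij u v
      rw [hbranch, hbranch, this, dist_comm u]
      simp only [pos, Sum.elim_inr]
      ring
  have hpos : ∀ z w, Same z w → pos z = pos w := by
    rintro _ _ ⟨i, u, v, rfl, rfl⟩
    rfl
  have hge : ∀ z w, 2 * min (pos z) (pos w) ≤ dist ρ z + dist ρ w - dist z w := by
    intro z w
    by_cases hs : Same z w
    · obtain ⟨i, u, v, rfl, rfl⟩ := hs
      rw [hbranch, hbranch, hsame]
      simp only [pos, Sum.elim_inr, min_self]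
      have := mul_le_mul_of_nonneg_left (dist_triangle_left u v (t i).root) (scale_nonneg β s i)
      linarith
    · exact (hsep z w hs).ge
  intro x y z
  by_cases h1 : Same x z <;> by_cases h2 : Same z y
  · obtain ⟨i, u, w, rfl, rfl⟩ := h1
    obtain ⟨j, w', v, hw, rfl⟩ := h2
    obtain ⟨rfl, hw⟩ := Sigma.mk.inj_iff.1 (Sum.inr_injective hw)
    obtain rfl := eq_of_heq hw
    simp only [hbranch, hsame]
    have hi := h i u v w
    have hm := scale_nonneg β s i
    rcases min_le_iff.1 hi with hi | hi <;> refine min_le_iff.2 ?_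
    · exact Or.inl (by nlinarith)
    · exact Or.inr (by nlinarith)
  · refine (min_le_right _ _).trans ?_
    rw [hsep z y h2, ← hpos x z h1]
    exact hge x y
  · refine (min_le_left _ _).trans ?_
    rw [hsep x z h1, hpos z y h2]
    exact hge x y
  · rw [hsep x z h1, hsep z y h2]
    refine le_trans ?_ (hge x y)
    grind

/-- The trees that satisfy the four-point condition. -/
def IsHyp (τ : TreeSpace) : Prop := HypAt τ.out.root

lemma isHyp_mk {T : RootedRTree} (h : HypAt T.root) : IsHyp ⟦T⟧ := by
  obtain ⟨e, he⟩ := Quotient.exact (Quotient.out_eq (⟦T⟧ : TreeSpace))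
  exact HypAt.of_isometry e.isometry (by rwa [he])

lemma isHyp_onePoint : IsHyp onePoint :=
  isHyp_mk fun _ _ _ => (min_le_left _ _)

lemma isHyp_segment (s : BeadString) : IsHyp s.segment := isHyp_mk (hypAt_segment s)

/-- The inequality involves distances only, so it passes from the disjoint union to the quotient.
The one-point default satisfies it as well. -/
lemma isHyp_phi {β : ℝ} {s : BeadString} {τ : ℕ → TreeSpace} (h : ∀ i, IsHyp (τ i)) :
    IsHyp (phi β s τ) := by
  by_cases hg : IsGraftable β s τ
  · rw [phi_eq_mk hg]
    refine isHyp_mk ?_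
    intro x y z
    obtain ⟨x, rfl⟩ := SeparationQuotient.surjective_mk x
    obtain ⟨y, rfl⟩ := SeparationQuotient.surjective_mk y
    obtain ⟨z, rfl⟩ := SeparationQuotient.surjective_mk z
    exact hypAt_preGraft (fun i => h i) x y z
  · rw [phi_eq_onePoint hg]
    exact isHyp_onePoint

lemma isHyp_subtree (β : ℝ) (ξ : List ℕ → BeadString) (k : ℕ) (i : List ℕ) :
    IsHyp (subtree β ξ k i) := by
  induction k generalizing i with
  | zero => exact isHyp_segment _
  | succ k ih => exact isHyp_phi fun j => ih _

/-! ### Limits of increasing sequences of trees -/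

/-- Geodesic points in a real tree. -/
lemma IsRTree.exists_between {M : Type*} [MetricSpace M] (h : IsRTree M) (x y : M) {s : ℝ}
    (hs : s ∈ Icc 0 (dist x y)) : ∃ m, dist x m = s ∧ dist m y = dist x y - s := by
  obtain ⟨g, hg, -⟩ := h x y
  have h0 : (0 : ℝ) ∈ Icc 0 (dist x y) := ⟨le_rfl, dist_nonneg⟩
  have h1 : dist x y ∈ Icc 0 (dist x y) := ⟨dist_nonneg, le_rfl⟩
  refine ⟨g s, ?_, ?_⟩
  · have := hg.dist_eq 0 h0 s hs
    rwa [hg.left, zero_sub, abs_neg, abs_of_nonneg hs.1] at this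
  · have := hg.dist_eq s hs _ h1
    rwa [hg.right, abs_sub_comm, abs_of_nonneg (by linarith [hs.2])] at this

/-- Approximate geodesic points between points that are close to an isometric copy of a real tree. -/
lemma exists_approx_between {M Y : Type*} [MetricSpace M] [MetricSpace Y] (hM : IsRTree M)
    {j : M → Y} (hj : Isometry j) {x y : Y} {ε s : ℝ} (hx : ∃ a, dist (j a) x ≤ ε)
    (hy : ∃ b, dist (j b) y ≤ ε) (hs : s ∈ Icc 0 (dist x y)) :
    ∃ m, dist x m - s ≤ 3 * ε ∧ dist m y - (dist x y - s) ≤ 3 * ε := by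
  obtain ⟨a, ha⟩ := hx
  obtain ⟨b, hb⟩ := hy
  obtain ⟨m, hm1, hm2⟩ := hM.exists_between a b (s := min s (dist a b))
    ⟨le_min hs.1 dist_nonneg, min_le_right _ _⟩
  have hε : 0 ≤ ε := dist_nonneg.trans ha
  have e1 := abs_le.1 (dist_dist_dist_le (j a) (j b) x y)
  rw [hj.dist_eq] at e1
  have e2 := dist_triangle_left x (j m) (j a)
  have e3 := dist_triangle (j m) (j b) y
  rw [hj.dist_eq] at e2 e3
  refine ⟨j m, by linarith [min_le_left s (dist a b)], ?_⟩
  rcases min_cases s (dist a b) with h | h <;> linarith [hs.2, e1.1, e1.2]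

/-- By compactness the larger of the two excesses attains its minimum, which is at most zero. The
triangle inequality makes the sum of the excesses nonnegative, so both vanish. -/
lemma exists_between_of_approx {Y : Type*} [MetricSpace Y] [CompactSpace Y] {x y : Y} {s : ℝ}
    (h : ∀ ε > 0, ∃ m, dist x m - s ≤ ε ∧ dist m y - (dist x y - s) ≤ ε) :
    ∃ m, dist x m = s ∧ dist m y = dist x y - s := by
  obtain ⟨m, -, hm⟩ := isCompact_univ.exists_isMinOn ⟨x, mem_univ x⟩
    (f := fun m => max (dist x m - s) (dist m y - (dist x y - s))) (by fun_prop)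
  have h0 : max (dist x m - s) (dist m y - (dist x y - s)) ≤ 0 := by
    refine le_of_forall_pos_le_add fun ε hε => ?_
    obtain ⟨m', h1, h2⟩ := h ε hε
    rw [zero_add]
    exact (hm (mem_univ m')).trans (max_le h1 h2)
  have h1 := (le_max_left _ _).trans h0
  have h2 := (le_max_right _ _).trans h0
  have := dist_triangle x m y
  exact ⟨m, by linarith, by linarith⟩

/-- An increasing sequence of trees with summable mutual distances converges. -/
lemma exists_tendsto_of_embedsDense {X : ℕ → TreeSpace} {r : ℕ → ℝ} (hr : Summable r)
    (hX : ∀ n, EmbedsDense (X n) (X (n + 1)) (r n)) (hH : ∀ n, IsHyp (X n)) :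
    ∃ T, Tendsto X atTop (𝓝 T) := by
  choose f hf hρ hd using hX
  let L := Metric.InductiveLimit hf
  let Y := UniformSpace.Completion L
  let j : ∀ n, (X n).out.carrier → Y := fun n x => (Metric.toInductiveLimit hf n x : L)
  have hj : ∀ n, Isometry (j n) := fun n =>
    UniformSpace.Completion.coe_isometry.comp (Metric.toInductiveLimit_isometry hf n)
  have hjf : ∀ n x, j (n + 1) (f n x) = j n x := fun n x =>
    congrArg ((↑) : L → Y) (congrFun (Metric.toInductiveLimit_commute hf n) x)
  have hroot : ∀ n, j n (X n).out.root = j 0 (X 0).out.root := by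
    intro n
    induction n with
    | zero => rfl
    | succ n ih => rw [← hρ, hjf, ih]
  have hr0 : ∀ n, 0 ≤ r n := fun n => by
    obtain ⟨x, hx⟩ := hd n (X (n + 1)).out.root
    exact dist_nonneg.trans hx
  have hup : ∀ n m, n ≤ m → ∀ x, ∃ y, j m y = j n x := by
    intro n m hnm x
    induction m, hnm using Nat.le_induction with
    | base => exact ⟨x, rfl⟩
    | succ m hnm ih =>
      obtain ⟨y, hy⟩ := ih
      exact ⟨f m y, by rw [hjf, hy]⟩
  have hdown : ∀ n k y, ∃ x, dist (j n x) (j (n + k) y) ≤ ∑ i ∈ Finset.range k, r (i + n) := by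
    intro n k
    induction k with
    | zero => exact fun y => ⟨y, by rw [Finset.sum_range_zero]; exact (dist_self _).le⟩
    | succ k ih =>
      intro y
      obtain ⟨z, hz⟩ := hd (n + k) y
      obtain ⟨x, hx⟩ := ih z
      refine ⟨x, ?_⟩
      rw [Finset.sum_range_succ]
      refine (dist_triangle _ (j (n + k) z) _).trans (add_le_add hx ?_)
      rw [← hjf, add_comm k n]
      exact ((hj (n + k + 1)).dist_eq _ _).le.trans hz
  -- The tail of the gaps bounds the distance from any point of the limit space to the copy of `X
  -- n`. It drives total boundedness, approximate geodesic points and convergence.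
  let R : ℕ → ℝ := fun n => ∑' i, r (i + n)
  have hR : Tendsto R atTop (𝓝 0) := tendsto_sum_nat_add r
  have hR0 : ∀ n, 0 ≤ R n := fun n => tsum_nonneg fun i => hr0 _
  have hdense : ∀ y : Y, y ∈ closure (⋃ n, range (j n)) := by
    have h1 := (UniformSpace.Completion.denseRange_coe (α := L)).dense_image
      (UniformSpace.Completion.continuous_coe L) (Metric.dense_iUnion_range_toInductiveLimit hf)
    intro y
    refine closure_mono ?_ (h1 y)
    rintro _ ⟨z, hz, rfl⟩
    obtain ⟨n, x, rfl⟩ := mem_iUnion.1 hz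
    exact mem_iUnion.2 ⟨n, x, rfl⟩
  have hnear : ∀ n (y : Y), ∃ x, dist (j n x) y ≤ R n := by
    intro n y
    -- The bound by the distance to the range is a closed condition, so it extends from the dense
    -- union to the completion; compactness of the range then gives an actual nearest point.
    have hcl : IsClosed {y : Y | Metric.infDist y (range (j n)) ≤ R n} :=
      isClosed_le (Metric.continuous_infDist_pt _) continuous_const
    have hy : y ∈ {y : Y | Metric.infDist y (range (j n)) ≤ R n} := by
      refine closure_minimal ?_ hcl (hdense y)
      refine iUnion_subset fun m => ?_
      rintro _ ⟨x, rfl⟩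
      obtain ⟨x', hx'⟩ := hup m (n + m) (by omega) x
      rw [← hx']
      obtain ⟨z, hz⟩ := hdown n m x'
      refine (Metric.infDist_le_dist_of_mem (mem_range_self z)).trans ?_
      rw [dist_comm]
      refine hz.trans ?_
      exact ((summable_nat_add_iff n).2 hr).sum_le_tsum _ fun i _ => hr0 _
    obtain ⟨_, ⟨x, rfl⟩, hx⟩ := (isCompact_range (hj n).continuous).exists_infDist_eq_dist
      ⟨_, mem_range_self (X n).out.root⟩ y
    exact ⟨x, by rw [dist_comm, ← hx]; exact hy⟩
  have hcomp : CompactSpace Y := by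
    refine ⟨TotallyBounded.isCompact_of_isClosed (Metric.totallyBounded_iff.2 fun ε hε => ?_)
      isClosed_univ⟩
    obtain ⟨n, hn⟩ := (hR.eventually (gt_mem_nhds (half_pos hε))).exists
    obtain ⟨t, -, ht, hc⟩ := finite_cover_balls_of_compact
      (isCompact_univ (X := (X n).out.carrier)) (half_pos hε)
    refine ⟨j n '' t, ht.image _, fun y _ => ?_⟩
    obtain ⟨x, hx⟩ := hnear n y
    obtain ⟨z, hz, hxz⟩ := mem_iUnion₂.1 (hc (mem_univ x))
    refine mem_biUnion (mem_image_of_mem _ hz) ?_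
    rw [Metric.mem_ball] at hxz ⊢
    rw [← (hj n).dist_eq] at hxz
    have := dist_triangle_left y (j n z) (j n x)
    linarith
  let ρ : Y := j 0 (X 0).out.root
  have hhyp : HypAt ρ := by
    have hD : Dense (⋃ n, range (j n)) := hdense
    have hclosed : IsClosed {z : Y × Y × Y | min (dist ρ z.1 + dist ρ z.2.2 - dist z.1 z.2.2)
        (dist ρ z.2.2 + dist ρ z.2.1 - dist z.2.2 z.2.1) ≤
          dist ρ z.1 + dist ρ z.2.1 - dist z.1 z.2.1} :=
      isClosed_le (by fun_prop) (by fun_prop)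
    intro x y z
    refine closure_minimal ?_ hclosed ((hD.prod (hD.prod hD)) (x, y, z))
    rintro ⟨_, _, _⟩ ⟨hx, hy, hz⟩
    obtain ⟨n, x, rfl⟩ := mem_iUnion.1 hx
    obtain ⟨m, y, rfl⟩ := mem_iUnion.1 hy
    obtain ⟨k, z, rfl⟩ := mem_iUnion.1 hz
    obtain ⟨x', hx'⟩ := hup n (n + m + k) (by omega) x
    obtain ⟨y', hy'⟩ := hup m (n + m + k) (by omega) y
    obtain ⟨z', hz'⟩ := hup k (n + m + k) (by omega) z
    have := hH (n + m + k) x' y' z'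
    simp only [← (hj (n + m + k)).dist_eq, hroot, hx', hy', hz'] at this
    exact this
  have htree : IsRTree Y := hhyp.fourPoint.isRTree fun x y s hs =>
    exists_between_of_approx fun ε hε => by
      obtain ⟨n, hn⟩ := (hR.eventually (gt_mem_nhds (show 0 < ε / 3 by positivity))).exists
      obtain ⟨m, h1, h2⟩ := exists_approx_between (X n).out.isRTree (hj n) (hnear n x) (hnear n y) hs
      exact ⟨m, by linarith, by linarith⟩
  refine ⟨⟦⟨Y, ρ, htree⟩⟧, tendsto_iff_dist_tendsto_zero.2 ?_⟩
  refine squeeze_zero (fun _ => dist_nonneg) (fun n => ?_) hR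
  conv_lhs => rw [← Quotient.out_eq (X n)]
  exact dist_mk_le (T := ⟨Y, ρ, htree⟩)
    (.of_isometry_of_dense (hj n) (hroot n) (hR0 n) (hnear n))

/-! ### The map on laws and couplings -/

/-- The expected sum of the `p`-th powers of the scaling factors. -/
def massMoment (β p : ℝ) (ν : Measure BeadString) : ℝ≥0∞ :=
  ∫⁻ s, ∑' j, ENNReal.ofReal (s.mass j ^ (p * β)) ∂ν

/-- The `p`-th moment of the height. -/
def heightMoment (p : ℝ) (η : Measure TreeSpace) : ℝ≥0∞ :=
  ∫⁻ τ, ENNReal.ofReal (height τ ^ p) ∂η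

/-- The `p`-th moment of the distance under a coupling. -/
def couplingCost (p : ℝ) (γ : Measure (TreeSpace × TreeSpace)) : ℝ≥0∞ :=
  ∫⁻ z, ENNReal.ofReal (dist z.1 z.2 ^ p) ∂γ

lemma measurable_ofReal_height_rpow (p : ℝ) :
    Measurable fun τ : TreeSpace => ENNReal.ofReal (height τ ^ p) :=
  (measurable_height.pow_const p).ennreal_ofReal

lemma measurable_ofReal_dist_rpow (p : ℝ) :
    Measurable fun z : TreeSpace × TreeSpace => ENNReal.ofReal (dist z.1 z.2 ^ p) :=
  ((measurable_fst.dist measurable_snd).pow_const p).ennreal_ofReal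

lemma measurable_ofReal_mass_rpow (β p : ℝ) (j : ℕ) :
    Measurable fun s : BeadString => ENNReal.ofReal (s.mass j ^ (p * β)) :=
  ((measurable_mass j).pow_const _).ennreal_ofReal

lemma measurable_powerSum {A : Type*} [MeasurableSpace A] (β p : ℝ) {s : A → BeadString}
    (hs : Measurable s) {f : A → ℕ → ℝ≥0∞} (hf : ∀ j, Measurable fun a => f a j) :
    Measurable fun a => powerSum β p (s a) (f a) :=
  Measurable.tsum fun j => ((measurable_ofReal_mass_rpow β p j).comp hs).mul (hf j)

/-- Each mass is independent of the tree attached at its site, so every term factorises. This is the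
source of the contraction factor. -/
lemma lintegral_powerSum {A : Type*} [MeasurableSpace A] (β p : ℝ) (ν : Measure BeadString)
    [IsProbabilityMeasure ν] (κ : Measure A) [IsProbabilityMeasure κ] {g : A → ℝ≥0∞}
    (hg : Measurable g) :
    ∫⁻ z, powerSum β p z.1 (fun j => g (z.2 j)) ∂(ν.prod (Measure.infinitePi fun _ : ℕ => κ)) =
      massMoment β p ν * ∫⁻ a, g a ∂κ := by
  simp only [powerSum]
  have hm : ∀ j, Measurable fun z : BeadString × (ℕ → A) =>
      ENNReal.ofReal (z.1.mass j ^ (p * β)) * g (z.2 j) := fun j =>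
    ((measurable_ofReal_mass_rpow β p j).comp measurable_fst).mul
      (hg.comp ((measurable_pi_apply j).comp measurable_snd))
  rw [lintegral_tsum fun j => (hm j).aemeasurable, massMoment,
    lintegral_tsum fun j => (measurable_ofReal_mass_rpow β p j).aemeasurable,
    ← ENNReal.tsum_mul_right]
  refine tsum_congr fun j => ?_
  rw [lintegral_prod_mul (f := fun s : BeadString => ENNReal.ofReal (s.mass j ^ (p * β)))
    (g := fun t : ℕ → A => g (t j)) (measurable_ofReal_mass_rpow β p j).aemeasurable
    (hg.comp (measurable_pi_apply j)).aemeasurable]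
  congr 1
  rw [← lintegral_map (f := g) (g := fun t : ℕ → A => t j) hg (measurable_pi_apply j),
    Measure.infinitePi_map_eval]

section coupling

variable {β p : ℝ} {ν : Measure BeadString} [IsProbabilityMeasure ν]

/-- The law of the pair of grafted trees, if the pairs of attached trees have the law `γ`. -/
def couplingMap (β : ℝ) (ν : Measure BeadString) (γ : Measure (TreeSpace × TreeSpace)) :
    Measure (TreeSpace × TreeSpace) :=
  (ν.prod (Measure.infinitePi fun _ : ℕ => γ)).map fun z =>
    (phi β z.1 fun i => (z.2 i).1, phi β z.1 fun i => (z.2 i).2)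

lemma measurable_phi_comp {A : Type*} [MeasurableSpace A] (hβ : 0 < β) {s : A → BeadString}
    (hs : Measurable s) {τ : A → ℕ → TreeSpace} (hτ : ∀ j, Measurable fun a => τ a j) :
    Measurable fun a => phi β (s a) (τ a) :=
  (measurable_phi hβ).comp (hs.prodMk (measurable_pi_iff.2 hτ))

lemma measurable_couplingMap_aux (hβ : 0 < β) :
    Measurable fun z : BeadString × (ℕ → TreeSpace × TreeSpace) =>
      (phi β z.1 fun i => (z.2 i).1, phi β z.1 fun i => (z.2 i).2) :=
  (measurable_phi_comp hβ measurable_fst fun j => by fun_prop).prodMk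
    (measurable_phi_comp hβ measurable_fst fun j => by fun_prop)

lemma map_prod_infinitePi {A B : Type*} [MeasurableSpace A] [MeasurableSpace B]
    (γ : Measure A) [IsProbabilityMeasure γ] {f : A → B} (hf : Measurable f) :
    (ν.prod (Measure.infinitePi fun _ : ℕ => γ)).map (fun z => (z.1, fun i => f (z.2 i))) =
      ν.prod (Measure.infinitePi fun _ : ℕ => γ.map f) := by
  have : IsProbabilityMeasure (γ.map f) := Measure.isProbabilityMeasure_map hf.aemeasurable
  have h1 := Measure.infinitePi_map_pi (fun _ : ℕ => γ) (f := fun _ => f) fun _ => hf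
  rw [← h1]
  conv_rhs => rw [← Measure.map_id (μ := ν)]
  rw [Measure.map_prod_map _ _ measurable_id (by fun_prop)]
  rfl

/-- Applied to the two projections, this shows that `couplingMap` produces a coupling of the images
under `Phi` of the two marginals. -/
lemma map_couplingMap (hβ : 0 < β) (γ : Measure (TreeSpace × TreeSpace)) [IsProbabilityMeasure γ]
    {f : TreeSpace × TreeSpace → TreeSpace} (hf : Measurable f)
    (hfφ : ∀ s (t : ℕ → TreeSpace × TreeSpace),
      f (phi β s fun i => (t i).1, phi β s fun i => (t i).2) = phi β s fun i => f (t i)) :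
    (couplingMap β ν γ).map f = Phi β ν (γ.map f) := by
  rw [couplingMap, Measure.map_map hf (measurable_couplingMap_aux hβ), Phi,
    ← map_prod_infinitePi γ hf, Measure.map_map (measurable_phi hβ) (by fun_prop)]
  congr 1
  funext z
  exact hfφ z.1 z.2

lemma isProbabilityMeasure_couplingMap (hβ : 0 < β) (γ : Measure (TreeSpace × TreeSpace))
    [IsProbabilityMeasure γ] : IsProbabilityMeasure (couplingMap β ν γ) :=
  Measure.isProbabilityMeasure_map (measurable_couplingMap_aux hβ).aemeasurable

lemma couplingCost_couplingMap_le (hβ : 0 < β) (hp : 0 < p) (γ : Measure (TreeSpace × TreeSpace))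
    [IsProbabilityMeasure γ] :
    couplingCost p (couplingMap β ν γ) ≤ massMoment β p ν * couplingCost p γ := by
  rw [couplingCost, couplingMap,
    lintegral_map (measurable_ofReal_dist_rpow p) (measurable_couplingMap_aux hβ), couplingCost,
    ← lintegral_powerSum β p ν γ (measurable_ofReal_dist_rpow p)]
  exact lintegral_mono fun z => ofReal_dist_phi_le hp _ _ _

lemma iterate_couplingMap (hβ : 0 < β) (hp : 0 < p) (γ : Measure (TreeSpace × TreeSpace))
    [IsProbabilityMeasure γ] (n : ℕ) :
    IsProbabilityMeasure ((couplingMap β ν)^[n] γ) ∧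
      ((couplingMap β ν)^[n] γ).map Prod.fst = (Phi β ν)^[n] (γ.map Prod.fst) ∧
      ((couplingMap β ν)^[n] γ).map Prod.snd = (Phi β ν)^[n] (γ.map Prod.snd) ∧
      couplingCost p ((couplingMap β ν)^[n] γ) ≤ massMoment β p ν ^ n * couplingCost p γ := by
  induction n with
  | zero => exact ⟨inferInstanceAs (IsProbabilityMeasure γ), rfl, rfl, by simp⟩
  | succ n ih =>
    obtain ⟨h1, h2, h3, h4⟩ := ih
    simp only [Function.iterate_succ_apply']
    refine ⟨isProbabilityMeasure_couplingMap hβ _, ?_, ?_, ?_⟩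
    · rw [map_couplingMap hβ _ measurable_fst fun _ _ => rfl, h2]
    · rw [map_couplingMap hβ _ measurable_snd fun _ _ => rfl, h3]
    · refine (couplingCost_couplingMap_le hβ hp _).trans ?_
      rw [pow_succ', mul_assoc]
      gcongr

end coupling

/-! ### Couplings, the Wasserstein distance and equality of laws. -/

lemma wasserstein_le {p : ℝ} (hp : 0 < p) {η η' : Measure TreeSpace}
    {γ : Measure (TreeSpace × TreeSpace)} (h1 : γ.map Prod.fst = η) (h2 : γ.map Prod.snd = η') :
    wasserstein p η η' ≤ couplingCost p γ ^ (1 / p) := by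
  refine ENNReal.rpow_le_rpow (iInf₂_le_of_le γ ⟨h1, h2⟩ (lintegral_mono fun z => ?_))
    (by positivity)
  exact ENNReal.ofReal_le_ofReal (Real.rpow_le_rpow (dGH_nonneg _ _) (dGH_le_dist _ _) hp.le)

/-- By Markov's inequality, a cost of at most `ε ^ p * ε` leaves probability at most `ε` for a
distance of at least `ε`. -/
lemma le_thickening_of_coupling {p ε : ℝ} (hp : 0 < p) (hε : 0 < ε) {η η' : Measure TreeSpace}
    {γ : Measure (TreeSpace × TreeSpace)} (h1 : γ.map Prod.fst = η) (h2 : γ.map Prod.snd = η')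
    (hγ : couplingCost p γ ≤ ENNReal.ofReal (ε ^ p * ε)) {B : Set TreeSpace}
    (hB : MeasurableSet B) : η B ≤ η' (Metric.thickening ε B) + ENNReal.ofReal ε := by
  rw [← h1, ← h2, Measure.map_apply measurable_fst hB,
    Measure.map_apply measurable_snd Metric.isOpen_thickening.measurableSet]
  have hsub : (Prod.fst ⁻¹' B : Set (TreeSpace × TreeSpace)) ⊆
      Prod.snd ⁻¹' Metric.thickening ε B ∪
        {z | ENNReal.ofReal (ε ^ p) ≤ ENNReal.ofReal (dist z.1 z.2 ^ p)} := by
    intro z hz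
    rcases lt_or_ge (dist z.1 z.2) ε with h | h
    · exact Or.inl (Metric.mem_thickening_iff.2 ⟨z.1, hz, by rwa [dist_comm]⟩)
    · exact Or.inr (ENNReal.ofReal_le_ofReal (Real.rpow_le_rpow hε.le h hp.le))
  refine (measure_mono hsub).trans ((measure_union_le _ _).trans (add_le_add le_rfl ?_))
  have hm := mul_meas_ge_le_lintegral (μ := γ) (measurable_ofReal_dist_rpow p)
    (ENNReal.ofReal (ε ^ p))
  have hεp : 0 < ε ^ p := Real.rpow_pos_of_pos hε p
  rw [ENNReal.ofReal_mul hεp.le] at hγ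
  exact (ENNReal.mul_le_mul_iff_right (by simpa using hεp) ENNReal.ofReal_ne_top).1 (hm.trans hγ)

/-- Two laws with couplings of arbitrarily small cost are equal. -/
lemma eq_of_couplingCost {p : ℝ} (hp : 0 < p) {η η' : Measure TreeSpace} [IsProbabilityMeasure η]
    [IsProbabilityMeasure η'] (h : ∀ ε > 0, ∃ γ : Measure (TreeSpace × TreeSpace),
      γ.map Prod.fst = η ∧ γ.map Prod.snd = η' ∧ couplingCost p γ ≤ ε) : η = η' := by
  -- Small couplings make the Lévy–Prokhorov distance vanish. This suffices for equality on closed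
  -- sets, which form a generating `π`-system.
  have h0 : levyProkhorovEDist η η' = 0 := by
    refine le_antisymm (levyProkhorovEDist_le_of_forall_le _ _ _ fun ε B hε hfin hB => ?_) bot_le
    have hε' : 0 < ε.toReal := ENNReal.toReal_pos hε.ne' hfin.ne
    obtain ⟨γ, h1, h2, h3⟩ := h (ENNReal.ofReal (ε.toReal ^ p * ε.toReal))
      (ENNReal.ofReal_pos.2 (by positivity))
    have := le_thickening_of_coupling hp hε' h1 h2 h3 hB
    rwa [ENNReal.ofReal_toReal hfin.ne] at this
  have hgen : (inferInstance : MeasurableSpace TreeSpace) =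
      MeasurableSpace.generateFrom {s | IsClosed s} := borel_eq_generateFrom_isClosed
  refine ext_of_generate_finite _ hgen isPiSystem_isClosed (fun F hF => ?_)
    (measure_univ.trans measure_univ.symm)
  exact measure_eq_measure_of_levyProkhorovEDist_eq_zero_of_isClosed h0 (s := F) hF
    ⟨1, one_pos, measure_ne_top _ _⟩ ⟨1, one_pos, measure_ne_top _ _⟩

lemma ofReal_dist_rpow_le_height {p : ℝ} (hp : 0 < p) (x y : TreeSpace) :
    ENNReal.ofReal (dist x y ^ p) ≤
      ENNReal.ofReal (height x ^ p) + ENNReal.ofReal (height y ^ p) := by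
  have h := Real.rpow_le_rpow dist_nonneg (dist_le_max_height x y) hp.le
  rcases max_cases (height x) (height y) with ⟨h1, -⟩ | ⟨h1, -⟩ <;> rw [h1] at h
  · exact (ENNReal.ofReal_le_ofReal h).trans le_self_add
  · exact (ENNReal.ofReal_le_ofReal h).trans le_add_self

lemma couplingCost_prod_le {p : ℝ} (hp : 0 < p) (η η' : Measure TreeSpace) [IsProbabilityMeasure η]
    [IsProbabilityMeasure η'] :
    couplingCost p (η.prod η') ≤ heightMoment p η + heightMoment p η' := by
  have e1 : ∫⁻ z, ENNReal.ofReal (height z.1 ^ p) ∂(η.prod η') = heightMoment p η :=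
    measurePreserving_fst.lintegral_comp (measurable_ofReal_height_rpow p)
  have e2 : ∫⁻ z, ENNReal.ofReal (height z.2 ^ p) ∂(η.prod η') = heightMoment p η' :=
    measurePreserving_snd.lintegral_comp (measurable_ofReal_height_rpow p)
  have hm : Measurable fun z : TreeSpace × TreeSpace => ENNReal.ofReal (height z.1 ^ p) :=
    (measurable_ofReal_height_rpow p).comp measurable_fst
  rw [← e1, ← e2, ← lintegral_add_left hm]
  exact lintegral_mono fun z => ofReal_dist_rpow_le_height hp z.1 z.2

/-- The height is at most the length plus the `ℓ^p` norm of the rescaled heights; Minkowski's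
inequality in `L^p`, which uses `1 ≤ p`, separates the two. -/
lemma heightMoment_Phi_le {β p : ℝ} {ν : Measure BeadString} [IsProbabilityMeasure ν] (hβ : 0 < β)
    (hp : 1 ≤ p) (η : Measure TreeSpace) [IsProbabilityMeasure η] :
    heightMoment p (Phi β ν η) ^ (1 / p) ≤ (∫⁻ s, ENNReal.ofReal (s.len ^ p) ∂ν) ^ (1 / p) +
      massMoment β p ν ^ (1 / p) * heightMoment p η ^ (1 / p) := by
  have hp0 : 0 < p := one_pos.trans_le hp
  let Q := ν.prod (Measure.infinitePi fun _ : ℕ => η)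
  let f : BeadString × (ℕ → TreeSpace) → ℝ≥0∞ := fun z => ENNReal.ofReal z.1.len
  let g : BeadString × (ℕ → TreeSpace) → ℝ≥0∞ := fun z =>
    powerSum β p z.1 (fun i => ENNReal.ofReal (height (z.2 i) ^ p)) ^ (1 / p)
  have hf : Measurable f := (measurable_len.comp measurable_fst).ennreal_ofReal
  have hg : Measurable g := (measurable_powerSum β p measurable_fst fun j =>
    (measurable_ofReal_height_rpow p).comp ((measurable_pi_apply j).comp measurable_snd)).pow_const _
  have h1 : heightMoment p (Phi β ν η) ≤ ∫⁻ z, (f + g) z ^ p ∂Q := by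
    rw [heightMoment, Phi, lintegral_map (measurable_ofReal_height_rpow p) (measurable_phi hβ)]
    refine lintegral_mono fun z => ?_
    rw [← ENNReal.ofReal_rpow_of_nonneg (height_nonneg _) hp0.le]
    exact ENNReal.rpow_le_rpow (ofReal_height_phi_le hp0 _ _) hp0.le
  have h2 : ∫⁻ z, f z ^ p ∂Q = ∫⁻ s, ENNReal.ofReal (s.len ^ p) ∂ν := by
    have hm : Measurable fun s : BeadString => ENNReal.ofReal (s.len ^ p) :=
      (measurable_len.pow_const p).ennreal_ofReal
    have e := lintegral_map (μ := Q) hm measurable_fst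
    rw [← Measure.fst, Measure.fst_prod] at e
    rw [e]
    exact lintegral_congr fun z => ENNReal.ofReal_rpow_of_nonneg z.1.len_nonneg hp0.le
  have h3 : ∫⁻ z, g z ^ p ∂Q = massMoment β p ν * heightMoment p η := by
    rw [heightMoment, ← lintegral_powerSum β p ν η (measurable_ofReal_height_rpow p)]
    refine lintegral_congr fun z => ?_
    rw [← ENNReal.rpow_mul, one_div_mul_cancel hp0.ne', ENNReal.rpow_one]
  have h4 := ENNReal.lintegral_Lp_add_le (μ := Q) hf.aemeasurable hg.aemeasurable hp
  rw [h2, h3, ENNReal.mul_rpow_of_nonneg _ _ (by positivity)] at h4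
  exact (ENNReal.rpow_le_rpow h1 (by positivity)).trans h4

/-! ### The branching property -/

/-- The family of strings at the descendants of the individual `j` of the first generation. -/
def shift (j : ℕ) (ξ : List ℕ → BeadString) : List ℕ → BeadString := fun v => ξ (j :: v)

lemma measurable_shift (j : ℕ) : Measurable (shift j) :=
  measurable_pi_iff.2 fun _ => measurable_pi_apply _

lemma subtree_cons (β : ℝ) (ξ : List ℕ → BeadString) (k j : ℕ) (v : List ℕ) :
    subtree β ξ k (j :: v) = subtree β (shift j ξ) k v := by
  induction k generalizing v with
  | zero => rfl
  | succ k ih => exact congrArg (phi β (ξ (j :: v))) (funext fun i => ih (v ++ [i]))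

/-- `subtree` recurses at the far end of words. Here the recursion is read from the root, where the
subtrees of the first generation are the same functional of shifted families. -/
lemma recTree_succ (β : ℝ) (ξ : List ℕ → BeadString) (n : ℕ) :
    recTree β ξ (n + 1) = phi β (ξ []) fun j => recTree β (shift j ξ) n :=
  congrArg (phi β (ξ [])) (funext fun j => subtree_cons β ξ n j [])

lemma measurable_recTree {β : ℝ} (hβ : 0 < β) (n : ℕ) :
    Measurable fun ξ : List ℕ → BeadString => recTree β ξ n := by
  induction n with
  | zero => exact measurable_segment.comp (measurable_pi_apply [])
  | succ n ih =>
    simp only [recTree_succ]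
    exact measurable_phi_comp hβ (measurable_pi_apply []) fun j => ih.comp (measurable_shift j)

section branching

variable (ν : Measure BeadString) [IsProbabilityMeasure ν]

/-- The law of i.i.d. strings, indexed by the Ulam–Harris tree. -/
def stringLaw : Measure (List ℕ → BeadString) := Measure.infinitePi fun _ => ν

instance : IsProbabilityMeasure (stringLaw ν) := by unfold stringLaw; infer_instance

/-- A family of strings from the string at the root and the families at the first generation. -/
def assemble (z : BeadString × (ℕ → List ℕ → BeadString)) : List ℕ → BeadString
  | [] => z.1
  | j :: v => z.2 j v

lemma measurable_assemble : Measurable assemble := by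
  refine measurable_pi_iff.2 fun v => ?_
  cases v with
  | nil => exact measurable_fst
  | cons j v =>
    exact (measurable_pi_apply v).comp ((measurable_pi_apply j).comp measurable_snd)

/-- The empty word and the words `j :: v` partition all words, so the two product measures agree on
finite boxes; currying regroups the nonempty words by their first letter. -/
lemma map_assemble :
    (ν.prod (Measure.infinitePi fun _ : ℕ => stringLaw ν)).map assemble = stringLaw ν := by
  classical
  refine Measure.eq_infinitePi _ fun S t ht => ?_
  let c : ℕ × List ℕ → List ℕ := fun z => z.1 :: z.2
  have hc : Function.Injective c := fun z w h => by
    obtain ⟨h1, h2⟩ := List.cons.inj h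
    exact Prod.ext h1 h2
  have hcurry : Measure.infinitePi (fun _ : ℕ => stringLaw ν) =
      (Measure.infinitePi fun _ : ℕ × List ℕ => ν).map (MeasurableEquiv.curry ℕ (List ℕ) BeadString) :=
    (Measure.infinitePi_map_curry fun _ _ => ν).symm
  have hprod : ν.prod (Measure.infinitePi fun _ : ℕ => stringLaw ν) =
      (ν.prod (Measure.infinitePi fun _ : ℕ × List ℕ => ν)).map
        (Prod.map id (MeasurableEquiv.curry ℕ (List ℕ) BeadString)) := by
    rw [← Measure.map_prod_map _ _ measurable_id (MeasurableEquiv.measurable _), Measure.map_id,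
      hcurry]
  have hS : MeasurableSet (Set.pi (S : Set (List ℕ)) t) := .pi S.countable_toSet fun _ _ => ht _
  have hpre : (assemble ∘ Prod.map id (MeasurableEquiv.curry ℕ (List ℕ) BeadString)) ⁻¹'
      (Set.pi (S : Set (List ℕ)) t) = {s | [] ∈ S → s ∈ t []} ×ˢ
        Set.pi ((S.preimage c hc.injOn : Finset (ℕ × List ℕ)) : Set (ℕ × List ℕ))
          fun z => t (c z) := by
    ext ⟨s, f⟩
    constructor
    · intro h
      exact ⟨fun h0 => h [] h0, fun z hz => h (c z) (by simpa using hz)⟩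
    · rintro ⟨h0, h1⟩ v hv
      cases v with
      | nil => exact h0 hv
      | cons j v => exact h1 (j, v) (by simpa [c] using hv)
  rw [hprod, Measure.map_map measurable_assemble
    (measurable_id.prodMap (MeasurableEquiv.measurable _)), Measure.map_apply
    (measurable_assemble.comp (measurable_id.prodMap (MeasurableEquiv.measurable _))) hS, hpre,
    Measure.prod_prod, Measure.infinitePi_pi _ fun _ _ => ht _]
  -- The root contributes its own factor if the box constrains it, and the condition on it is
  -- vacuous otherwise.
  by_cases h0 : [] ∈ S
  · have hS' : S.preimage c hc.injOn = (S.erase []).preimage c hc.injOn := by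
      ext z
      simp [c]
    rw [← Finset.mul_prod_erase S _ h0, hS', Finset.prod_preimage c (S.erase []) hc.injOn
      (fun v => ν (t v))]
    · simp [h0]
    · intro v hv hvc
      cases v with
      | nil => simp at hv
      | cons j v => exact absurd ⟨(j, v), rfl⟩ hvc
  · rw [Finset.prod_preimage c S hc.injOn (fun v => ν (t v))]
    · simp [h0]
    · intro v hv hvc
      cases v with
      | nil => exact absurd hv h0
      | cons j v => exact absurd ⟨(j, v), rfl⟩ hvc

/-- The branching property. -/
lemma map_branching {A : Type*} [MeasurableSpace A] {F : (List ℕ → BeadString) → A}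
    (hF : Measurable F) : (stringLaw ν).map (fun ξ => (ξ [], fun j => F (shift j ξ))) =
      ν.prod (Measure.infinitePi fun _ : ℕ => (stringLaw ν).map F) := by
  have hm : Measurable fun ξ : List ℕ → BeadString => (ξ [], fun j => F (shift j ξ)) :=
    (measurable_pi_apply []).prodMk (measurable_pi_iff.2 fun j => hF.comp (measurable_shift j))
  conv_lhs => rw [← map_assemble ν]
  rw [Measure.map_map hm measurable_assemble, ← map_prod_infinitePi (stringLaw ν) hF]
  rfl

lemma lintegral_powerSum_shift (β p : ℝ) {g : (List ℕ → BeadString) → ℝ≥0∞} (hg : Measurable g) :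
    ∫⁻ ξ, powerSum β p (ξ []) (fun j => g (shift j ξ)) ∂(stringLaw ν) =
      massMoment β p ν * ∫⁻ ξ, g ξ ∂(stringLaw ν) := by
  have hm : Measurable fun ξ : List ℕ → BeadString => (ξ [], fun j => shift j ξ) :=
    (measurable_pi_apply []).prodMk (measurable_pi_iff.2 fun j => measurable_shift j)
  have hb := map_branching ν measurable_id
  rw [Measure.map_id] at hb
  rw [← lintegral_powerSum β p ν (stringLaw ν) hg, ← hb]
  exact (lintegral_map (measurable_powerSum β p measurable_fst fun j =>
    hg.comp ((measurable_pi_apply j).comp measurable_snd)) hm).symm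

lemma measurePreserving_root :
    MeasurePreserving (fun ξ : List ℕ → BeadString => ξ []) (stringLaw ν) ν :=
  measurePreserving_eval_infinitePi (fun _ => ν) []

lemma measurePreserving_shift (j : ℕ) : MeasurePreserving (shift j) (stringLaw ν) (stringLaw ν) := by
  have hb := map_branching ν measurable_id
  rw [Measure.map_id] at hb
  have hm : Measurable fun ξ : List ℕ → BeadString => (ξ [], fun j => shift j ξ) :=
    (measurable_pi_apply []).prodMk (measurable_pi_iff.2 fun j => measurable_shift j)
  have h1 : MeasurePreserving (fun ξ : List ℕ → BeadString => (ξ [], fun j => shift j ξ))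
      (stringLaw ν) (ν.prod (Measure.infinitePi fun _ : ℕ => stringLaw ν)) := ⟨hm, hb⟩
  exact ((measurePreserving_eval_infinitePi (fun _ : ℕ => stringLaw ν) j).comp
    measurePreserving_snd).comp h1

end branching

/-! ### Convergence of the recursive construction -/

/-- The law of `Ť_n`. -/
lemma map_recTree_succ {β : ℝ} (hβ : 0 < β) (ν : Measure BeadString) [IsProbabilityMeasure ν]
    (n : ℕ) : (stringLaw ν).map (fun ξ => recTree β ξ (n + 1)) =
      Phi β ν ((stringLaw ν).map fun ξ => recTree β ξ n) := by
  have hm : Measurable fun ξ : List ℕ → BeadString => (ξ [], fun j => recTree β (shift j ξ) n) :=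
    (measurable_pi_apply []).prodMk (measurable_pi_iff.2 fun j =>
      (measurable_recTree hβ n).comp (measurable_shift j))
  rw [Phi, ← map_branching ν (measurable_recTree hβ n), Measure.map_map (measurable_phi hβ) hm]
  simp only [recTree_succ]
  rfl

/-- The sum over the `n`-th generation of the `p`-th powers of the rescaled lengths. -/
def generationSum (β p : ℝ) : ℕ → (List ℕ → BeadString) → ℝ≥0∞
  | 0, ξ => ENNReal.ofReal ((ξ []).len ^ p)
  | n + 1, ξ => powerSum β p (ξ []) fun j => generationSum β p n (shift j ξ)

lemma measurable_generationSum (β p : ℝ) (n : ℕ) : Measurable (generationSum β p n) := by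
  induction n with
  | zero => exact ((measurable_len.comp (measurable_pi_apply [])).pow_const p).ennreal_ofReal
  | succ n ih =>
    exact measurable_powerSum β p (measurable_pi_apply []) fun j => ih.comp (measurable_shift j)

lemma massMoment_rpow_lt_one {β p : ℝ} {ν : Measure BeadString} (hp : 0 < p) (hc : massMoment β p ν < 1) :
    massMoment β p ν ^ (1 / p) < 1 :=
  ENNReal.rpow_lt_one hc (by positivity)

lemma tsum_pow_lt_top {q : ℝ≥0∞} (hq : q < 1) : ∑' n : ℕ, q ^ n < ∞ := by
  rw [ENNReal.tsum_geometric, ENNReal.inv_lt_top]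
  exact tsub_pos_of_lt hq

/-- A uniform bound for the height moments. -/
def momentBound (β p : ℝ) (ν : Measure BeadString) : ℝ≥0∞ :=
  ((∫⁻ s, ENNReal.ofReal (s.len ^ p) ∂ν) ^ (1 / p) *
    ∑' n : ℕ, (massMoment β p ν ^ (1 / p)) ^ n) ^ p

lemma momentBound_lt_top {β p : ℝ} {ν : Measure BeadString} (hp : 0 < p) (hlen : ∫⁻ s, ENNReal.ofReal (s.len ^ p) ∂ν < ∞)
    (hc : massMoment β p ν < 1) : momentBound β p ν < ∞ :=
  ENNReal.rpow_lt_top_of_nonneg hp.le (ENNReal.mul_lt_top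
    (ENNReal.rpow_lt_top_of_nonneg (by positivity) hlen.ne)
    (tsum_pow_lt_top (massMoment_rpow_lt_one hp hc))).ne

lemma lintegral_ofReal_dist_rpow_le {A : Type*} [MeasurableSpace A] (κ : Measure A) {p : ℝ}
    (hp : 0 < p) {R R' : A → TreeSpace} (hR : Measurable R) (hR' : Measurable R') :
    ∫⁻ a, ENNReal.ofReal (dist (R a) (R' a) ^ p) ∂κ ≤
      heightMoment p (κ.map R) + heightMoment p (κ.map R') := by
  have hm : Measurable fun a => ENNReal.ofReal (height (R a) ^ p) :=
    (measurable_ofReal_height_rpow p).comp hR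
  rw [heightMoment, heightMoment, lintegral_map (measurable_ofReal_height_rpow p) hR,
    lintegral_map (measurable_ofReal_height_rpow p) hR', ← lintegral_add_left hm]
  exact lintegral_mono fun a => ofReal_dist_rpow_le_height hp _ _

section

variable {β p : ℝ} {ν : Measure BeadString} [IsProbabilityMeasure ν]

lemma lintegral_generationSum (n : ℕ) : ∫⁻ ξ, generationSum β p n ξ ∂(stringLaw ν) =
    massMoment β p ν ^ n * ∫⁻ s, ENNReal.ofReal (s.len ^ p) ∂ν := by
  induction n with
  | zero =>
    rw [pow_zero, one_mul]
    exact (measurePreserving_root ν).lintegral_comp (measurable_len.pow_const p).ennreal_ofReal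
  | succ n ih =>
    rw [pow_succ', mul_assoc, ← ih]
    exact lintegral_powerSum_shift ν β p (measurable_generationSum β p n)

lemma isProbabilityMeasure_map_recTree (hβ : 0 < β) (n : ℕ) :
    IsProbabilityMeasure ((stringLaw ν).map fun ξ => recTree β ξ n) :=
  Measure.isProbabilityMeasure_map (measurable_recTree hβ n).aemeasurable

lemma heightMoment_recTree_le (hβ : 0 < β) (hp : 1 ≤ p) (n : ℕ) :
    heightMoment p ((stringLaw ν).map fun ξ => recTree β ξ n) ≤ momentBound β p ν := by
  have hp0 : 0 < p := one_pos.trans_le hp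
  set a := (∫⁻ s, ENNReal.ofReal (s.len ^ p) ∂ν) ^ (1 / p) with ha
  set q := massMoment β p ν ^ (1 / p) with hq
  -- The geometric sum makes `a * ∑' n, q ^ n` invariant under `h ↦ a + q * h`, the recursion of
  -- `heightMoment_Phi_le`, so the bound survives the induction.
  have hS : ∑' n : ℕ, q ^ n = 1 + q * ∑' n : ℕ, q ^ n := by
    rw [← ENNReal.tsum_mul_left, tsum_eq_zero_add' ENNReal.summable, pow_zero]
    simp only [pow_succ']
  have key : heightMoment p ((stringLaw ν).map fun ξ => recTree β ξ n) ^ (1 / p) ≤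
      a * ∑' n : ℕ, q ^ n := by
    induction n with
    | zero =>
      have h0 : heightMoment p ((stringLaw ν).map fun ξ => recTree β ξ 0) =
          ∫⁻ s, ENNReal.ofReal (s.len ^ p) ∂ν := by
        rw [heightMoment, lintegral_map (measurable_ofReal_height_rpow p) (measurable_recTree hβ 0)]
        refine Eq.trans (lintegral_congr fun ξ => ?_) ((measurePreserving_root ν).lintegral_comp
          (measurable_len.pow_const p).ennreal_ofReal)
        rw [recTree, subtree, height_segment]
      rw [h0, ← ha, hS, mul_add, mul_one]
      exact le_self_add
    | succ n ih =>
      have := isProbabilityMeasure_map_recTree (ν := ν) hβ n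
      rw [map_recTree_succ hβ]
      refine (heightMoment_Phi_le hβ hp _).trans ?_
      rw [← ha, ← hq, hS, mul_add, mul_one, mul_left_comm]
      gcongr
  rw [momentBound, ← ha, ← hq]
  calc _ = (heightMoment p ((stringLaw ν).map fun ξ => recTree β ξ n) ^ (1 / p)) ^ p := by
        rw [← ENNReal.rpow_mul, one_div_mul_cancel hp0.ne', ENNReal.rpow_one]
    _ ≤ _ := ENNReal.rpow_le_rpow key hp0.le

/-- The expected power sum of the heights is finite. This rules out the one-point default almost
surely, and with it the only way in which the sequence could fail to increase. -/
lemma ae_isGraftable (hβ : 0 < β) (hp : 1 ≤ p)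
    (hlen : ∫⁻ s, ENNReal.ofReal (s.len ^ p) ∂ν < ∞) (hc : massMoment β p ν < 1) (n : ℕ) :
    ∀ᵐ ξ ∂(stringLaw ν), IsGraftable β (ξ []) fun j => recTree β (shift j ξ) n := by
  have hp0 : 0 < p := one_pos.trans_le hp
  have hg : Measurable fun ξ => ENNReal.ofReal (height (recTree β ξ n) ^ p) :=
    (measurable_ofReal_height_rpow p).comp (measurable_recTree hβ n)
  have h1 : ∫⁻ ξ, ENNReal.ofReal (height (recTree β ξ n) ^ p) ∂(stringLaw ν) < ∞ := by
    rw [← lintegral_map (measurable_ofReal_height_rpow p) (measurable_recTree hβ n)]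
    exact (heightMoment_recTree_le hβ hp n).trans_lt (momentBound_lt_top hp0 hlen hc)
  have h2 := lintegral_powerSum_shift ν β p hg
  have h3 := ae_lt_top (measurable_powerSum β p (measurable_pi_apply []) fun j =>
    hg.comp (measurable_shift j)) (h2.trans_ne (ENNReal.mul_lt_top (hc.trans ENNReal.one_lt_top) h1).ne)
  filter_upwards [h3] with ξ hξ
  exact isGraftable_of_powerSum hp0 hξ.ne

lemma ae_generationSum_lt_top (hlen : ∫⁻ s, ENNReal.ofReal (s.len ^ p) ∂ν < ∞)
    (hc : massMoment β p ν < 1) (n : ℕ) : ∀ᵐ ξ ∂(stringLaw ν), generationSum β p n ξ < ∞ := by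
  refine ae_lt_top (measurable_generationSum β p n) ?_
  rw [lintegral_generationSum]
  exact (ENNReal.mul_lt_top (ENNReal.pow_lt_top (hc.trans ENNReal.one_lt_top)) hlen).ne

lemma ofReal_toReal_rpow (hp : 0 < p) {a : ℝ≥0∞} (ha : a ≠ ∞) :
    ENNReal.ofReal ((a.toReal ^ (1 / p)) ^ p) = a := by
  rw [← Real.rpow_mul ENNReal.toReal_nonneg, one_div_mul_cancel hp.ne', Real.rpow_one,
    ENNReal.ofReal_toReal ha]

/-- The segments that distinguish the two trees belong to generation `n + 1`, hence the index of the
gap. The shifts preserve the law, so the induction hypothesis holds almost surely at all children at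
once and is carried to the root by `embedsDense_phi`. -/
lemma ae_embedsDense (hβ : 0 < β) (hp : 1 ≤ p)
    (hlen : ∫⁻ s, ENNReal.ofReal (s.len ^ p) ∂ν < ∞) (hc : massMoment β p ν < 1) (n : ℕ) :
    ∀ᵐ ξ ∂(stringLaw ν), EmbedsDense (recTree β ξ n) (recTree β ξ (n + 1))
      ((generationSum β p (n + 1) ξ).toReal ^ (1 / p)) := by
  have hp0 : 0 < p := one_pos.trans_le hp
  induction n with
  | zero =>
    filter_upwards [ae_isGraftable hβ hp hlen hc 0, ae_generationSum_lt_top hlen hc 1] with ξ h1 h2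
    rw [recTree_succ]
    refine embedsDense_segment h1 fun i => ?_
    simp only [recTree, subtree, height_segment]
    exact scale_mul_le_of_powerSum hp0 (fun i => (shift i ξ []).len_nonneg) h2.ne i
  | succ n ih =>
    have ih' : ∀ᵐ ξ ∂(stringLaw ν), ∀ j, EmbedsDense (recTree β (shift j ξ) n)
        (recTree β (shift j ξ) (n + 1))
        ((generationSum β p (n + 1) (shift j ξ)).toReal ^ (1 / p)) :=
      ae_all_iff.2 fun j => (measurePreserving_shift ν j).quasiMeasurePreserving.ae ih
    have hfin : ∀ᵐ ξ ∂(stringLaw ν), ∀ j, generationSum β p (n + 1) (shift j ξ) < ∞ :=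
      ae_all_iff.2 fun j => (measurePreserving_shift ν j).quasiMeasurePreserving.ae
        (ae_generationSum_lt_top hlen hc (n + 1))
    filter_upwards [ih', hfin, ae_isGraftable hβ hp hlen hc n, ae_isGraftable hβ hp hlen hc (n + 1),
      ae_generationSum_lt_top hlen hc (n + 2)] with ξ h1 h2 h3 h4 h5
    rw [recTree_succ β ξ n, recTree_succ β ξ (n + 1)]
    -- The sum is rewritten through the `p`-th powers of the gaps at the children, which are real
    -- numbers because their sums are finite.
    have hsum : generationSum β p (n + 2) ξ = powerSum β p (ξ []) fun j => ENNReal.ofReal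
        (((generationSum β p (n + 1) (shift j ξ)).toReal ^ (1 / p)) ^ p) := by
      rw [generationSum]
      congr 1
      funext j
      rw [ofReal_toReal_rpow hp0 (h2 j).ne]
    refine embedsDense_phi h3 h4 h1 (fun i => ?_) (Real.rpow_nonneg ENNReal.toReal_nonneg _)
    rw [hsum] at h5 ⊢
    exact scale_mul_le_of_powerSum hp0
      (fun j => Real.rpow_nonneg ENNReal.toReal_nonneg (1 / p)) h5.ne i

/-- Jensen's inequality on a probability space, in the form that `L^1` norms are at most `L^p`
norms. -/
lemma lintegral_rpow_one_div_le {A : Type*} [MeasurableSpace A] (κ : Measure A)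
    [IsProbabilityMeasure κ] (hp : 1 ≤ p) {g : A → ℝ≥0∞} (hg : Measurable g) :
    ∫⁻ a, g a ^ (1 / p) ∂κ ≤ (∫⁻ a, g a ∂κ) ^ (1 / p) := by
  have hp0 : 0 < p := one_pos.trans_le hp
  have := eLpNorm'_le_eLpNorm'_of_exponent_le one_pos hp κ
    (f := fun a => g a ^ (1 / p)) (hg.pow_const _).aestronglyMeasurable
  simpa only [eLpNorm', enorm_eq_self, ENNReal.rpow_one, ← ENNReal.rpow_mul,
    one_div_mul_cancel hp0.ne', div_one] using this

lemma ae_summable (hp : 1 ≤ p) (hlen : ∫⁻ s, ENNReal.ofReal (s.len ^ p) ∂ν < ∞)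
    (hc : massMoment β p ν < 1) : ∀ᵐ ξ ∂(stringLaw ν),
      Summable fun n => (generationSum β p (n + 1) ξ).toReal ^ (1 / p) := by
  have hp0 : 0 < p := one_pos.trans_le hp
  have hm : ∀ n, Measurable fun ξ => generationSum β p (n + 1) ξ ^ (1 / p) := fun n =>
    (measurable_generationSum β p (n + 1)).pow_const _
  have h1 : ∫⁻ ξ, ∑' n, generationSum β p (n + 1) ξ ^ (1 / p) ∂(stringLaw ν) ≠ ∞ := by
    rw [lintegral_tsum fun n => (hm n).aemeasurable]
    refine ((ENNReal.tsum_le_tsum fun n => lintegral_rpow_one_div_le (stringLaw ν) hp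
      (measurable_generationSum β p (n + 1))).trans_lt ?_).ne
    have h2 : ∀ n : ℕ, (∫⁻ ξ, generationSum β p (n + 1) ξ ∂(stringLaw ν)) ^ (1 / p) ≤
        (massMoment β p ν ^ (1 / p)) ^ n * (∫⁻ s, ENNReal.ofReal (s.len ^ p) ∂ν) ^ (1 / p) := by
      intro n
      have e : (massMoment β p ν ^ (1 / p)) ^ n = (massMoment β p ν ^ n) ^ (1 / p) := by
        rw [← ENNReal.rpow_natCast, ← ENNReal.rpow_mul, mul_comm, ENNReal.rpow_mul,
          ENNReal.rpow_natCast]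
      rw [lintegral_generationSum, ENNReal.mul_rpow_of_nonneg _ _ (by positivity), e]
      gcongr ?_ ^ _ * _
      -- One factor `massMoment β p ν ≤ 1` is dropped, which leaves a geometric series starting at
      -- `n = 0`.
      exact pow_le_pow_right_of_le_one' hc.le n.le_succ
    refine (ENNReal.tsum_le_tsum h2).trans_lt ?_
    rw [ENNReal.tsum_mul_right]
    exact ENNReal.mul_lt_top (tsum_pow_lt_top (massMoment_rpow_lt_one hp0 hc))
      (ENNReal.rpow_lt_top_of_nonneg (by positivity) hlen.ne)
  filter_upwards [ae_lt_top (Measurable.tsum hm) h1] with ξ hξ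
  simpa only [ENNReal.toReal_rpow] using ENNReal.summable_toReal hξ.ne

lemma exists_limit (hβ : 0 < β) (hp : 1 ≤ p)
    (hlen : ∫⁻ s, ENNReal.ofReal (s.len ^ p) ∂ν < ∞) (hc : massMoment β p ν < 1) :
    ∃ T : (List ℕ → BeadString) → TreeSpace, Measurable T ∧
      ∀ᵐ ξ ∂(stringLaw ν), Tendsto (fun n => recTree β ξ n) atTop (𝓝 (T ξ)) := by
  refine measurable_limit_of_tendsto_metrizable_ae
    (fun n => (measurable_recTree hβ n).aemeasurable) ?_
  filter_upwards [ae_all_iff.2 fun n => ae_embedsDense hβ hp hlen hc n, ae_summable hp hlen hc]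
    with ξ h1 h2
  exact exists_tendsto_of_embedsDense h2 h1 fun n => isHyp_subtree β ξ n []

/-! ### The fixpoint -/

lemma measurable_ofReal_dist_comp {A : Type*} [MeasurableSpace A] (p : ℝ) {f g : A → TreeSpace}
    (hf : Measurable f) (hg : Measurable g) :
    Measurable fun a => ENNReal.ofReal (dist (f a) (g a) ^ p) := by
  have h := (measurable_ofReal_dist_rpow p).comp (hf.prodMk hg)
  exact h

lemma lintegral_dist_phi_shift_le (hp : 0 < p) {R R' : (List ℕ → BeadString) → TreeSpace}
    (hR : Measurable R) (hR' : Measurable R') :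
    ∫⁻ ξ, ENNReal.ofReal (dist (phi β (ξ []) fun j => R (shift j ξ))
        (phi β (ξ []) fun j => R' (shift j ξ)) ^ p) ∂(stringLaw ν) ≤
      massMoment β p ν * ∫⁻ ξ, ENNReal.ofReal (dist (R ξ) (R' ξ) ^ p) ∂(stringLaw ν) := by
  have hm : Measurable fun ξ => ENNReal.ofReal (dist (R ξ) (R' ξ) ^ p) :=
    measurable_ofReal_dist_comp p hR hR'
  have h := lintegral_powerSum_shift ν β p hm
  rw [← h]
  exact lintegral_mono fun ξ => ofReal_dist_phi_le hp _ _ _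

/-- Both trees have the same strings in their first `n` generations, so the contraction applies `n`
times and leaves the initial pair of depths `0` and `m`, bounded by height moments. -/
lemma lintegral_dist_recTree_le (hβ : 0 < β) (hp : 1 ≤ p) (n m : ℕ) :
    ∫⁻ ξ, ENNReal.ofReal (dist (recTree β ξ n) (recTree β ξ (m + n)) ^ p) ∂(stringLaw ν) ≤
      massMoment β p ν ^ n * (momentBound β p ν + momentBound β p ν) := by
  have hp0 : 0 < p := one_pos.trans_le hp
  induction n with
  | zero =>
    rw [pow_zero, one_mul]
    exact (lintegral_ofReal_dist_rpow_le _ hp0 (measurable_recTree hβ 0)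
      (measurable_recTree hβ (m + 0))).trans
      (add_le_add (heightMoment_recTree_le hβ hp 0) (heightMoment_recTree_le hβ hp (m + 0)))
  | succ n ih =>
    have h := lintegral_dist_phi_shift_le (β := β) (ν := ν) hp0 (measurable_recTree hβ n)
      (measurable_recTree hβ (m + n))
    rw [pow_succ', mul_assoc, ← add_assoc]
    simp only [recTree_succ]
    exact h.trans (by gcongr)

section limit

variable {T : (List ℕ → BeadString) → TreeSpace}

/-- Fatou's lemma applied to the preceding bound as `m` tends to infinity. -/
lemma lintegral_dist_limit_le (hβ : 0 < β) (hp : 1 ≤ p)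
    (hT : ∀ᵐ ξ ∂(stringLaw ν), Tendsto (fun n => recTree β ξ n) atTop (𝓝 (T ξ))) (n : ℕ) :
    ∫⁻ ξ, ENNReal.ofReal (dist (recTree β ξ n) (T ξ) ^ p) ∂(stringLaw ν) ≤
      massMoment β p ν ^ n * (momentBound β p ν + momentBound β p ν) := by
  have hp0 : 0 < p := one_pos.trans_le hp
  have h1 : ∀ᵐ ξ ∂(stringLaw ν), ENNReal.ofReal (dist (recTree β ξ n) (T ξ) ^ p) =
      liminf (fun m => ENNReal.ofReal (dist (recTree β ξ n) (recTree β ξ (m + n)) ^ p)) atTop := by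
    filter_upwards [hT] with ξ hξ
    have h2 := (tendsto_const_nhds (x := recTree β ξ n)).dist (hξ.comp (tendsto_add_atTop_nat n))
    exact (ENNReal.tendsto_ofReal (h2.rpow_const (Or.inr hp0.le))).liminf_eq.symm
  rw [lintegral_congr_ae h1]
  refine (lintegral_liminf_le fun m => measurable_ofReal_dist_comp p (measurable_recTree hβ n)
    (measurable_recTree hβ (m + n))).trans ?_
  refine liminf_le_of_le isBounded_ge_of_bot fun b hb => ?_
  obtain ⟨m, hm⟩ := hb.exists
  exact hm.trans (lintegral_dist_recTree_le hβ hp n m)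

lemma heightMoment_limit_le (hβ : 0 < β) (hp : 1 ≤ p) (hTm : Measurable T)
    (hT : ∀ᵐ ξ ∂(stringLaw ν), Tendsto (fun n => recTree β ξ n) atTop (𝓝 (T ξ))) :
    heightMoment p ((stringLaw ν).map T) ≤ momentBound β p ν := by
  have hp0 : 0 < p := one_pos.trans_le hp
  have h1 : ∀ᵐ ξ ∂(stringLaw ν), ENNReal.ofReal (height (T ξ) ^ p) =
      liminf (fun m => ENNReal.ofReal (height (recTree β ξ m) ^ p)) atTop := by
    filter_upwards [hT] with ξ hξ
    have h2 := (continuous_height.tendsto _).comp hξ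
    exact (ENNReal.tendsto_ofReal (h2.rpow_const (Or.inr hp0.le))).liminf_eq.symm
  rw [heightMoment, lintegral_map (measurable_ofReal_height_rpow p) hTm, lintegral_congr_ae h1]
  refine (lintegral_liminf_le fun m => (measurable_ofReal_height_rpow p).comp
    (measurable_recTree hβ m)).trans ?_
  refine liminf_le_of_le isBounded_ge_of_bot fun b hb => ?_
  obtain ⟨m, hm⟩ := hb.exists
  refine hm.trans (le_trans (le_of_eq ?_) (heightMoment_recTree_le hβ hp m))
  rw [heightMoment, lintegral_map (measurable_ofReal_height_rpow p) (measurable_recTree hβ m)]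
  rfl

lemma ofReal_dist_rpow_triangle {p : ℝ} (hp : 0 < p) (x y z : TreeSpace) :
    ENNReal.ofReal (dist x z ^ p) ≤ ENNReal.ofReal (2 ^ p) *
      (ENNReal.ofReal (dist y x ^ p) + ENNReal.ofReal (dist y z ^ p)) := by
  rw [← ENNReal.ofReal_add (by positivity) (by positivity), ← ENNReal.ofReal_mul (by positivity)]
  refine ENNReal.ofReal_le_ofReal ?_
  have h1 := dist_triangle_left x z y
  have n1 : 0 ≤ dist y x ^ p := by positivity
  have n2 : 0 ≤ dist y z ^ p := by positivity
  have n3 : (0 : ℝ) < 2 ^ p := by positivity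
  rcases le_total (dist y x) (dist y z) with h | h
  · have := Real.rpow_le_rpow dist_nonneg (show dist x z ≤ 2 * dist y z by linarith) hp.le
    rw [Real.mul_rpow (by norm_num) dist_nonneg] at this
    nlinarith
  · have := Real.rpow_le_rpow dist_nonneg (show dist x z ≤ 2 * dist y x by linarith) hp.le
    rw [Real.mul_rpow (by norm_num) dist_nonneg] at this
    nlinarith

lemma Phi_map_limit (hβ : 0 < β) (hp : 1 ≤ p)
    (hlen : ∫⁻ s, ENNReal.ofReal (s.len ^ p) ∂ν < ∞) (hc : massMoment β p ν < 1)
    (hTm : Measurable T)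
    (hT : ∀ᵐ ξ ∂(stringLaw ν), Tendsto (fun n => recTree β ξ n) atTop (𝓝 (T ξ))) :
    Phi β ν ((stringLaw ν).map T) = (stringLaw ν).map T := by
  have hp0 : 0 < p := one_pos.trans_le hp
  -- `T'` grafts the limits of the first generation onto the root string. Both `T'` and `T` are
  -- compared with `recTree β ξ (n + 1)`: the contraction handles `T'`, so no continuity of `phi` is
  -- required.
  let T' : (List ℕ → BeadString) → TreeSpace := fun ξ => phi β (ξ []) fun j => T (shift j ξ)
  have hT'm : Measurable T' := measurable_phi_comp hβ (measurable_pi_apply []) fun j =>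
    hTm.comp (measurable_shift j)
  have hlaw : (stringLaw ν).map T' = Phi β ν ((stringLaw ν).map T) := by
    have hm : Measurable fun ξ : List ℕ → BeadString => (ξ [], fun j => T (shift j ξ)) :=
      (measurable_pi_apply []).prodMk (measurable_pi_iff.2 fun j => hTm.comp (measurable_shift j))
    rw [Phi, ← map_branching ν hTm, Measure.map_map (measurable_phi hβ) hm]
    rfl
  rw [← hlaw]
  have := Measure.isProbabilityMeasure_map (μ := stringLaw ν) hTm.aemeasurable
  have := Measure.isProbabilityMeasure_map (μ := stringLaw ν) hT'm.aemeasurable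
  set K := momentBound β p ν + momentBound β p ν with hK
  have hKtop : K < ∞ := ENNReal.add_lt_top.2 ⟨momentBound_lt_top hp0 hlen hc,
    momentBound_lt_top hp0 hlen hc⟩
  have hdm : ∀ n, Measurable fun ξ => ENNReal.ofReal (dist (recTree β ξ n) (T ξ) ^ p) := fun n =>
    measurable_ofReal_dist_comp p (measurable_recTree hβ n) hTm
  have hdm' : ∀ n, Measurable fun ξ => ENNReal.ofReal (dist (recTree β ξ n) (T' ξ) ^ p) := fun n =>
    measurable_ofReal_dist_comp p (measurable_recTree hβ n) hT'm
  have h1 : ∀ n, ∫⁻ ξ, ENNReal.ofReal (dist (recTree β ξ (n + 1)) (T' ξ) ^ p) ∂(stringLaw ν) ≤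
      massMoment β p ν ^ (n + 1) * K := fun n => by
    have h3 := lintegral_dist_phi_shift_le (β := β) (ν := ν) hp0 (measurable_recTree hβ n) hTm
    simp only [recTree_succ]
    rw [pow_succ', mul_assoc]
    refine h3.trans ?_
    gcongr
    exact lintegral_dist_limit_le hβ hp hT n
  have hcost : ∀ n, couplingCost p ((stringLaw ν).map fun ξ => (T' ξ, T ξ)) ≤
      ENNReal.ofReal (2 ^ p) * (massMoment β p ν ^ (n + 1) * K + massMoment β p ν ^ (n + 1) * K) :=
    fun n => by
      rw [couplingCost, lintegral_map (measurable_ofReal_dist_rpow p) (hT'm.prodMk hTm)]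
      refine (lintegral_mono fun ξ => ofReal_dist_rpow_triangle hp0 _ (recTree β ξ (n + 1)) _).trans
        ?_
      rw [lintegral_const_mul' _ _ ENNReal.ofReal_ne_top]
      gcongr
      refine (lintegral_add_left (hdm' (n + 1)) _).trans_le ?_
      gcongr
      · exact h1 n
      · exact lintegral_dist_limit_le hβ hp hT (n + 1)
  have hlim : Tendsto (fun n => ENNReal.ofReal (2 ^ p) *
      (massMoment β p ν ^ (n + 1) * K + massMoment β p ν ^ (n + 1) * K)) atTop (𝓝 0) := by
    have h2 := (ENNReal.tendsto_pow_atTop_nhds_zero_of_lt_one hc).comp (tendsto_add_atTop_nat 1)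
    have h3 := ENNReal.Tendsto.mul_const h2 (Or.inr hKtop.ne)
    have h4 := ENNReal.Tendsto.const_mul (h3.add h3) (Or.inr (ENNReal.ofReal_ne_top (r := 2 ^ p)))
    simpa using h4
  -- The joint law of `T'` and `T` is a coupling of cost zero. Since the distance is treated as a
  -- pseudo-metric, equality is concluded for the laws and not for the trees.
  have hzero := le_antisymm (ge_of_tendsto' hlim hcost) bot_le
  refine eq_of_couplingCost hp0 fun ε hε =>
    ⟨(stringLaw ν).map fun ξ => (T' ξ, T ξ), ?_, ?_, hzero.trans_le hε.le⟩
  · rw [Measure.map_map measurable_fst (hT'm.prodMk hTm)]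
    rfl
  · rw [Measure.map_map measurable_snd (hT'm.prodMk hTm)]
    rfl

end limit

/-- A fixpoint with a finite height moment is unique and attractive. -/
lemma isUniqueAttractiveFixpoint_of_fixed (hβ : 0 < β) (hp : 0 < p) (hc : massMoment β p ν < 1)
    {ηs : Measure TreeSpace} (hmem : ηs ∈ finiteMomentLaws p) (hfix : Phi β ν ηs = ηs) :
    IsUniqueAttractiveFixpoint β p ν ηs := by
  have := hmem.1
  have hcoup : ∀ η ∈ finiteMomentLaws p, ∃ (K : ℝ≥0∞) (γ : ℕ → Measure (TreeSpace × TreeSpace)),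
      K ≠ ∞ ∧ ∀ n, (γ n).map Prod.fst = (Phi β ν)^[n] η ∧ (γ n).map Prod.snd = ηs ∧
        couplingCost p (γ n) ≤ massMoment β p ν ^ n * K := by
    intro η hη
    have := hη.1
    -- The iteration starts from the independent coupling, whose cost is finite by the height
    -- moments; its second marginal stays at the fixpoint.
    refine ⟨couplingCost p (η.prod ηs), fun n => (couplingMap β ν)^[n] (η.prod ηs),
      ((couplingCost_prod_le hp η ηs).trans_lt (ENNReal.add_lt_top.2 ⟨hη.2, hmem.2⟩)).ne,
      fun n => ?_⟩
    obtain ⟨-, h1, h2, h3⟩ := iterate_couplingMap (ν := ν) hβ hp (η.prod ηs) n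
    refine ⟨?_, ?_, h3⟩
    · rw [h1, ← Measure.fst, Measure.fst_prod]
    · rw [h2, ← Measure.snd, Measure.snd_prod]
      exact Function.iterate_fixed hfix n
  have hlim : ∀ K : ℝ≥0∞, K ≠ ∞ → Tendsto (fun n => massMoment β p ν ^ n * K) atTop (𝓝 0) :=
    fun K hK => by
      simpa using ENNReal.Tendsto.mul_const (ENNReal.tendsto_pow_atTop_nhds_zero_of_lt_one hc)
        (Or.inr hK)
  refine ⟨hmem, hfix, fun η hη hηfix => ?_, fun η hη => ?_⟩
  · have := hη.1
    obtain ⟨K, γ, hK, hγ⟩ := hcoup η hη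
    refine eq_of_couplingCost hp fun ε hε => ?_
    obtain ⟨n, hn⟩ := ((hlim K hK).eventually (gt_mem_nhds hε)).exists
    obtain ⟨h1, h2, h3⟩ := hγ n
    exact ⟨γ n, h1.trans (Function.iterate_fixed hηfix n), h2, h3.trans hn.le⟩
  · obtain ⟨K, γ, hK, hγ⟩ := hcoup η hη
    have h0 := ((hlim K hK).ennrpow_const (1 / p))
    rw [ENNReal.zero_rpow_of_pos (by positivity)] at h0
    refine tendsto_of_tendsto_of_tendsto_of_le_of_le tendsto_const_nhds h0 (fun _ => bot_le)
      fun n => ?_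
    obtain ⟨h1, h2, h3⟩ := hγ n
    exact (wasserstein_le hp h1 h2).trans (ENNReal.rpow_le_rpow h3 (by positivity))

end

end StringTree

end

/-! ### Transfer to an arbitrary probability space. -/

theorem mainTheorem2 {Ω : Type*} [MeasurableSpace Ω] (μ : Measure Ω) [IsProbabilityMeasure μ]
    (β p : ℝ) (hβ : 0 < β) (hp : 1 ≤ p)
    (ν : Measure StringTree.BeadString) [IsProbabilityMeasure ν]
    (hlen : ∫⁻ s, ENNReal.ofReal (s.len ^ p) ∂ν < ∞)
    (hmass : ∫⁻ s, ∑' j, ENNReal.ofReal (s.mass j ^ (p * β)) ∂ν < 1)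
    (ξ : List ℕ → Ω → StringTree.BeadString)
    (hξ_meas : ∀ i, Measurable (ξ i))
    (hξ_law : ∀ i, μ.map (ξ i) = ν)
    (hξ_indep : iIndepFun ξ μ) :
    (∀ n, Measurable fun ω => StringTree.recTree β (fun i => ξ i ω) n) ∧
    (∀ᵐ ω ∂μ, ∀ n, StringTree.Embeds (StringTree.recTree β (fun i => ξ i ω) n)
      (StringTree.recTree β (fun i => ξ i ω) (n + 1))) ∧
    ∃ T : Ω → StringTree.TreeSpace, Measurable T ∧
      (∀ᵐ ω ∂μ, Tendsto
        (fun n => StringTree.dGH (StringTree.recTree β (fun i => ξ i ω) n) (T ω)) atTop (𝓝 0)) ∧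
      StringTree.IsUniqueAttractiveFixpoint β p ν (μ.map T) := by
  have hp0 : 0 < p := one_pos.trans_le hp
  have hm : Measurable fun ω i => ξ i ω := measurable_pi_iff.2 hξ_meas
  -- Independence and the common law identify the distribution of the whole family with the product
  -- measure, so almost sure statements and laws are pulled back from the canonical space.
  have hpres : MeasurePreserving (fun ω i => ξ i ω) μ (StringTree.stringLaw ν) := by
    refine ⟨hm, ?_⟩
    rw [(iIndepFun_iff_map_fun_eq_infinitePi_map₀ hm.aemeasurable).1 hξ_indep]
    simp only [hξ_law]
    rfl
  obtain ⟨T, hTm, hT⟩ := StringTree.exists_limit (ν := ν) hβ hp hlen hmass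
  refine ⟨fun n => (StringTree.measurable_recTree hβ n).comp hm, ?_, fun ω => T fun i => ξ i ω,
    hTm.comp hm, ?_, ?_⟩
  · refine ae_all_iff.2 fun n => hpres.quasiMeasurePreserving.ae
      (p := fun ζ => StringTree.Embeds (StringTree.recTree β ζ n) (StringTree.recTree β ζ (n + 1))) ?_
    filter_upwards [StringTree.ae_embedsDense (ν := ν) hβ hp hlen hmass n] with ζ hζ
    exact hζ.embeds
  · filter_upwards [hpres.quasiMeasurePreserving.ae hT] with ω hω
    exact squeeze_zero (fun n => StringTree.dGH_nonneg _ _) (fun n => StringTree.dGH_le_dist _ _)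
      (tendsto_iff_dist_tendsto_zero.1 hω)
  · have hlaw : μ.map (fun ω => T fun i => ξ i ω) = (StringTree.stringLaw ν).map T := by
      rw [← hpres.map_eq, Measure.map_map hTm hm]
      rfl
    rw [hlaw]
    refine StringTree.isUniqueAttractiveFixpoint_of_fixed hβ hp0 hmass
      ⟨Measure.isProbabilityMeasure_map hTm.aemeasurable, ?_⟩
      (StringTree.Phi_map_limit hβ hp hlen hmass hTm hT)
    exact (StringTree.heightMoment_limit_le hβ hp hTm hT).trans_lt
      (StringTree.momentBound_lt_top hp0 hlen hmass)
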